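/- **Conventions.** A simplicial category is a category enriched in simplicial sets; $\mathrm{Map}(X,Y)$ is its mapping space, a map $X\to Y$ is a vertex of it, and a homotopy is an edge. Two objects $X,Y$ are equivalent, $X\simeq Y$, if there are maps in both directions whose composites are homotopic to the identities. A homotopy commutative square with sides $Z\to X$, $Z\to Y$, $X\to M$, $Y\to M$ is a homotopy pullback, written $Z=X\times_M Y$, if $\mathrm{Map}(T,Z)\to \mathrm{Map}(T,X)\times^h_{\mathrm{Map}(T,M)}\mathrm{Map}(T,Y)$ is a weak equivalence for every object $T$; homotopy pushouts, products and terminal objects are defined similarly. $\mathbf{Man}$ is the category of smooth manifolds (Hausdorff, second countable, finite-dimensional, without boundary) and smooth maps, and $\mathbf{CG}$ the category of compactly generated Hausdorff spaces; both are discrete as simplicial categories. A simplicial category $\mathbf{dM}$ is *geometric* if: 1. all its mapping spaces are Kan complexes; 2. there is a fully faithful functor $\mathbf i:\mathbf{Man}\to\mathbf{dM}$ (i.e. $\mathrm{Hom}(M,N)\to\mathrm{Map}(\mathbf iM,\mathbf iN)$ is a weak equivalence, $\mathrm{Hom}(M,N)$ being discrete); we write $M$ for $\mathbf i(M)$; 3.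 $\mathbf i$ sends the fibre product of any two transverse maps $f:A\to M$, $g:B\to M$ (that is, $\operatorname{im} df_a+\operatorname{im} dg_b=T_{f(a)}M$ whenever $f(a)=g(b)$) to a homotopy pullback, and $\mathbb R^0$ is homotopy terminal in $\mathbf{dM}$; 4. there is an underlying space functor $\mathbf U:\mathbf{dM}\to\mathbf{CG}$ which extends the usual one on $\mathbf{Man}$ and takes homotopy pullbacks to pullbacks. Topological properties of objects and maps of $\mathbf{dM}$ (compact, proper, ...) are those of their underlying spaces and maps. A map $k:\mathcal V\to\mathcal X$ is an *open subobject* (over its image) if $\mathbf U(k)$ is an open embedding and, for each map $\varphi:\mathcal T\to\mathcal X$ with $\operatorname{im}\mathbf U(\varphi)\subseteq\operatorname{im}\mathbf U(k)$, the space of factorizations of $\varphi$ through $k$ is contractible. A *union* of $\mathcal X$ and $\mathcal Y$ along open subobjects $\mathcal W\to\mathcal X$ and $\mathcal W\to\mathcal Y$ is an object $\mathcal P$ with open subobjects $\mathcal X\to\mathcal P$, $\mathcal Y\to\mathcal P$ such that the resulting square commutes up to homotopy and is a pushout of underlying spaces. For $f:\mathcal Y\to\mathbb R^n$ let $\mathcal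 Y_{f=0}=\mathcal Y\times_{\mathbb R^n}\mathbb R^0$; its inclusion into $\mathcal Y$ is called a *model imbedding*. A map $g:\mathcal X\to\mathcal Y$ is an *imbedding* if $\mathcal Y$ has a cover by open subobjects $\mathcal Y_i$ such that each restriction $g^{-1}(\mathcal Y_i)\to\mathcal Y_i$ is a model imbedding. The category $\mathbf{dM}$ is *good for doing intersection theory on manifolds* if it is geometric and: 1. (open subobjects) for every object $\mathcal X$ there is an open subobject over each open subset of $\mathbf U(\mathcal X)$; 2. (unions) if $\mathcal U\to\mathcal X$ and $\mathcal V\to\mathcal Y$ are open subobjects and $a:\mathcal U\to\mathcal V$ is an equivalence such that the space obtained by gluing $\mathbf U(\mathcal X)$ and $\mathbf U(\mathcal Y)$ along $a$ is Hausdorff, then a union of $\mathcal X$ and $\mathcal Y$ along $a$ exists; and every union is a homotopy pushout, so that maps which agree on $\mathcal U$ glue; 3. (finite limits) $\mathcal X\times_M\mathcal Y$ exists for all objects $\mathcal X,\mathcal Y$ over a manifold $M$; 4. (local models) for every $\mathcal X$, any open cover of $\mathbf U(\mathcal X)$ has a refinement to an open cover whose open subobjects are equivalent to objects $\mathbb R^n_{f=0}$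 with $f:\mathbb R^n\to\mathbb R^k$ smooth; 5. (extensions) if $g:\mathcal X\to\mathcal Y$ is an imbedding and $h:\mathcal X\to\mathbb R$ a map, then $h\simeq h'\circ g$ for some $h':\mathcal Y\to\mathbb R$; 6. (normal bundles) if $g:\mathcal X\to M$ is an imbedding into a manifold, there are an open neighbourhood $U$ of the image of $g$ in $M$, a smooth vector bundle $E\to U$ (its rank may vary from one open and closed part of $U$ to another) and a smooth section $s$ of $E$ such that $\mathcal X$ is the homotopy pullback of $s$ and the zero section, both projections $\mathcal X\to U$ being given by $g$; and the bundle $g^*E$ on $\mathbf U(\mathcal X)$ is unique up to isomorphism. A map $f:\mathcal X\to\mathbb R$ is *$c$-collared*, for $c\in\mathbb R$, if for some $\epsilon>0$ there is an equivalence $\mathcal X_{|f-c|<\epsilon}\simeq\mathcal X_{f=c}\times(-\epsilon,\epsilon)$ under which $f$ corresponds, up to homotopy, to $(z,t)\mapsto c+t$; here $\mathcal X_{|f-c|<\epsilon}$ is the open subobject over $\{|f-c|<\epsilon\}$ and $\mathcal X_{f=c}=\mathcal X\times_{\mathbb R}\{c\}$. Compact objects $\mathcal Z_0,\mathcal Z_1$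 are *derived cobordant* if there are an object $\mathcal X$ and a proper map $f:\mathcal X\to\mathbb R$ such that, for $c=0$ and for $c=1$, the map $f$ is $c$-collared and $\mathcal Z_c\simeq\mathcal X_{f=c}$. **Proposition 3.10.** Let $\mathbf{dM}$ be a simplicial category that is good for doing intersection theory on manifolds. Then derived cobordism is an equivalence relation on the compact objects of $\mathbf{dM}$. -/

import Mathlib

universe v u

open CategoryTheory MonoidalCategory Limits Simplicial Opposite
open scoped ContDiff

noncomputable section

namespace DerivedCobordism

/-! ## Homotopy theory of simplicial sets

All simplicial sets to which the notions below are applied are Kan complexes, so that weak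
equivalences are the same thing as homotopy equivalences. -/

/-- `f` is a homotopy equivalence of simplicial sets. -/
def IsHomotopyEquivalence {K L : SSet.{v}} (f : K ⟶ L) : Prop :=
  ∃ g : L ⟶ K, Nonempty (SSet.Homotopy (f ≫ g) (𝟙 K)) ∧ Nonempty (SSet.Homotopy (g ≫ f) (𝟙 L))

/-- `K` is contractible: it is homotopy equivalent to the point. -/
def IsContractible (K : SSet.{v}) : Prop :=
  IsHomotopyEquivalence (SemiCartesianMonoidalCategory.toUnit K)

/-- The map from the discrete simplicial set on `S` determined by a family of vertices. -/
def ofVertices {S : Type v} {K : SSet.{v}} (σ : S → K _⦋0⦌) :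
    (SimplicialObject.const (Type v)).obj S ⟶ K where
  app n := ↾fun s => K.map (SimplexCategory.const n.unop ⦋0⦌ 0).op (σ s)
  naturality n m f := by
    ext s
    dsimp
    rw [← Functor.map_comp_apply]
    rfl

/-- The space of paths `L ^ Δ[1]`. -/
abbrev pathSpace (L : SSet.{v}) : SSet.{v} := (ihom Δ[1]).obj L

/-- The starting point of a path. -/
def pathStart (L : SSet.{v}) : pathSpace L ⟶ L :=
  SSet.ι₀ ≫ (β_ _ _).hom ≫ (ihom.ev Δ[1]).app L

/-- The end point of a path. -/
def pathEnd (L : SSet.{v}) : pathSpace L ⟶ L :=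
  SSet.ι₁ ≫ (β_ _ _).hom ≫ (ihom.ev Δ[1]).app L

/-- A homotopy `K × Δ[1] ⟶ L`, seen as a map from `K` to the space of paths of `L`. -/
def toPathSpace {K L : SSet.{v}} (h : K ⊗ Δ[1] ⟶ L) : K ⟶ pathSpace L :=
  MonoidalClosed.curry ((β_ _ _).hom ≫ h)

lemma toPathSpace_ev {K L : SSet.{v}} (h : K ⊗ Δ[1] ⟶ L) :
    toPathSpace h ▷ Δ[1] ≫ (β_ _ _).hom ≫ (ihom.ev Δ[1]).app L = h := by
  rw [BraidedCategory.braiding_naturality_left_assoc, toPathSpace,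
    MonoidalClosed.whiskerLeft_curry_ihom_ev_app, SymmetricCategory.symmetry_assoc]

lemma toPathSpace_start {K L : SSet.{v}} (h : K ⊗ Δ[1] ⟶ L) :
    toPathSpace h ≫ pathStart L = SSet.ι₀ ≫ h := by
  rw [pathStart, ← SSet.ι₀_comp_assoc, toPathSpace_ev]

lemma toPathSpace_end {K L : SSet.{v}} (h : K ⊗ Δ[1] ⟶ L) :
    toPathSpace h ≫ pathEnd L = SSet.ι₁ ≫ h := by
  rw [pathEnd, ← SSet.ι₁_comp_assoc, toPathSpace_ev]

/-- The homotopy pullback `K ×ʰ_L M`: triples of a point `k` of `K`, a path in `L` from `f k` to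
`g m`, and a point `m` of `M`. -/
def hPullback {K L M : SSet.{v}} (f : K ⟶ L) (g : M ⟶ L) : SSet.{v} :=
  pullback (pullback.snd f (pathStart L) ≫ pathEnd L) g

/-- The map to a homotopy pullback given by `a`, `b` and a homotopy between `a ≫ f` and
`b ≫ g`. -/
def hPullbackLift {T K L M : SSet.{v}} {f : K ⟶ L} {g : M ⟶ L} (a : T ⟶ K) (b : T ⟶ M)
    (h : T ⊗ Δ[1] ⟶ L) (h₀ : SSet.ι₀ ≫ h = a ≫ f) (h₁ : SSet.ι₁ ≫ h = b ≫ g) :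
    T ⟶ hPullback f g :=
  pullback.lift (pullback.lift a (toPathSpace h) (by rw [toPathSpace_start, h₀])) b
    (by rw [pullback.lift_snd_assoc, toPathSpace_end, h₁])

lemma const_zero_edge {K X : SSet.{v}} (s : K _⦋1⦌) :
    (SSet.const (SSet.stdSimplex.obj₀Equiv.symm 0) : X ⟶ Δ[1]) ≫ SSet.yonedaEquiv.symm s =
      SSet.const (K.δ 1 s) := by
  have h : SSet.stdSimplex.obj₀Equiv.{v}.symm 0 =
      SSet.stdSimplex.objEquiv.symm (SimplexCategory.δ 1) := by decide
  rw [SSet.const_comp, h]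
  rfl

lemma const_one_edge {K X : SSet.{v}} (s : K _⦋1⦌) :
    (SSet.const (SSet.stdSimplex.obj₀Equiv.symm 1) : X ⟶ Δ[1]) ≫ SSet.yonedaEquiv.symm s =
      SSet.const (K.δ 0 s) := by
  have h : SSet.stdSimplex.obj₀Equiv.{v}.symm 1 =
      SSet.stdSimplex.objEquiv.symm (SimplexCategory.δ 0) := by decide
  rw [SSet.const_comp, h]
  rfl

lemma toUnit_comp_eq_const {K X : SSet.{v}} (g : 𝟙_ SSet.{v} ⟶ K) :
    SemiCartesianMonoidalCategory.toUnit X ≫ g = SSet.const (K.unitHomEquiv g) := by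
  conv_lhs => rw [← K.unitHomEquiv.symm_apply_apply g]
  rfl

/-! ## Homotopies, equivalences and homotopy limits in a simplicial category -/

section SimplicialCategory

variable {C : Type u} [Category.{v} C] [SimplicialCategory C]

open SimplicialCategory

/-- A homotopy between two maps: an edge of the mapping space. -/
abbrev Htpy {X Y : C} (f g : X ⟶ Y) : Type v := SSet.Edge (homEquiv' X Y f) (homEquiv' X Y g)

/-- Two maps are homotopic. In all cases below, mapping spaces are Kan complexes, and this is an
equivalence relation. -/
def Homotopic {X Y : C} (f g : X ⟶ Y) : Prop := Nonempty (Htpy f g)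

/-- `f` is an equivalence: it has an inverse up to homotopy. -/
def IsEquivalence {X Y : C} (f : X ⟶ Y) : Prop :=
  ∃ g : Y ⟶ X, Homotopic (f ≫ g) (𝟙 X) ∧ Homotopic (g ≫ f) (𝟙 Y)

/-- The objects `X` and `Y` are equivalent. -/
def Equivalent (X Y : C) : Prop := ∃ f : X ⟶ Y, IsEquivalence f

/-- Composition with a homotopy `η` between maps `P ⟶ M`, as a homotopy between maps
`Map(T, P) ⟶ Map(T, M)`. -/
def postHtpy (T : C) {P M : C} {f g : P ⟶ M} (η : Htpy f g) : sHom T P ⊗ Δ[1] ⟶ sHom T M :=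
  sHom T P ◁ SSet.yonedaEquiv.symm η.edge ≫ sHomComp T P M

lemma ι₀_postHtpy (T : C) {P M : C} {f g : P ⟶ M} (η : Htpy f g) :
    SSet.ι₀ ≫ postHtpy T η = eHomWhiskerLeft SSet T f := by
  have h : SSet.ι₀ ≫ sHom T P ◁ SSet.yonedaEquiv.symm η.edge =
      (ρ_ _).inv ≫ sHom T P ◁ eHomEquiv SSet f := by
    apply CartesianMonoidalCategory.hom_ext
    · rfl
    · have e := toUnit_comp_eq_const (X := sHom T P) (eHomEquiv SSet f)
      have e' := const_zero_edge (X := sHom T P) η.edge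
      rw [SSet.Edge.src_eq] at e'
      exact e'.trans e.symm
  rw [postHtpy, reassoc_of% h]
  rfl

lemma ι₁_postHtpy (T : C) {P M : C} {f g : P ⟶ M} (η : Htpy f g) :
    SSet.ι₁ ≫ postHtpy T η = eHomWhiskerLeft SSet T g := by
  have h : SSet.ι₁ ≫ sHom T P ◁ SSet.yonedaEquiv.symm η.edge =
      (ρ_ _).inv ≫ sHom T P ◁ eHomEquiv SSet g := by
    apply CartesianMonoidalCategory.hom_ext
    · rfl
    · have e := toUnit_comp_eq_const (X := sHom T P) (eHomEquiv SSet g)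
      have e' := const_one_edge (X := sHom T P) η.edge
      rw [SSet.Edge.tgt_eq] at e'
      exact e'.trans e.symm
  rw [postHtpy, reassoc_of% h]
  rfl

/-- Composition with a homotopy `η` between maps `M ⟶ P`, as a homotopy between maps
`Map(P, T) ⟶ Map(M, T)`. -/
def preHtpy (T : C) {P M : C} {f g : M ⟶ P} (η : Htpy f g) : sHom P T ⊗ Δ[1] ⟶ sHom M T :=
  (β_ _ _).hom ≫ SSet.yonedaEquiv.symm η.edge ▷ sHom P T ≫ sHomComp M P T

lemma ι₀_preHtpy (T : C) {P M : C} {f g : M ⟶ P} (η : Htpy f g) :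
    SSet.ι₀ ≫ preHtpy T η = eHomWhiskerRight SSet f T := by
  have h : SSet.ι₀ ≫ (β_ _ _).hom ≫ SSet.yonedaEquiv.symm η.edge ▷ sHom P T =
      (λ_ _).inv ≫ eHomEquiv SSet f ▷ sHom P T := by
    apply CartesianMonoidalCategory.hom_ext
    · have e := toUnit_comp_eq_const (X := sHom P T) (eHomEquiv SSet f)
      have e' := const_zero_edge (X := sHom P T) η.edge
      rw [SSet.Edge.src_eq] at e'
      exact e'.trans e.symm
    · rfl
  rw [preHtpy, reassoc_of% h]
  rfl

lemma ι₁_preHtpy (T : C) {P M : C} {f g : M ⟶ P} (η : Htpy f g) :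
    SSet.ι₁ ≫ preHtpy T η = eHomWhiskerRight SSet g T := by
  have h : SSet.ι₁ ≫ (β_ _ _).hom ≫ SSet.yonedaEquiv.symm η.edge ▷ sHom P T =
      (λ_ _).inv ≫ eHomEquiv SSet g ▷ sHom P T := by
    apply CartesianMonoidalCategory.hom_ext
    · have e := toUnit_comp_eq_const (X := sHom P T) (eHomEquiv SSet g)
      have e' := const_one_edge (X := sHom P T) η.edge
      rw [SSet.Edge.tgt_eq] at e'
      exact e'.trans e.symm
    · rfl
  rw [preHtpy, reassoc_of% h]
  rfl

/-- The map `Map(T, P) ⟶ Map(T, A) ×ʰ_{Map(T, M)} Map(T, B)` induced by a homotopy commutative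
square `p ≫ f ~ q ≫ g`. -/
def pullbackComparison (T : C) {P A B M : C} {p : P ⟶ A} {q : P ⟶ B} {f : A ⟶ M} {g : B ⟶ M}
    (η : Htpy (p ≫ f) (q ≫ g)) :
    sHom T P ⟶ hPullback (eHomWhiskerLeft SSet T f) (eHomWhiskerLeft SSet T g) :=
  hPullbackLift (eHomWhiskerLeft SSet T p) (eHomWhiskerLeft SSet T q) (postHtpy T η)
    (by rw [ι₀_postHtpy, eHomWhiskerLeft_comp]) (by rw [ι₁_postHtpy, eHomWhiskerLeft_comp])

/-- The square with sides `p : P ⟶ A`, `q : P ⟶ B`, `f : A ⟶ M`, `g : B ⟶ M` can be filled by a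
homotopy `p ≫ f ~ q ≫ g` which makes it a homotopy pullback square. -/
def IsHomotopyPullback {P A B M : C} (p : P ⟶ A) (q : P ⟶ B) (f : A ⟶ M) (g : B ⟶ M) : Prop :=
  ∃ η : Htpy (p ≫ f) (q ≫ g), ∀ T : C, IsHomotopyEquivalence (pullbackComparison T η)

/-- The map `Map(P, T) ⟶ Map(X, T) ×ʰ_{Map(U, T)} Map(Y, T)` induced by a homotopy commutative
square `i ≫ k ~ j ≫ l`. -/
def pushoutComparison (T : C) {U X Y P : C} {i : U ⟶ X} {j : U ⟶ Y} {k : X ⟶ P} {l : Y ⟶ P}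
    (η : Htpy (i ≫ k) (j ≫ l)) :
    sHom P T ⟶ hPullback (eHomWhiskerRight SSet i T) (eHomWhiskerRight SSet j T) :=
  hPullbackLift (eHomWhiskerRight SSet k T) (eHomWhiskerRight SSet l T) (preHtpy T η)
    (by rw [ι₀_preHtpy, eHomWhiskerRight_comp]) (by rw [ι₁_preHtpy, eHomWhiskerRight_comp])

/-- The square `i ≫ k ~ j ≫ l`, filled by the homotopy `η`, is a homotopy pushout square. -/
def IsHomotopyPushout {U X Y P : C} {i : U ⟶ X} {j : U ⟶ Y} {k : X ⟶ P} {l : Y ⟶ P}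
    (η : Htpy (i ≫ k) (j ≫ l)) : Prop :=
  ∀ T : C, IsHomotopyEquivalence (pushoutComparison T η)

/-- `a : Q ⟶ A` and `b : Q ⟶ B` exhibit `Q` as the homotopy product `A × B`. -/
def IsHomotopyProduct {Q A B : C} (a : Q ⟶ A) (b : Q ⟶ B) : Prop :=
  ∀ T : C, IsHomotopyEquivalence
    (CartesianMonoidalCategory.lift (eHomWhiskerLeft SSet T a) (eHomWhiskerLeft SSet T b))

/-- `X` is homotopy terminal. -/
def IsHomotopyTerminal (X : C) : Prop := ∀ T : C, IsContractible (sHom T X)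

/-- The space of factorizations up to homotopy of `φ : T ⟶ X` through `k : V ⟶ X`: the homotopy
fiber over `φ` of `Map(T, V) ⟶ Map(T, X)`. -/
def factorizationSpace {V X T : C} (k : V ⟶ X) (φ : T ⟶ X) : SSet.{v} :=
  hPullback (eHomWhiskerLeft SSet T k) (eHomEquiv SSet φ)

end SimplicialCategory

/-! ## Compactly generated Hausdorff spaces and smooth manifolds -/

/-- The category of compactly generated Hausdorff spaces. -/
abbrev CG : Type 1 :=
  ObjectProperty.FullSubcategory
    (fun X : TopCat.{0} => T2Space X ∧ CompactlyGeneratedSpace X)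

/-- Smooth manifolds: Hausdorff, second countable, without boundary, modelled on a
finite-dimensional real vector space `E`. -/
structure Man : Type 1 where
  E : Type
  [normedAddCommGroup : NormedAddCommGroup E]
  [normedSpace : NormedSpace ℝ E]
  [finiteDimensional : FiniteDimensional ℝ E]
  carrier : Type
  [topologicalSpace : TopologicalSpace carrier]
  [t2Space : T2Space carrier]
  [secondCountable : SecondCountableTopology carrier]
  [chartedSpace : ChartedSpace E carrier]
  [isManifold : IsManifold (modelWithCornersSelf ℝ E) ∞ carrier]

namespace Man

attribute [instance] normedAddCommGroup normedSpace finiteDimensional topologicalSpace t2Space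
  secondCountable chartedSpace isManifold

/-- The model of a manifold. -/
abbrev model (M : Man) : ModelWithCorners ℝ M.E M.E := modelWithCornersSelf ℝ M.E

/-- Morphisms of manifolds are the smooth maps. -/
instance : Category Man where
  Hom M N := ContMDiffMap M.model N.model M.carrier N.carrier ∞
  id _ := ContMDiffMap.id
  comp f g := g.comp f

/-- The smooth map underlying a morphism. -/
abbrev toMap {M N : Man} (f : M ⟶ N) : ContMDiffMap M.model N.model M.carrier N.carrier ∞ := f

/-- The underlying space functor. -/
def toCG : Man ⥤ CG where
  obj M := ⟨TopCat.of M.carrier, inferInstanceAs (T2Space M.carrier), by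
    have := Manifold.locallyCompact_of_finiteDimensional (M := M.carrier) M.model
    exact inferInstanceAs (CompactlyGeneratedSpace M.carrier)⟩
  map f := ObjectProperty.homMk (TopCat.ofHom ⟨toMap f, (toMap f).contMDiff.continuous⟩)

/-- The differential of a morphism at a point; the tangent spaces are the vector spaces `A.E` and
`M.E`. -/
def diff {A M : Man} (f : A ⟶ M) (a : A.carrier) : A.E →L[ℝ] M.E :=
  mfderiv A.model M.model (toMap f) a

/-- Two smooth maps to `M` are transverse: whenever `f a = g b`, the images of the two differentials
span the tangent space of `M` at this point. -/
def Transverse {A B M : Man} (f : A ⟶ M) (g : B ⟶ M) : Prop :=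
  ∀ (a : A.carrier) (b : B.carrier), toMap f a = toMap g b →
    ∀ w : M.E, ∃ (x : A.E) (y : B.E), diff f a x + diff g b y = w

/-- An open subset of a manifold, as a manifold. -/
def opens (M : Man) (U : TopologicalSpace.Opens M.carrier) : Man where
  E := M.E
  carrier := U

/-- The inclusion of an open submanifold. -/
def opensIncl (M : Man) (U : TopologicalSpace.Opens M.carrier) : M.opens U ⟶ M :=
  (⟨Subtype.val, contMDiff_subtype_val⟩ :
    ContMDiffMap M.model M.model U M.carrier ∞)

/-- Euclidean space `ℝⁿ`. -/
def euclidean (n : ℕ) : Man where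
  E := EuclideanSpace ℝ (Fin n)
  carrier := EuclideanSpace ℝ (Fin n)

/-- The real line. -/
def line : Man where
  E := ℝ
  carrier := ℝ

/-- The map from the point `ℝ⁰` to `M` with value `x`. -/
def point (M : Man) (x : M.carrier) : euclidean 0 ⟶ M :=
  (ContMDiffMap.const x : ContMDiffMap (euclidean 0).model M.model (euclidean 0).carrier M.carrier ∞)

/-- The origin `ℝ⁰ ⟶ ℝⁿ`. -/
def origin (n : ℕ) : euclidean 0 ⟶ euclidean n :=
  point (euclidean n) (0 : EuclideanSpace ℝ (Fin n))

/-- The open interval `(-ε, ε)`. -/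
def interval (ε : ℝ) : Man :=
  line.opens (⟨Set.Ioo (-ε) ε, isOpen_Ioo⟩ : TopologicalSpace.Opens ℝ)

/-- The map `(-ε, ε) ⟶ ℝ` sending `t` to `c + t`. -/
def intervalAt (c ε : ℝ) : interval ε ⟶ line :=
  line.opensIncl _ ≫ (⟨fun t : ℝ => c + t, (contDiff_const.add contDiff_id).contMDiff⟩ :
    ContMDiffMap line.model line.model line.carrier line.carrier ∞)

/-- A smooth real vector bundle over `B`, with total space realized as an object `total`. -/
structure VectorBundle (B : Man) where
  F : Type
  [normedAddCommGroup : NormedAddCommGroup F]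
  [normedSpace : NormedSpace ℝ F]
  [finiteDimensional : FiniteDimensional ℝ F]
  V : B.carrier → Type
  [addCommGroup : ∀ x, AddCommGroup (V x)]
  [module : ∀ x, Module ℝ (V x)]
  [fiberTopology : ∀ x, TopologicalSpace (V x)]
  [totalTopology : TopologicalSpace (Bundle.TotalSpace F V)]
  [fiberBundle : FiberBundle F V]
  [vectorBundle : _root_.VectorBundle ℝ F V]
  [smooth : ContMDiffVectorBundle ∞ F V B.model]
  total : Man
  diffeo : Diffeomorph total.model (B.model.prod (modelWithCornersSelf ℝ F)) total.carrier
    (Bundle.TotalSpace F V) ∞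

namespace VectorBundle

attribute [instance] normedAddCommGroup normedSpace finiteDimensional addCommGroup module
  fiberTopology totalTopology fiberBundle vectorBundle smooth

variable {B : Man} (E : VectorBundle B)

/-- `s` is a (smooth) section. -/
def IsSection (s : B ⟶ E.total) : Prop := ∀ x, (E.diffeo (toMap s x)).proj = x

/-- `z` is the zero section. -/
def IsZeroSection (z : B ⟶ E.total) : Prop :=
  ∀ x, E.diffeo (toMap z x) = Bundle.zeroSection E.F E.V x

/-- The pullbacks to `X` of the vector bundles `E` and `E'`, along `γ` and `γ'`, are isomorphic as
topological vector bundles. -/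
def PullbackIso {B B' : Man} (E : VectorBundle B) (E' : VectorBundle B') {X : Type}
    [TopologicalSpace X] (γ : C(X, B.carrier)) (γ' : C(X, B'.carrier)) : Prop :=
  ∃ φ : ∀ x, E.V (γ x) ≃ₗ[ℝ] E'.V (γ' x),
    Continuous (fun p : Bundle.TotalSpace E.F (Bundle.Pullback γ E.V) =>
      (⟨p.proj, φ p.proj p.snd⟩ : Bundle.TotalSpace E'.F (Bundle.Pullback γ' E'.V))) ∧
    Continuous (fun p : Bundle.TotalSpace E'.F (Bundle.Pullback γ' E'.V) =>
      (⟨p.proj, (φ p.proj).symm p.snd⟩ : Bundle.TotalSpace E.F (Bundle.Pullback γ E.V)))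

end VectorBundle

end Man

/-! ## Geometric simplicial categories -/

open SimplicialCategory

/-- The data and properties making the simplicial category `C` geometric. -/
structure GeometricStructure (C : Type u) [Category.{v} C] [SimplicialCategory C] where
  /-- Mapping spaces are fibrant. -/
  kan : ∀ X Y : C, SSet.KanComplex (sHom X Y)
  /-- The inclusion of manifolds. -/
  i : Man ⥤ C
  /-- `i` is fully faithful: the discrete space of smooth maps `M ⟶ N` is equivalent to the mapping
  space from `i M` to `i N`. -/
  fullyFaithful : ∀ M N : Man, IsHomotopyEquivalence
    (ofVertices fun f : ULift.{v} (M ⟶ N) => homEquiv' (i.obj M) (i.obj N) (i.map f.down))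
  /-- `i` preserves transverse fibre products. -/
  transverse : ∀ {P A B M : Man} {p : P ⟶ A} {q : P ⟶ B} {f : A ⟶ M} {g : B ⟶ M},
    IsPullback p q f g → Man.Transverse f g →
      IsHomotopyPullback (i.map p) (i.map q) (i.map f) (i.map g)
  /-- `i` preserves the terminal object. -/
  terminal : IsHomotopyTerminal (i.obj (Man.euclidean 0))
  /-- The underlying space functor. As a simplicial functor to a discrete category, it is a functor
  which identifies homotopic maps. -/
  U : C ⥤ CG
  map_eq_of_homotopic : ∀ {X Y : C} {f g : X ⟶ Y}, Homotopic f g → U.map f = U.map g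
  /-- The underlying space of `i M` is the usual one. -/
  iU : i ⋙ U ≅ Man.toCG
  /-- `U` takes homotopy pullbacks to pullbacks. -/
  isPullback : ∀ {P A B M : C} {p : P ⟶ A} {q : P ⟶ B} {f : A ⟶ M} {g : B ⟶ M},
    IsHomotopyPullback p q f g → IsPullback (U.map p) (U.map q) (U.map f) (U.map g)

namespace GeometricStructure

variable {C : Type u} [Category.{v} C] [SimplicialCategory C] (D : GeometricStructure C)

/-- The underlying topological space of `X`. -/
abbrev space (X : C) : TopCat.{0} := (D.U.obj X).obj

/-- The continuous map underlying a map. -/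
abbrev onSpace {X Y : C} (f : X ⟶ Y) : D.space X ⟶ D.space Y := (D.U.map f).hom

/-- The continuous map to the manifold `M` underlying a map to `i M`. -/
def toMan {X : C} {M : Man} (f : X ⟶ D.i.obj M) : C(D.space X, M.carrier) :=
  (D.onSpace f ≫ (D.iU.hom.app M).hom).hom

/-- The real line as an object of `C`. -/
abbrev line : C := D.i.obj Man.line

/-- The object `X` is compact. -/
def IsCompact (X : C) : Prop := CompactSpace (D.space X)

/-- The map `f` to the real line is proper. -/
def IsProper {X : C} (f : X ⟶ D.line) : Prop :=
  ∀ K : Set ℝ, _root_.IsCompact K → _root_.IsCompact (D.toMan f ⁻¹' K)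

/-! ### Open subobjects, unions, local models, imbeddings, normal bundles -/

/-- `k` is an open subobject of `X`, over the open subset `Set.range (D.onSpace k)`: it is an open
embedding on underlying spaces, and every map to `X` whose underlying map takes values in this open
subset factors homotopy-uniquely through `k`. -/
def IsOpenSubobject {V X : C} (k : V ⟶ X) : Prop :=
  Topology.IsOpenEmbedding (D.onSpace k) ∧
    ∀ (T : C) (φ : T ⟶ X), Set.range (D.onSpace φ) ⊆ Set.range (D.onSpace k) →
      IsContractible (factorizationSpace k φ)

/-- `P` is the union of its open subobjects `k : X ⟶ P` and `l : Y ⟶ P` along the common open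
subobject `W` of `X` and `Y`. -/
structure IsUnion {W X Y P : C} (i : W ⟶ X) (j : W ⟶ Y) (k : X ⟶ P) (l : Y ⟶ P) : Prop where
  left : D.IsOpenSubobject i
  right : D.IsOpenSubobject j
  inl : D.IsOpenSubobject k
  inr : D.IsOpenSubobject l
  comm : Homotopic (i ≫ k) (j ≫ l)
  isPushout : IsPushout (D.onSpace i) (D.onSpace j) (D.onSpace k) (D.onSpace l)

/-- `X` is a local model: the zero set of a smooth map `ℝⁿ ⟶ ℝᵏ`. -/
def IsLocalModel (X : C) : Prop :=
  ∃ (n k : ℕ) (f : Man.euclidean n ⟶ Man.euclidean k)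
    (p : X ⟶ D.i.obj (Man.euclidean n)) (q : X ⟶ D.i.obj (Man.euclidean 0)),
    IsHomotopyPullback p q (D.i.map f) (D.i.map (Man.origin k))

/-- `g` is a model imbedding: the inclusion of the zero set of a map `Y ⟶ ℝⁿ`. -/
def IsModelImbedding {X Y : C} (g : X ⟶ Y) : Prop :=
  ∃ (n : ℕ) (f : Y ⟶ D.i.obj (Man.euclidean n)) (q : X ⟶ D.i.obj (Man.euclidean 0)),
    IsHomotopyPullback g q f (D.i.map (Man.origin n))

/-- `g` is an imbedding: `Y` is covered by open subobjects over which `g` is a model imbedding. -/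
def IsImbedding {X Y : C} (g : X ⟶ Y) : Prop :=
  ∀ y : D.space Y, ∃ (Y' : C) (k : Y' ⟶ Y) (X' : C) (k' : X' ⟶ X) (g' : X' ⟶ Y'),
    D.IsOpenSubobject k ∧ y ∈ Set.range (D.onSpace k) ∧
      IsHomotopyPullback k' g' g k ∧ D.IsModelImbedding g'

/-- An open neighborhood of `X` in `M`, a vector bundle on this neighborhood, and a section of it
whose zero set is `X`, for a map `g` from `X` to `M`. The rank of the bundle may vary: the
neighborhood is given as a disjoint union of opens `nbhd r`, with one bundle on each of them. -/
structure NormalBundle {X : C} {M : Man} (g : X ⟶ D.i.obj M) where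
  nbhd : ℕ → TopologicalSpace.Opens M.carrier
  disjoint : ∀ r r', r ≠ r' → Disjoint (nbhd r) (nbhd r')
  covers : ∀ x, ∃ r, D.toMan g x ∈ nbhd r
  bundle : ∀ r, Man.VectorBundle (M.opens (nbhd r))
  /-- The defining section. -/
  s : ∀ r, M.opens (nbhd r) ⟶ (bundle r).total
  isSection : ∀ r, (bundle r).IsSection (s r)
  /-- The zero section. -/
  z : ∀ r, M.opens (nbhd r) ⟶ (bundle r).total
  isZeroSection : ∀ r, (bundle r).IsZeroSection (z r)
  /-- The open subobject of `X` over the preimage of `nbhd r`. -/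
  part : ℕ → C
  incl : ∀ r, part r ⟶ X
  isOpenSubobject : ∀ r, D.IsOpenSubobject (incl r)
  range_incl : ∀ r, Set.range (D.onSpace (incl r)) = D.toMan g ⁻¹' (nbhd r)
  /-- The restriction of `g` to a map `part r ⟶ nbhd r`. -/
  restr : ∀ r, part r ⟶ D.i.obj (M.opens (nbhd r))
  homotopic : ∀ r, Homotopic (restr r ≫ D.i.map (M.opensIncl (nbhd r))) (incl r ≫ g)
  isHomotopyPullback : ∀ r,
    IsHomotopyPullback (restr r) (restr r) (D.i.map (s r)) (D.i.map (z r))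

/-- The map underlying `g`, restricted to the preimage of the open subset `O'` of `M`, and seen as a
map to the larger open submanifold `O`. -/
def NormalBundle.underlying {X : C} {M : Man} (g : X ⟶ D.i.obj M)
    (O O' : TopologicalSpace.Opens M.carrier) (h : O' ≤ O) :
    C({x : D.space X // D.toMan g x ∈ O'}, (M.opens O).carrier) where
  toFun x := ⟨D.toMan g x.1, h x.2⟩
  continuous_toFun := ((D.toMan g).continuous.comp continuous_subtype_val).subtype_mk _

/-- The pullbacks to `X` of the two bundles are isomorphic. -/
def NormalBundle.Iso {X : C} {M : Man} {g : X ⟶ D.i.obj M} (N N' : D.NormalBundle g) : Prop :=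
  ∀ r r' : ℕ, Man.VectorBundle.PullbackIso (N.bundle r) (N'.bundle r')
    (NormalBundle.underlying D g (N.nbhd r) (N.nbhd r ⊓ N'.nbhd r') inf_le_left)
    (NormalBundle.underlying D g (N'.nbhd r') (N.nbhd r ⊓ N'.nbhd r') inf_le_right)

/-- The geometric simplicial category `C` is good for doing intersection theory on manifolds. -/
structure GoodForIntersectionTheory : Prop where
  /-- There is an open subobject over every open subset. -/
  exists_openSubobject : ∀ (X : C) (W : TopologicalSpace.Opens (D.space X)),
    ∃ (V : C) (k : V ⟶ X), D.IsOpenSubobject k ∧ Set.range (D.onSpace k) = W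
  /-- Objects can be glued along an equivalence of open subobjects, when the union of the underlying
  spaces is Hausdorff. -/
  exists_union : ∀ {X Y W V : C} (i : W ⟶ X) (j : V ⟶ Y) (a : W ⟶ V),
    D.IsOpenSubobject i → D.IsOpenSubobject j → IsEquivalence a →
    (∃ (Q : TopCat.{0}) (x : D.space X ⟶ Q) (y : D.space Y ⟶ Q),
      IsPushout (D.onSpace i) (D.onSpace (a ≫ j)) x y ∧ T2Space Q) →
    ∃ (P : C) (k : X ⟶ P) (l : Y ⟶ P), D.IsUnion i (a ≫ j) k l
  /-- Unions are homotopy colimits. -/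
  union_isHomotopyPushout : ∀ {W X Y P : C} {i : W ⟶ X} {j : W ⟶ Y} {k : X ⟶ P} {l : Y ⟶ P},
    D.IsUnion i j k l → ∀ η : Htpy (i ≫ k) (j ≫ l), IsHomotopyPushout η
  /-- Fibre products over manifolds exist. -/
  exists_pullback : ∀ {X Y : C} {M : Man} (f : X ⟶ D.i.obj M) (g : Y ⟶ D.i.obj M),
    ∃ (Z : C) (p : Z ⟶ X) (q : Z ⟶ Y), IsHomotopyPullback p q f g
  /-- Every open cover of the underlying space of `X` can be refined to an open cover by local
  models; equivalently, each point has arbitrarily small open neighborhoods which are local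
  models. -/
  exists_localModel : ∀ (X : C) (x : D.space X) (W : TopologicalSpace.Opens (D.space X)), x ∈ W →
    ∃ (V : C) (k : V ⟶ X), D.IsOpenSubobject k ∧ x ∈ Set.range (D.onSpace k) ∧
      Set.range (D.onSpace k) ⊆ W ∧ D.IsLocalModel V
  /-- Real functions extend along imbeddings. -/
  exists_extension : ∀ {X Y : C} (g : X ⟶ Y), D.IsImbedding g → ∀ h : X ⟶ D.line,
    ∃ h' : Y ⟶ D.line, Homotopic (g ≫ h') h
  /-- Imbeddings into manifolds have normal bundles, and these are unique up to isomorphism. -/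
  exists_normalBundle : ∀ {X : C} {M : Man} (g : X ⟶ D.i.obj M), D.IsImbedding g →
    Nonempty (D.NormalBundle g)
  normalBundle_unique : ∀ {X : C} {M : Man} (g : X ⟶ D.i.obj M), D.IsImbedding g →
    ∀ N N' : D.NormalBundle g, NormalBundle.Iso D N N'

/-! ### Derived cobordism -/

/-- `p : P ⟶ X` is (the inclusion of) the fibre `X_{f = c}` of `f : X ⟶ ℝ` over the number `c`. -/
def IsFiber {P X : C} (p : P ⟶ X) (f : X ⟶ D.line) (c : ℝ) : Prop :=
  ∃ q : P ⟶ D.i.obj (Man.euclidean 0), IsHomotopyPullback p q f (D.i.map (Man.point Man.line c))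

/-- `f : X ⟶ ℝ` is collared at `c`: there are `ε > 0` and an equivalence, compatible with the maps
to `ℝ`, between the open subobject `X_{|f - c| < ε}` and the product `X_{f = c} × (-ε, ε)`. -/
def IsCollaredAt {X : C} (f : X ⟶ D.line) (c : ℝ) : Prop :=
  ∃ (ε : ℝ) (V : C) (k : V ⟶ X) (P : C) (p : P ⟶ X)
    (Q : C) (a : Q ⟶ P) (b : Q ⟶ D.i.obj (Man.interval ε)) (e : V ⟶ Q),
    0 < ε ∧
    D.IsOpenSubobject k ∧ Set.range (D.onSpace k) = D.toMan f ⁻¹' (Set.Ioo (c - ε) (c + ε) : Set ℝ) ∧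
    D.IsFiber p f c ∧ IsHomotopyProduct a b ∧
    IsEquivalence e ∧ Homotopic (k ≫ f) (e ≫ b ≫ D.i.map (Man.intervalAt c ε))

/-- `Z₀` and `Z₁` are derived cobordant. -/
def DerivedCobordant (Z₀ Z₁ : C) : Prop :=
  ∃ (X : C) (f : X ⟶ D.line), D.IsProper f ∧ D.IsCollaredAt f 0 ∧ D.IsCollaredAt f 1 ∧
    (∃ (P : C) (p : P ⟶ X), D.IsFiber p f 0 ∧ Equivalent Z₀ P) ∧
    (∃ (P : C) (p : P ⟶ X), D.IsFiber p f 1 ∧ Equivalent Z₁ P)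

end GeometricStructure

end DerivedCobordism

end

/-! Reflexivity comes from the projection `Z × ℝ ⟶ ℝ`, proper because `Z` is compact, and symmetry
from `t ↦ 1 - t`. For transitivity the second cobordism is translated by `1`, both are cut to `{f <
s}` and `{g > r}` with `r < 1 < s`, and these are glued along the collars over `(r, s)`, two copies
of the same open part of `Z' × ℝ` (`exists_glue`). The result is Hausdorff because the real
functions separate points outside the overlap (`t2Space_of_isPushout`), and the functions glue
because unions are homotopy pushouts. A rescaling by `1/2` ends the argument.

Two things need work. The first is homotopy coherence. All that is used takes place in the homotopy
2-category of `C`, whose 2-cells are classes of paths in mapping spaces. `MapGroupoid` is the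
groupoid of such classes, with parameters in a simplicial set `A`. `hPullback_path_iff` describes
paths in a homotopy pullback by commuting squares in this groupoid, and so turns the homotopical
definitions into `IsWeakPullback`, `IsWeakProduct` and `IsWeakOpen`. After that only a calculus of
2-cells remains.

The second is that collars are products with the manifold `(-ε, ε)`, whereas the open subobjects of
`Z × ℝ` are abstract, and the axioms do not say directly that the two agree. `liftsTo_open` bridges
the gap: a map to the line with values in an open `J` factors through the manifold `J`. Its heart,
`liftsTo_of_zeroSet`, is that on the zero set of `F` a function `g` is homotopic to `g + ‖F‖²`,
which is positive everywhere once `g` is nonnegative, and positive on the zero set.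

Collars are then handled as `HasCollar`, where the interval gives way to the part of `Z × ℝ` over
any open `J`; this form is easily shrunk, restricted and reparametrized. `equivalent_fiber` recovers
`Z` as the fibre, and `derivedCobordant_iff` restates the relation. -/

noncomputable section

namespace DerivedCobordism

/-! ### Path groupoids of maps into a Kan complex. -/

section PathGroupoid

variable {A K L : SSet.{v}}

/-- The internal hom from `A` to a Kan complex is a Kan complex; this is its horn filling condition
after uncurrying. The value `f i`, at the missing face, plays no role. -/
lemma horn_extension [SSet.KanComplex K] {n : ℕ} (i : Fin (n + 3))
    (f : Fin (n + 3) → (A ⊗ Δ[n + 1] ⟶ K))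
    (h : ∀ (j k : Fin (n + 3)), j ≠ i → k ≠ i → ∀ hjk : j < k,
      A ◁ SSet.stdSimplex.δ (k.pred (Fin.ne_zero_of_lt hjk)) ≫ f j =
        A ◁ SSet.stdSimplex.δ (j.castPred (Fin.ne_last_of_lt hjk)) ≫ f k) :
    ∃ φ : A ⊗ Δ[n + 2] ⟶ K, ∀ j, j ≠ i → A ◁ SSet.stdSimplex.δ j ≫ φ = f j := by
  have hf : SSet.horn.IsCompatible (i := i)
      (fun j (_ : j ≠ i) => MonoidalClosed.curry (f j)) := by
    rw [SSet.horn.isCompatible_iff]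
    intro j k hj hk hjk
    rw [← MonoidalClosed.curry_natural_left, ← MonoidalClosed.curry_natural_left, h j k hj hk hjk]
  obtain ⟨φ, hφ⟩ := hf.exists_lift_of_kanComplex
  refine ⟨MonoidalClosed.uncurry φ, fun j hj => ?_⟩
  rw [← MonoidalClosed.uncurry_natural_left, hφ j hj, MonoidalClosed.uncurry_curry]

/-- A path in `K`, parametrized by `A`. -/
@[ext]
structure Path (a b : A ⟶ K) where
  h : A ⊗ Δ[1] ⟶ K
  h₀ : SSet.ι₀ ≫ h = a
  h₁ : SSet.ι₁ ≫ h = b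

lemma fst_ι₀ : CartesianMonoidalCategory.fst A Δ[0] ≫ SSet.ι₀ = A ◁ SSet.stdSimplex.δ 1 := by
  apply CartesianMonoidalCategory.hom_ext
  · rfl
  · have h : SSet.stdSimplex.obj₀Equiv.{v}.symm 0 =
      SSet.stdSimplex.objEquiv.symm (SimplexCategory.δ 1) := by decide
    have e : CartesianMonoidalCategory.snd A Δ[0] =
      SSet.const (SSet.stdSimplex.obj₀Equiv.symm 0) := SSet.stdSimplex.ext₀
    rw [CartesianMonoidalCategory.whiskerLeft_snd, e, SSet.const_comp, Category.assoc, SSet.ι₀_snd, SSet.comp_const, h]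
    rfl

lemma fst_ι₁ : CartesianMonoidalCategory.fst A Δ[0] ≫ SSet.ι₁ = A ◁ SSet.stdSimplex.δ 0 := by
  apply CartesianMonoidalCategory.hom_ext
  · rfl
  · have h : SSet.stdSimplex.obj₀Equiv.{v}.symm 1 =
      SSet.stdSimplex.objEquiv.symm (SimplexCategory.δ 0) := by decide
    have e : CartesianMonoidalCategory.snd A Δ[0] =
      SSet.const (SSet.stdSimplex.obj₀Equiv.symm 0) := SSet.stdSimplex.ext₀
    rw [CartesianMonoidalCategory.whiskerLeft_snd, e, SSet.const_comp, Category.assoc, SSet.ι₁_snd, SSet.comp_const, h]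
    rfl

namespace Path

variable {a b c d : A ⟶ K}

lemma δ_one (p : Path a b) :
    A ◁ SSet.stdSimplex.δ (n := 0) 1 ≫ p.h = CartesianMonoidalCategory.fst A Δ[0] ≫ a := by
  rw [← fst_ι₀, Category.assoc, p.h₀]

lemma δ_zero (p : Path a b) :
    A ◁ SSet.stdSimplex.δ (n := 0) 0 ≫ p.h = CartesianMonoidalCategory.fst A Δ[0] ≫ b := by
  rw [← fst_ι₁, Category.assoc, p.h₁]

lemma fst_cancel {f g : A ⟶ K} (h : CartesianMonoidalCategory.fst A Δ[0] ≫ f =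
    CartesianMonoidalCategory.fst A Δ[0] ≫ g) : f = g := by
  have := congrArg (fun t => CartesianMonoidalCategory.lift (𝟙 A)
    (SSet.const (SSet.stdSimplex.obj₀Equiv.symm 0)) ≫ t) h
  simpa using this

/-- A map with the given restrictions to the two ends, as a path. -/
def ofδ (h : A ⊗ Δ[1] ⟶ K)
    (h₀ : A ◁ SSet.stdSimplex.δ (n := 0) 1 ≫ h = CartesianMonoidalCategory.fst A Δ[0] ≫ a)
    (h₁ : A ◁ SSet.stdSimplex.δ (n := 0) 0 ≫ h = CartesianMonoidalCategory.fst A Δ[0] ≫ b) :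
    Path a b where
  h := h
  h₀ := fst_cancel (by rw [← h₀, ← fst_ι₀, Category.assoc])
  h₁ := fst_cancel (by rw [← h₁, ← fst_ι₁, Category.assoc])

/-- The constant path. -/
def refl (a : A ⟶ K) : Path a a where
  h := CartesianMonoidalCategory.fst _ _ ≫ a
  h₀ := rfl
  h₁ := rfl

/-- The paths `p`, `q`, `r` are the sides of a triangle. -/
def Tri (p : Path a b) (q : Path b c) (r : Path a c) : Prop :=
  ∃ σ : A ⊗ Δ[2] ⟶ K, A ◁ SSet.stdSimplex.δ 2 ≫ σ = p.h ∧
    A ◁ SSet.stdSimplex.δ 0 ≫ σ = q.h ∧ A ◁ SSet.stdSimplex.δ 1 ≫ σ = r.h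

lemma whisker_δ_δ {n : ℕ} {i j : Fin (n + 2)} (H : i ≤ j) :
    A ◁ SSet.stdSimplex.δ i ≫ A ◁ SSet.stdSimplex.δ j.succ =
      A ◁ SSet.stdSimplex.δ j ≫ A ◁ SSet.stdSimplex.δ i.castSucc := by
  rw [← whiskerLeft_comp, ← whiskerLeft_comp, SSet.stdSimplex.δ_comp_δ H]

lemma whisker_eq_id {X : SSet.{v}} {f : Δ[1] ⟶ X} {g : X ⟶ Δ[1]} (h : f ≫ g = 𝟙 _)
    (k : A ⊗ Δ[1] ⟶ K) : A ◁ f ≫ A ◁ g ≫ k = k := by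
  rw [← whiskerLeft_comp_assoc, h, whiskerLeft_id, Category.id_comp]

lemma whisker_eq_const {X : SSet.{v}} {f : Δ[1] ⟶ X} {g : X ⟶ Δ[1]} {i : Δ[0] ⟶ Δ[1]}
    (h : f ≫ g = SSet.stdSimplex.σ 0 ≫ i) {k : A ⊗ Δ[1] ⟶ K} {a : A ⟶ K}
    (hi : A ◁ i ≫ k = CartesianMonoidalCategory.fst A Δ[0] ≫ a) :
    A ◁ f ≫ A ◁ g ≫ k = (refl a).h := by
  rw [← whiskerLeft_comp_assoc, h, whiskerLeft_comp, Category.assoc, hi]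
  rfl

lemma Tri.id_left (p : Path a b) : Tri (refl a) p p :=
  ⟨A ◁ SSet.stdSimplex.σ 0 ≫ p.h,
    whisker_eq_const (SSet.stdSimplex.δ_comp_σ_of_gt (n := 0) (i := 1) (j := 0) (by decide))
      p.δ_one,
    whisker_eq_id (CosimplicialObject.δ_comp_σ_self SSet.stdSimplex (i := (0 : Fin 2))) _,
    whisker_eq_id (CosimplicialObject.δ_comp_σ_succ SSet.stdSimplex (i := (0 : Fin 2))) _⟩

lemma Tri.id_right (p : Path a b) : Tri p (refl b) p :=
  ⟨A ◁ SSet.stdSimplex.σ 1 ≫ p.h,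
    whisker_eq_id (CosimplicialObject.δ_comp_σ_succ SSet.stdSimplex (i := (1 : Fin 2))) _,
    whisker_eq_const (SSet.stdSimplex.δ_comp_σ_of_le (n := 0) (i := 0) (j := 0) (by decide))
      p.δ_zero,
    whisker_eq_id (CosimplicialObject.δ_comp_σ_self SSet.stdSimplex (i := (1 : Fin 2))) _⟩

lemma whisker_δ_eq {n : ℕ} {i j : Fin (n + 2)} (H : i ≤ j) {φ : A ⊗ Δ[n + 2] ⟶ K}
    {f g : A ⊗ Δ[n + 1] ⟶ K} (hf : A ◁ SSet.stdSimplex.δ j.succ ≫ φ = f)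
    (hg : A ◁ SSet.stdSimplex.δ i.castSucc ≫ φ = g) :
    A ◁ SSet.stdSimplex.δ i ≫ f = A ◁ SSet.stdSimplex.δ j ≫ g := by
  rw [← hf, ← hg, ← Category.assoc, ← Category.assoc, whisker_δ_δ H]

variable [SSet.KanComplex K]

lemma exists_comp (p : Path a b) (q : Path b c) : ∃ r : Path a c, Tri p q r := by
  -- The entry at index `1` belongs to the missing face and is a dummy; the same convention is used
  -- for the other horns.
  obtain ⟨φ, hφ⟩ := horn_extension (n := 0) 1 ![q.h, q.h, p.h] (by
    intro j k hj hk hjk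
    fin_cases j <;> fin_cases k <;> simp at hj hk hjk
    exact q.δ_one.trans p.δ_zero.symm)
  have h0 := hφ 0 (by decide)
  have h2 := hφ 2 (by decide)
  exact ⟨ofδ (A ◁ SSet.stdSimplex.δ 1 ≫ φ)
    ((whisker_δ_eq (n := 0) (i := 1) (j := 1) le_rfl h2 rfl).symm.trans p.δ_one)
    ((whisker_δ_eq (n := 0) (i := 0) (j := 0) le_rfl rfl h0).trans q.δ_zero), φ, h2, h0, rfl⟩

/-- Filling the outer horn at the vertex `0` divides by `p`. Inverses in the path groupoid come from
the case where `r` is constant. -/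
lemma exists_comp_right (p : Path a b) (r : Path a c) : ∃ q : Path b c, Tri p q r := by
  obtain ⟨φ, hφ⟩ := horn_extension (n := 0) 0 ![r.h, r.h, p.h] (by
    intro j k hj hk hjk
    fin_cases j <;> fin_cases k <;> simp at hj hk hjk
    exact r.δ_one.trans p.δ_one.symm)
  have h1 := hφ 1 (by decide)
  have h2 := hφ 2 (by decide)
  exact ⟨ofδ (A ◁ SSet.stdSimplex.δ 0 ≫ φ)
    ((whisker_δ_eq (n := 0) (i := 0) (j := 1) (by decide) h2 rfl).symm.trans p.δ_zero)
    ((whisker_δ_eq (n := 0) (i := 0) (j := 0) le_rfl h1 rfl).symm.trans r.δ_zero), φ, h2, rfl, h1⟩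

variable {p₀₁ : Path a b} {p₁₂ : Path b c} {p₂₃ : Path c d} {p₀₂ : Path a c} {p₁₃ : Path b d}
  {p₀₃ : Path a d}

/-- Three faces of a tetrahedron give the fourth, here the one opposite the vertex `1`.
Associativity and the independence of choices below all reduce to this and `fill_two`. -/
lemma Tri.fill_one (h₃ : Tri p₀₁ p₁₂ p₀₂) (h₀ : Tri p₁₂ p₂₃ p₁₃) (h₂ : Tri p₀₁ p₁₃ p₀₃) :
    Tri p₀₂ p₂₃ p₀₃ := by
  obtain ⟨σ₃, h₃₂, h₃₀, h₃₁⟩ := h₃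
  obtain ⟨σ₀, h₀₂, h₀₀, h₀₁⟩ := h₀
  obtain ⟨σ₂, h₂₂, h₂₀, h₂₁⟩ := h₂
  obtain ⟨φ, hφ⟩ := horn_extension (n := 1) 1 ![σ₀, σ₀, σ₂, σ₃] (by
    intro j k hj hk hjk
    fin_cases j <;> fin_cases k <;> simp at hj hk hjk
    · exact h₀₁.trans h₂₀.symm
    · exact h₀₂.trans h₃₀.symm
    · exact h₂₂.trans h₃₂.symm)
  have e₀ := hφ 0 (by decide)
  have e₂ := hφ 2 (by decide)
  have e₃ := hφ 3 (by decide)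
  exact ⟨_, (whisker_δ_eq (n := 1) (i := 1) (j := 2) (by decide) e₃ rfl).symm.trans h₃₁,
    (whisker_δ_eq (n := 1) (i := 0) (j := 0) (by decide) rfl e₀).trans h₀₀,
    (whisker_δ_eq (n := 1) (i := 1) (j := 1) (by decide) e₂ rfl).symm.trans h₂₁⟩

lemma Tri.fill_two (h₃ : Tri p₀₁ p₁₂ p₀₂) (h₀ : Tri p₁₂ p₂₃ p₁₃) (h₁ : Tri p₀₂ p₂₃ p₀₃) :
    Tri p₀₁ p₁₃ p₀₃ := by
  obtain ⟨σ₃, h₃₂, h₃₀, h₃₁⟩ := h₃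
  obtain ⟨σ₀, h₀₂, h₀₀, h₀₁⟩ := h₀
  obtain ⟨σ₁, h₁₂, h₁₀, h₁₁⟩ := h₁
  obtain ⟨φ, hφ⟩ := horn_extension (n := 1) 2 ![σ₀, σ₁, σ₀, σ₃] (by
    intro j k hj hk hjk
    fin_cases j <;> fin_cases k <;> simp at hj hk hjk
    · exact h₀₀.trans h₁₀.symm
    · exact h₀₂.trans h₃₀.symm
    · exact h₁₂.trans h₃₁.symm)
  have e₀ := hφ 0 (by decide)
  have e₁ := hφ 1 (by decide)
  have e₃ := hφ 3 (by decide)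
  exact ⟨_, (whisker_δ_eq (n := 1) (i := 2) (j := 2) (by decide) e₃ rfl).symm.trans h₃₂,
    (whisker_δ_eq (n := 1) (i := 0) (j := 1) (by decide) rfl e₀).trans h₀₁,
    (whisker_δ_eq (n := 1) (i := 1) (j := 1) (by decide) rfl e₁).trans h₁₁⟩

/-- Homotopy of paths relative to the end points. -/
def Rel (p q : Path a b) : Prop := Tri p (refl b) q

lemma Rel.symm {p q : Path a b} (h : Rel p q) : Rel q p :=
  Tri.fill_one h (Tri.id_right _) (Tri.id_right _)

lemma Rel.trans {p q r : Path a b} (h : Rel p q) (h' : Rel q r) : Rel p r :=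
  Tri.fill_two h (Tri.id_right _) h'

lemma Rel.id_left {p q : Path a b} (h : Rel p q) : Tri (refl a) p q :=
  Tri.fill_two (Tri.id_left p) (Tri.id_right p) h

lemma Tri.unique {p p' : Path a b} {q q' : Path b c} {r r' : Path a c} (h : Tri p q r)
    (h' : Tri p' q' r') (hp : Rel p p') (hq : Rel q q') : Rel r r' :=
  Tri.fill_one h (Tri.id_right q) (Tri.fill_one (Tri.id_right p) hq.id_left
    (Tri.fill_two hp (Tri.id_left q') h'))

end Path

/-- The groupoid of maps `A ⟶ K`, with the homotopy classes of paths. -/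
structure MapGroupoid (A K : SSet.{v}) where
  map : A ⟶ K

variable [SSet.KanComplex K]

/-- Paths up to homotopy. -/
instance pathSetoid (a b : A ⟶ K) : Setoid (Path a b) where
  r := Path.Rel
  iseqv := ⟨Path.Tri.id_right, Path.Rel.symm, Path.Rel.trans⟩

namespace MapGroupoid

instance : CategoryStruct (MapGroupoid A K) where
  Hom x y := Quotient (pathSetoid x.map y.map)
  id x := ⟦Path.refl x.map⟧
  comp := Quotient.lift₂ (fun p q => ⟦(Path.exists_comp p q).choose⟧) (fun p q p' q' hp hq =>
    Quotient.sound (Path.Tri.unique (Path.exists_comp p q).choose_spec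
      (Path.exists_comp p' q').choose_spec hp hq))

end MapGroupoid

variable {a b c : A ⟶ K}

/-- The class of a path. -/
def Path.cls (p : Path a b) : MapGroupoid.mk a ⟶ MapGroupoid.mk b := Quotient.mk _ p

lemma Path.cls_surjective {a b : A ⟶ K} (f : MapGroupoid.mk a ⟶ MapGroupoid.mk b) :
    ∃ p : Path a b, p.cls = f := Quotient.exists_rep f

lemma Path.tri_iff {p : Path a b} {q : Path b c} {r : Path a c} :
    Path.Tri p q r ↔ p.cls ≫ q.cls = r.cls := by
  constructor
  · intro h
    exact Quotient.sound
      (Path.Tri.unique (Path.exists_comp p q).choose_spec h (Path.Tri.id_right _) (Path.Tri.id_right _))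
  · intro h
    exact Path.Tri.fill_two (Path.exists_comp p q).choose_spec (.id_right q) (Quotient.exact h)

@[simp]
lemma Path.cls_refl (a : A ⟶ K) : (Path.refl a).cls = 𝟙 (MapGroupoid.mk a) := rfl

namespace MapGroupoid

instance : Category (MapGroupoid A K) where
  id_comp {x y} f := by
    obtain ⟨p, rfl⟩ := Path.cls_surjective f
    exact Path.tri_iff.1 (Path.Tri.id_left p)
  comp_id {x y} f := by
    obtain ⟨p, rfl⟩ := Path.cls_surjective f
    exact Path.tri_iff.1 (Path.Tri.id_right p)
  assoc {x y z w} f g h := by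
    obtain ⟨p, rfl⟩ := Path.cls_surjective f
    obtain ⟨q, rfl⟩ := Path.cls_surjective g
    obtain ⟨r, rfl⟩ := Path.cls_surjective h
    obtain ⟨s, hs⟩ := Path.exists_comp p q
    obtain ⟨t, ht⟩ := Path.exists_comp q r
    obtain ⟨m, hm⟩ := Path.exists_comp p t
    rw [Path.tri_iff.1 hs, Path.tri_iff.1 ht, Path.tri_iff.1 hm]
    exact Path.tri_iff.1 (Path.Tri.fill_one hs ht hm)

lemma exists_right_inverse {x y : MapGroupoid A K} (f : x ⟶ y) : ∃ g : y ⟶ x, f ≫ g = 𝟙 x := by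
  obtain ⟨p, rfl⟩ := Path.cls_surjective f
  obtain ⟨q, hq⟩ := Path.exists_comp_right p (.refl _)
  exact ⟨q.cls, Path.tri_iff.1 hq⟩

instance : Groupoid (MapGroupoid A K) where
  inv f := (exists_right_inverse f).choose
  inv_comp f := by
    have h := (exists_right_inverse f).choose_spec
    obtain ⟨k, hk⟩ := exists_right_inverse (exists_right_inverse f).choose
    have : k = f := by rw [← Category.id_comp k, ← h, Category.assoc, hk, Category.comp_id]
    rwa [this] at hk
  comp_inv f := (exists_right_inverse f).choose_spec

end MapGroupoid

end PathGroupoid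

/-! ### The square as a union of two triangles. -/

section Square

open SSet.stdSimplex in
/-- The sum of two monotone maps to `{0, 1}`, as a monotone map to `{0, 1, 2}`. -/
def sumMap : (Δ[1] ⊗ Δ[1] : SSet.{v}) ⟶ Δ[2] where
  app m := ↾fun z => objMk (n := ⦋2⦌)
    ⟨fun i => ⟨(asOrderHom z.1 i : ℕ) + (asOrderHom z.2 i : ℕ), by
      have h₁ := (asOrderHom z.1 i).2
      have h₂ := (asOrderHom z.2 i).2
      simp only
      omega⟩, fun i j hij => by
      have h₁ : (asOrderHom z.1 i : ℕ) ≤ (asOrderHom z.1 j : ℕ) := (asOrderHom z.1).monotone hij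
      have h₂ : (asOrderHom z.2 i : ℕ) ≤ (asOrderHom z.2 j : ℕ) := (asOrderHom z.2).monotone hij
      exact Nat.add_le_add h₁ h₂⟩
  naturality m n f := rfl

/-- The triangle below the diagonal of the square. -/
def lowerTriangle : Δ[2] ⟶ (Δ[1] ⊗ Δ[1] : SSet.{v}) :=
  CartesianMonoidalCategory.lift (SSet.stdSimplex.σ 1) (SSet.stdSimplex.σ 0)

/-- The triangle above the diagonal of the square. -/
def upperTriangle : Δ[2] ⟶ (Δ[1] ⊗ Δ[1] : SSet.{v}) :=
  CartesianMonoidalCategory.lift (SSet.stdSimplex.σ 0) (SSet.stdSimplex.σ 1)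

lemma lowerTriangle_sumMap : lowerTriangle.{v} ≫ sumMap = 𝟙 _ := by decide

lemma upperTriangle_sumMap : upperTriangle.{v} ≫ sumMap = 𝟙 _ := by decide


-- A simplex of the square is a pair of monotone maps to `{0, 1}`. Two such maps are always
-- comparable, so the simplex lies in one of the triangles, and `sumMap`, a retraction onto either,
-- tells to which simplex of `Δ[2]` it corresponds. Hence the definition of `Γ` by cases.
open SSet.stdSimplex in
lemma exists_square {X : SSet.{v}} (σ₁ σ₂ : Δ[2] ⟶ X)
    (h : SSet.stdSimplex.δ 1 ≫ σ₁ = SSet.stdSimplex.δ 1 ≫ σ₂) :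
    ∃ Γ : Δ[1] ⊗ Δ[1] ⟶ X, lowerTriangle ≫ Γ = σ₁ ∧ upperTriangle ≫ Γ = σ₂ := by
  classical
  -- On the diagonal the sum only takes the values `0` and `2`, so it lands in the face `δ 1`, where
  -- `σ₁` and `σ₂` agree.
  have key (m : SimplexCategoryᵒᵖ) (z : (Δ[1] ⊗ Δ[1] : SSet.{v}).obj m)
      (hz : asOrderHom z.1 ≤ asOrderHom z.2) (hz' : asOrderHom z.2 ≤ asOrderHom z.1) :
      σ₁.app m (sumMap.app m z) = σ₂.app m (sumMap.app m z) := by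
    have e : sumMap.app m z = (SSet.stdSimplex.δ 1 : Δ[1] ⟶ Δ[2]).app m z.1 := by
      apply objEquiv.injective
      apply SimplexCategory.Hom.ext
      ext i
      have e₁ : asOrderHom z.1 i = asOrderHom z.2 i := le_antisymm (hz i) (hz' i)
      change (asOrderHom z.1 i : ℕ) + (asOrderHom z.2 i : ℕ) =
        ((1 : Fin 3).succAbove (asOrderHom z.1 i) : ℕ)
      rw [← e₁]
      generalize asOrderHom z.1 i = t
      revert t
      decide
    rw [e]
    exact ConcreteCategory.congr_hom (congr_app h m) z.1
  let Γ : Δ[1] ⊗ Δ[1] ⟶ X :=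
    { app m := ↾fun z => if asOrderHom z.2 ≤ asOrderHom z.1 then σ₁.app m (sumMap.app m z)
        else σ₂.app m (sumMap.app m z)
      naturality m n f := by
        ext z
        have e₁ := ConcreteCategory.congr_hom ((sumMap ≫ σ₁).naturality f) z
        have e₂ := ConcreteCategory.congr_hom ((sumMap ≫ σ₂).naturality f) z
        change (if asOrderHom (Δ[1].map f z.2) ≤ asOrderHom (Δ[1].map f z.1) then
          (sumMap ≫ σ₁).app n ((Δ[1] ⊗ Δ[1] : SSet.{v}).map f z) else
          (sumMap ≫ σ₂).app n ((Δ[1] ⊗ Δ[1] : SSet.{v}).map f z)) =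
          X.map f (if asOrderHom z.2 ≤ asOrderHom z.1 then σ₁.app m (sumMap.app m z)
            else σ₂.app m (sumMap.app m z))
        by_cases hz : asOrderHom z.2 ≤ asOrderHom z.1
        · rw [if_pos hz]
          exact (if_pos fun i => hz _).trans e₁
        · rw [if_neg hz]
          have hz' : asOrderHom z.1 ≤ asOrderHom z.2 := by
            -- Incomparable maps would take the values `(0, 1)` at some `i` and `(1, 0)` at some
            -- `j`, which monotonicity forbids whichever of `i` and `j` comes first.
            by_contra hn
            obtain ⟨i, hi⟩ := not_forall.1 hz
            obtain ⟨j, hj⟩ := not_forall.1 hn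
            have b₁ := (asOrderHom z.1 i).2
            have b₂ := (asOrderHom z.2 i).2
            have b₃ := (asOrderHom z.1 j).2
            have b₄ := (asOrderHom z.2 j).2
            simp only [not_le, Fin.lt_def] at hi hj
            rcases le_total i j with hij | hij
            · have h₂ : (asOrderHom z.2 i : ℕ) ≤ (asOrderHom z.2 j : ℕ) :=
                (asOrderHom z.2).monotone hij
              omega
            · have h₁ : (asOrderHom z.1 j : ℕ) ≤ (asOrderHom z.1 i : ℕ) :=
                (asOrderHom z.1).monotone hij
              omega
          split_ifs with hc
          · exact (key n ((Δ[1] ⊗ Δ[1] : SSet.{v}).map f z) (fun i => hz' _) hc).trans e₂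
          · exact e₂ }
  refine ⟨Γ, ?_, ?_⟩
  · ext m w
    have hw : asOrderHom (lowerTriangle.app m w).2 ≤ asOrderHom (lowerTriangle.app m w).1 := by
      intro i
      change (Fin.predAbove 0 (asOrderHom w i)) ≤ (Fin.predAbove 1 (asOrderHom w i))
      generalize asOrderHom w i = t
      revert t
      decide
    have e : σ₁.app m ((lowerTriangle ≫ sumMap).app m w) = σ₁.app m w := by
      rw [lowerTriangle_sumMap]
      rfl
    exact (if_pos hw).trans e
  · ext m w
    have hw : asOrderHom (upperTriangle.app m w).1 ≤ asOrderHom (upperTriangle.app m w).2 := by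
      intro i
      change (Fin.predAbove 0 (asOrderHom w i)) ≤ (Fin.predAbove 1 (asOrderHom w i))
      generalize asOrderHom w i = t
      revert t
      decide
    have e : σ₂.app m ((upperTriangle ≫ sumMap).app m w) = σ₂.app m w := by
      rw [upperTriangle_sumMap]
      rfl
    change (if asOrderHom (upperTriangle.app m w).2 ≤ asOrderHom (upperTriangle.app m w).1 then
      σ₁.app m (sumMap.app m (upperTriangle.app m w)) else
      σ₂.app m ((upperTriangle ≫ sumMap).app m w)) = _
    split_ifs with hc
    · exact (key m _ hw hc).trans e
    · exact e

end Square

/-! ### Functoriality of path groupoids, and commuting squares. -/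

section Maps

variable {A A' K L M : SSet.{v}}

namespace Path

variable {a b c : A ⟶ K}

/-- The image of a path by a map. -/
@[simps]
def map (p : Path a b) (φ : K ⟶ L) {a' b' : A ⟶ L} (ha : a ≫ φ = a') (hb : b ≫ φ = b') :
    Path a' b' where
  h := p.h ≫ φ
  h₀ := by rw [← Category.assoc, p.h₀, ha]
  h₁ := by rw [← Category.assoc, p.h₁, hb]

/-- The restriction of a path to another space of parameters. -/
def pre (u : A' ⟶ A) (p : Path a b) {a' b' : A' ⟶ K} (ha : u ≫ a = a') (hb : u ≫ b = b') :
    Path a' b' where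
  h := u ▷ _ ≫ p.h
  h₀ := by rw [SSet.ι₀_comp_assoc, p.h₀, ha]
  h₁ := by rw [SSet.ι₁_comp_assoc, p.h₁, hb]

lemma Tri.map {p : Path a b} {q : Path b c} {r : Path a c} (h : Tri p q r) (φ : K ⟶ L)
    {a' b' c' : A ⟶ L} (ha : a ≫ φ = a') (hb : b ≫ φ = b') (hc : c ≫ φ = c') :
    Tri (p.map φ ha hb) (q.map φ hb hc) (r.map φ ha hc) := by
  obtain ⟨σ, h₂, h₀, h₁⟩ := h
  refine ⟨σ ≫ φ, ?_, ?_, ?_⟩ <;> simp only [map_h, ← h₂, ← h₀, ← h₁, Category.assoc]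

lemma refl_map (φ : K ⟶ L) {a' : A ⟶ L} (h h' : a ≫ φ = a') :
    (refl a).map φ h h' = refl a' := by
  subst h
  rfl

/-- A homotopy, as a path. -/
def ofHomotopy (H : SSet.Homotopy a b) : Path a b := ⟨H.h, H.h₀, H.h₁⟩

/-- A path, as a homotopy. -/
def toHomotopy (p : Path a b) : SSet.Homotopy a b where
  h := p.h
  h₀ := p.h₀
  h₁ := p.h₁
  rel := by
    ext n x
    exact x.1.2.elim

lemma whisker_bottom : A ◁ CartesianMonoidalCategory.lift (𝟙 Δ[1])
    (SSet.stdSimplex.σ 0 ≫ SSet.stdSimplex.δ 1) ≫ (α_ A Δ[1] Δ[1]).inv = SSet.ι₀ := by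
  rw [SSet.stdSimplex.δ_one_eq_const]
  rfl

lemma whisker_top : A ◁ CartesianMonoidalCategory.lift (𝟙 Δ[1])
    (SSet.stdSimplex.σ 0 ≫ SSet.stdSimplex.δ 0) ≫ (α_ A Δ[1] Δ[1]).inv = SSet.ι₁ := by
  rw [SSet.stdSimplex.δ_zero_eq_const]
  rfl

lemma whisker_left : A ◁ CartesianMonoidalCategory.lift
    (SSet.stdSimplex.σ 0 ≫ SSet.stdSimplex.δ 1) (𝟙 Δ[1]) ≫ (α_ A Δ[1] Δ[1]).inv =
      SSet.ι₀ ▷ Δ[1] := by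
  rw [SSet.stdSimplex.δ_one_eq_const]
  rfl

lemma whisker_right : A ◁ CartesianMonoidalCategory.lift
    (SSet.stdSimplex.σ 0 ≫ SSet.stdSimplex.δ 0) (𝟙 Δ[1]) ≫ (α_ A Δ[1] Δ[1]).inv =
      SSet.ι₁ ▷ Δ[1] := by
  rw [SSet.stdSimplex.δ_zero_eq_const]
  rfl

lemma comp_lift_eq {X Y Z W : SSet.{v}} {e : X ⟶ Y} {x : Y ⟶ Z} {y : Y ⟶ W} {x' : X ⟶ Z}
    {y' : X ⟶ W} (h : e ≫ x = x') (h' : e ≫ y = y') :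
    e ≫ CartesianMonoidalCategory.lift x y = CartesianMonoidalCategory.lift x' y' := by
  rw [CartesianMonoidalCategory.comp_lift, h, h']

lemma lowerTriangle_two : SSet.stdSimplex.δ 2 ≫ lowerTriangle.{v} =
    CartesianMonoidalCategory.lift (𝟙 Δ[1])
      (SSet.stdSimplex.σ 0 ≫ SSet.stdSimplex.δ 1) :=
  comp_lift_eq (by decide) (by decide)

lemma lowerTriangle_zero : SSet.stdSimplex.δ 0 ≫ lowerTriangle.{v} =
    CartesianMonoidalCategory.lift
      (SSet.stdSimplex.σ 0 ≫ SSet.stdSimplex.δ 0) (𝟙 Δ[1]) :=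
  comp_lift_eq (by decide) (by decide)

lemma upperTriangle_two : SSet.stdSimplex.δ 2 ≫ upperTriangle.{v} =
    CartesianMonoidalCategory.lift
      (SSet.stdSimplex.σ 0 ≫ SSet.stdSimplex.δ 1) (𝟙 Δ[1]) :=
  comp_lift_eq (by decide) (by decide)

lemma upperTriangle_zero : SSet.stdSimplex.δ 0 ≫ upperTriangle.{v} =
    CartesianMonoidalCategory.lift (𝟙 Δ[1])
      (SSet.stdSimplex.σ 0 ≫ SSet.stdSimplex.δ 0) :=
  comp_lift_eq (by decide) (by decide)

lemma lowerTriangle_one : SSet.stdSimplex.δ 1 ≫ lowerTriangle.{v} =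
    SSet.stdSimplex.δ 1 ≫ upperTriangle :=
  (comp_lift_eq (by decide) (by decide)).trans
    (comp_lift_eq (x' := 𝟙 Δ[1]) (y' := 𝟙 Δ[1]) (by decide) (by decide)).symm

/-- The diagonal of the square is a composite of `p` and `s` by the lower triangle, and of `r` and
`q` by the upper one. -/
lemma comm_of_square [SSet.KanComplex K] {a b a' b' : A ⟶ K} {p : Path a b} {q : Path a' b'}
    {r : Path a a'} {s : Path b b'} (Γ : (A ⊗ Δ[1]) ⊗ Δ[1] ⟶ K) (hp : SSet.ι₀ ≫ Γ = p.h)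
    (hq : SSet.ι₁ ≫ Γ = q.h) (hr : SSet.ι₀ ▷ _ ≫ Γ = r.h) (hs : SSet.ι₁ ▷ _ ≫ Γ = s.h) :
    p.cls ≫ s.cls = r.cls ≫ q.cls := by
  have face {e : Δ[1] ⟶ Δ[2]} {τ : Δ[2] ⟶ (Δ[1] ⊗ Δ[1] : SSet.{v})}
      {x : Δ[1] ⟶ (Δ[1] ⊗ Δ[1] : SSet.{v})} (hx : e ≫ τ = x) :
      A ◁ e ≫ A ◁ τ ≫ (α_ A Δ[1] Δ[1]).inv ≫ Γ = (A ◁ x ≫ (α_ A Δ[1] Δ[1]).inv) ≫ Γ := by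
    rw [← hx, whiskerLeft_comp, Category.assoc, Category.assoc]
  have l₂ := (face lowerTriangle_two).trans
    ((congrArg (· ≫ Γ) whisker_bottom).trans hp)
  have l₀ := (face lowerTriangle_zero).trans
    ((congrArg (· ≫ Γ) whisker_right).trans hs)
  have u₂ := (face upperTriangle_two).trans
    ((congrArg (· ≫ Γ) whisker_left).trans hr)
  have u₀ := (face upperTriangle_zero).trans
    ((congrArg (· ≫ Γ) whisker_top).trans hq)
  have l₁ := (face lowerTriangle_one).trans (face rfl).symm
  obtain ⟨d, hd⟩ : ∃ d : Path a b', d.h = A ◁ SSet.stdSimplex.δ 1 ≫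
      A ◁ lowerTriangle ≫ (α_ A Δ[1] Δ[1]).inv ≫ Γ :=
    ⟨ofδ _ ((whisker_δ_eq (n := 0) (i := 1) (j := 1) le_rfl l₂ rfl).symm.trans p.δ_one)
      ((whisker_δ_eq (n := 0) (i := 0) (j := 0) le_rfl rfl l₀).trans s.δ_zero), rfl⟩
  rw [tri_iff.1 (⟨_, l₂, l₀, hd.symm⟩ : Tri p s d),
    tri_iff.1 (⟨_, u₂, u₀, l₁.symm.trans hd.symm⟩ : Tri r q d)]

/-- One path `d` represents both composites, and the two triangles over it are glued along it. -/
lemma exists_square_of_comm [SSet.KanComplex K] {a b a' b' : A ⟶ K} {p : Path a b} {q : Path a' b'}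
    {r : Path a a'} {s : Path b b'} (h : p.cls ≫ s.cls = r.cls ≫ q.cls) :
    ∃ Γ : (A ⊗ Δ[1]) ⊗ Δ[1] ⟶ K, SSet.ι₀ ≫ Γ = p.h ∧
      SSet.ι₁ ≫ Γ = q.h ∧ SSet.ι₀ ▷ _ ≫ Γ = r.h ∧ SSet.ι₁ ▷ _ ≫ Γ = s.h := by
  obtain ⟨d, hd⟩ := exists_comp p s
  obtain ⟨σ₁, l₂, l₀, l₁⟩ := id hd
  obtain ⟨σ₂, u₂, u₀, u₁⟩ := tri_iff.2 (h.symm.trans (tri_iff.1 hd))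
  obtain ⟨Γ, h₁, h₂⟩ := exists_square (MonoidalClosed.curry σ₁) (MonoidalClosed.curry σ₂) (by
    rw [← MonoidalClosed.curry_natural_left, ← MonoidalClosed.curry_natural_left, l₁, u₁])
  have t₁ : A ◁ lowerTriangle ≫ MonoidalClosed.uncurry Γ = σ₁ := by
    rw [← MonoidalClosed.uncurry_natural_left, h₁, MonoidalClosed.uncurry_curry]
  have t₂ : A ◁ upperTriangle ≫ MonoidalClosed.uncurry Γ = σ₂ := by
    rw [← MonoidalClosed.uncurry_natural_left, h₂, MonoidalClosed.uncurry_curry]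
  have face {e : Δ[1] ⟶ Δ[2]} {τ : Δ[2] ⟶ (Δ[1] ⊗ Δ[1] : SSet.{v})} {σ : A ⊗ Δ[2] ⟶ K}
      (hσ : A ◁ τ ≫ MonoidalClosed.uncurry Γ = σ)
      {x : Δ[1] ⟶ (Δ[1] ⊗ Δ[1] : SSet.{v})} (hx : e ≫ τ = x)
      {y : A ⊗ Δ[1] ⟶ (A ⊗ Δ[1]) ⊗ Δ[1]} (hy : A ◁ x ≫ (α_ A Δ[1] Δ[1]).inv = y) :
      y ≫ (α_ A Δ[1] Δ[1]).hom ≫ MonoidalClosed.uncurry Γ = A ◁ e ≫ σ := by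
    rw [← hy, Category.assoc, Iso.inv_hom_id_assoc, ← hx, whiskerLeft_comp, Category.assoc, hσ]
  exact ⟨(α_ A Δ[1] Δ[1]).hom ≫ MonoidalClosed.uncurry Γ,
    (face t₁ lowerTriangle_two whisker_bottom).trans l₂,
    (face t₂ upperTriangle_zero whisker_top).trans u₀,
    (face t₂ upperTriangle_two whisker_left).trans u₂,
    (face t₁ lowerTriangle_zero whisker_right).trans l₀⟩

end Path

variable [SSet.KanComplex K] [SSet.KanComplex L] [SSet.KanComplex M]

namespace MapGroupoid

variable {a b c : A ⟶ K}

/-- The image of a class of paths by a map `φ`. -/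
def push (p : mk a ⟶ mk b) (φ : K ⟶ L) {a' b' : A ⟶ L} (ha : a ≫ φ = a') (hb : b ≫ φ = b') :
    mk a' ⟶ mk b' :=
  Quotient.map (fun p : Path a b => p.map φ ha hb) (fun p q (h : Path.Tri _ _ _) => by
    have := h.map φ ha hb hb
    rwa [Path.refl_map] at this) p

lemma cls_push (p : Path a b) (φ : K ⟶ L) {a' b' : A ⟶ L} (ha : a ≫ φ = a') (hb : b ≫ φ = b') :
    push p.cls φ ha hb = (p.map φ ha hb).cls := rfl

lemma push_comp (p : mk a ⟶ mk b) (q : mk b ⟶ mk c) (φ : K ⟶ L) {a' b' c' : A ⟶ L}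
    (ha : a ≫ φ = a') (hb : b ≫ φ = b') (hc : c ≫ φ = c') :
    push (p ≫ q) φ ha hc = push p φ ha hb ≫ push q φ hb hc := by
  obtain ⟨p, rfl⟩ := Path.cls_surjective p
  obtain ⟨q, rfl⟩ := Path.cls_surjective q
  obtain ⟨r, hr⟩ := Path.exists_comp p q
  rw [Path.tri_iff.1 hr, cls_push, cls_push, cls_push, Path.tri_iff.1 (hr.map φ ha hb hc)]

@[simp]
lemma push_id (φ : K ⟶ L) {a' : A ⟶ L} (h h' : a ≫ φ = a') :
    push (𝟙 (mk a)) φ h h' = 𝟙 (mk a') :=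
  congrArg Path.cls (Path.refl_map φ h h')

lemma push_inv (p : mk a ⟶ mk b) (φ : K ⟶ L) {a' b' : A ⟶ L} (ha : a ≫ φ = a')
    (hb : b ≫ φ = b') : push (inv p) φ hb ha = inv (push p φ ha hb) := by
  apply IsIso.eq_inv_of_hom_inv_id
  rw [← push_comp, IsIso.hom_inv_id, push_id]

lemma push_push (p : mk a ⟶ mk b) (φ : K ⟶ L) (ψ : L ⟶ M) {a' b' : A ⟶ L} {a'' b'' : A ⟶ M}
    (ha : a ≫ φ = a') (hb : b ≫ φ = b') (ha' : a' ≫ ψ = a'') (hb' : b' ≫ ψ = b'') {χ : K ⟶ M}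
    (hχ : φ ≫ ψ = χ) :
    push (push p φ ha hb) ψ ha' hb' =
      push p χ (by rw [← ha', ← ha, ← hχ, Category.assoc])
        (by rw [← hb', ← hb, ← hχ, Category.assoc]) := by
  obtain ⟨p, rfl⟩ := Path.cls_surjective p
  subst hχ
  exact congrArg Path.cls (Path.ext (Category.assoc _ _ _))

@[simp]
lemma push_one (p : mk a ⟶ mk b) (h : a ≫ 𝟙 K = a) (h' : b ≫ 𝟙 K = b) :
    push p (𝟙 K) h h' = p := by
  obtain ⟨p, rfl⟩ := Path.cls_surjective p
  exact congrArg Path.cls (Path.ext (Category.comp_id _))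

/-- A homotopy of maps `K ⟶ L` is natural with respect to paths in `K`. -/
lemma naturality {φ ψ : K ⟶ L} (H : Path φ ψ) (p : mk a ⟶ mk b) {a₀ b₀ a₁ b₁ : A ⟶ L}
    (ha₀ : a ≫ φ = a₀) (hb₀ : b ≫ φ = b₀) (ha₁ : a ≫ ψ = a₁) (hb₁ : b ≫ ψ = b₁) :
    push p φ ha₀ hb₀ ≫ (H.pre b hb₀ hb₁).cls = (H.pre a ha₀ ha₁).cls ≫ push p ψ ha₁ hb₁ := by
  obtain ⟨p, rfl⟩ := Path.cls_surjective p
  refine Path.comm_of_square (p.h ▷ _ ≫ H.h) ?_ ?_ ?_ ?_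
  · rw [SSet.ι₀_comp_assoc, H.h₀]; rfl
  · rw [SSet.ι₁_comp_assoc, H.h₁]; rfl
  · rw [← comp_whiskerRight_assoc, p.h₀]; rfl
  · rw [← comp_whiskerRight_assoc, p.h₁]; rfl

end MapGroupoid

end Maps

/-! ### Homotopy equivalences and homotopy pullbacks in terms of path groupoids. -/

section HomotopyEquivalences

open MapGroupoid

variable {A K L M : SSet.{v}}

/-- A path between the restrictions of two equal maps. -/
def Path.ofEq {a b : A ⟶ K} (h : a = b) : Path a b := ⟨(Path.refl a).h, rfl, h⟩

lemma isHomotopyEquivalence_iff_path {f : K ⟶ L} :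
    IsHomotopyEquivalence f ↔
      ∃ g : L ⟶ K, Nonempty (Path (f ≫ g) (𝟙 K)) ∧ Nonempty (Path (g ≫ f) (𝟙 L)) :=
  exists_congr fun _ => and_congr
    ⟨fun ⟨H⟩ => ⟨.ofHomotopy H⟩, fun ⟨p⟩ => ⟨p.toHomotopy⟩⟩
    ⟨fun ⟨H⟩ => ⟨.ofHomotopy H⟩, fun ⟨p⟩ => ⟨p.toHomotopy⟩⟩

namespace IsHomotopyEquivalence

lemma exists_preimage {f : K ⟶ L} (hf : IsHomotopyEquivalence f) (y : A ⟶ L) :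
    ∃ x : A ⟶ K, Nonempty (Path (x ≫ f) y) := by
  obtain ⟨g, -, ⟨H⟩⟩ := isHomotopyEquivalence_iff_path.1 hf
  exact ⟨y ≫ g, ⟨H.pre y (Category.assoc _ _ _).symm (Category.comp_id _)⟩⟩

variable [SSet.KanComplex K]

lemma reflects {f : K ⟶ L} (hf : IsHomotopyEquivalence f) {x x' : A ⟶ K}
    (p : Path (x ≫ f) (x' ≫ f)) : Nonempty (mk x ⟶ mk x') := by
  obtain ⟨g, ⟨H⟩, -⟩ := isHomotopyEquivalence_iff_path.1 hf
  exact ⟨inv (H.pre x rfl (Category.comp_id _)).cls ≫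
    (p.map g (Category.assoc _ _ _) (Category.assoc _ _ _)).cls ≫
    (H.pre x' rfl (Category.comp_id _)).cls⟩

/-- By naturality of `H`, up to conjugation by its tracks `f` acts as the identity on classes of
paths. That homotopy equivalences are faithful and full on paths follows from this. -/
lemma eq_of_path_id {f : K ⟶ K} (H : Path f (𝟙 K)) {a b : A ⟶ K} (p : mk a ⟶ mk b) :
    p = inv (H.pre a rfl (Category.comp_id _)).cls ≫ push p f rfl rfl ≫
      (H.pre b rfl (Category.comp_id _)).cls := by
  rw [IsIso.eq_inv_comp, naturality H p rfl rfl (Category.comp_id _) (Category.comp_id _), push_one]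

variable [SSet.KanComplex L]

lemma faithful {f : K ⟶ L} (hf : IsHomotopyEquivalence f) {a b : A ⟶ K} {p q : mk a ⟶ mk b}
    {a' b' : A ⟶ L} {ha : a ≫ f = a'} {hb : b ≫ f = b'}
    (h : push p f ha hb = push q f ha hb) : p = q := by
  obtain ⟨g, ⟨H⟩, -⟩ := isHomotopyEquivalence_iff_path.1 hf
  have e : push p (f ≫ g) rfl rfl = push q (f ≫ g) rfl rfl := by
    subst ha hb
    rw [← push_push p f g rfl rfl (Category.assoc _ _ _) (Category.assoc _ _ _) rfl, h,
      push_push q f g rfl rfl (Category.assoc _ _ _) (Category.assoc _ _ _) rfl]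
  rw [eq_of_path_id H p, eq_of_path_id H q, e]

lemma full {f : K ⟶ L} (hf : IsHomotopyEquivalence f) {a b : A ⟶ K} {a' b' : A ⟶ L}
    (ha : a ≫ f = a') (hb : b ≫ f = b') (r : mk a' ⟶ mk b') :
    ∃ p : mk a ⟶ mk b, push p f ha hb = r := by
  subst ha hb
  obtain ⟨g, ⟨H⟩, ⟨H'⟩⟩ := isHomotopyEquivalence_iff_path.1 hf
  have hg : IsHomotopyEquivalence g := isHomotopyEquivalence_iff_path.2 ⟨f, ⟨H'⟩, ⟨H⟩⟩
  let p : mk a ⟶ mk b := inv (H.pre a rfl (Category.comp_id _)).cls ≫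
    push r g (Category.assoc _ _ _) (Category.assoc _ _ _) ≫
    (H.pre b rfl (Category.comp_id _)).cls
  -- The homotopy inverse `g` is faithful as well, so the equation may be checked after applying it.
  refine ⟨p, hg.faithful (ha := Category.assoc _ _ _) (hb := Category.assoc _ _ _) ?_⟩
  rw [push_push p f g rfl rfl (Category.assoc _ _ _) (Category.assoc _ _ _) rfl]
  have e := eq_of_path_id H p
  simpa only [p, cancel_epi, cancel_mono] using e.symm

end IsHomotopyEquivalence

/-- Yoneda in the homotopy category: the inverse is a preimage of `𝟙 L`. -/
lemma IsHomotopyEquivalence.of_bijective {f : K ⟶ L}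
    (surj : ∀ {A : SSet.{v}} (y : A ⟶ L), ∃ x : A ⟶ K, Nonempty (Path (x ≫ f) y))
    (inj : ∀ {A : SSet.{v}} (x x' : A ⟶ K), Nonempty (Path (x ≫ f) (x' ≫ f)) →
      Nonempty (Path x x')) : IsHomotopyEquivalence f := by
  rw [isHomotopyEquivalence_iff_path]
  obtain ⟨g, ⟨r⟩⟩ := surj (𝟙 L)
  exact ⟨g, inj (f ≫ g) (𝟙 K) (by
    rw [Category.assoc, Category.id_comp]
    exact ⟨r.pre f rfl (Category.comp_id _)⟩), ⟨r⟩⟩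

lemma kanComplex_tensor (K M : SSet.{v}) [SSet.KanComplex K] [SSet.KanComplex M] :
    SSet.KanComplex (K ⊗ M) := by
  rw [SSet.KanComplex.iff]
  intro n i f hf
  have h₁ := SSet.horn.IsCompatible.of_hom (hf.desc ≫ CartesianMonoidalCategory.fst K M)
  have h₂ := SSet.horn.IsCompatible.of_hom (hf.desc ≫ CartesianMonoidalCategory.snd K M)
  obtain ⟨φ, hφ⟩ := h₁.exists_lift_of_kanComplex
  obtain ⟨ψ, hψ⟩ := h₂.exists_lift_of_kanComplex
  refine ⟨CartesianMonoidalCategory.lift φ ψ, fun j hj => ?_⟩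
  rw [CartesianMonoidalCategory.comp_lift, hφ j hj, hψ j hj, ← CartesianMonoidalCategory.comp_lift,
    ← CartesianMonoidalCategory.comp_lift, CartesianMonoidalCategory.lift_fst_snd]
  simp

/-- The path parametrized by a map to the space of paths. -/
def Path.ofPathSpace (z : A ⟶ pathSpace L) : Path (z ≫ pathStart L) (z ≫ pathEnd L) where
  h := z ▷ Δ[1] ≫ (β_ _ _).hom ≫ (ihom.ev Δ[1]).app L
  h₀ := by rw [SSet.ι₀_comp_assoc, pathStart]
  h₁ := by rw [SSet.ι₁_comp_assoc, pathEnd]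

lemma pathSpace_hom_ext {z z' : A ⟶ pathSpace L}
    (h : (Path.ofPathSpace z).h = (Path.ofPathSpace z').h) : z = z' := by
  apply MonoidalClosed.uncurry_injective
  rw [MonoidalClosed.uncurry_eq, MonoidalClosed.uncurry_eq]
  have h' : (β_ A Δ[1]).hom ≫ Δ[1] ◁ z ≫ (ihom.ev Δ[1]).app L =
      (β_ A Δ[1]).hom ≫ Δ[1] ◁ z' ≫ (ihom.ev Δ[1]).app L := by
    rw [← BraidedCategory.braiding_naturality_left_assoc,
      ← BraidedCategory.braiding_naturality_left_assoc]
    exact h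
  exact (cancel_epi _).1 h'

lemma Path.ofPathSpace_comp {B : SSet.{v}} (u : B ⟶ A) (z : A ⟶ pathSpace L) :
    (ofPathSpace (u ≫ z)).h = u ▷ Δ[1] ≫ (ofPathSpace z).h := by
  exact comp_whiskerRight_assoc _ _ _ _

section IteratedPullback

variable {B N : SSet.{v}} {f : K ⟶ L} {s e : N ⟶ L} {g : M ⟶ L}

lemma pullback_pullback_hom_ext {y y' : A ⟶ pullback (pullback.snd f s ≫ e) g}
    (h₁ : y ≫ pullback.fst _ _ ≫ pullback.fst _ _ = y' ≫ pullback.fst _ _ ≫ pullback.fst _ _)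
    (h₂ : y ≫ pullback.fst _ _ ≫ pullback.snd _ _ = y' ≫ pullback.fst _ _ ≫ pullback.snd _ _)
    (h₃ : y ≫ pullback.snd _ _ = y' ≫ pullback.snd _ _) : y = y' :=
  pullback.hom_ext (pullback.hom_ext (by simpa using h₁) (by simpa using h₂)) h₃

lemma pullback_pullback_start :
    (pullback.fst (pullback.snd f s ≫ e) g ≫ pullback.snd _ _) ≫ s =
      (pullback.fst _ _ ≫ pullback.fst _ _) ≫ f := by
  rw [Category.assoc, Category.assoc, pullback.condition]

lemma pullback_pullback_end :
    (pullback.fst (pullback.snd f s ≫ e) g ≫ pullback.snd _ _) ≫ e = pullback.snd _ _ ≫ g := by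
  rw [Category.assoc, pullback.condition]

lemma pullback_pullback_lift {a : A ⟶ K} {n : A ⟶ N} {b : A ⟶ M} (h : a ≫ f = n ≫ s)
    (h' : pullback.lift a n h ≫ pullback.snd f s ≫ e = b ≫ g) :
    pullback.lift (pullback.lift a n h) b h' ≫ pullback.fst _ _ ≫ pullback.fst _ _ = a ∧
      pullback.lift (pullback.lift a n h) b h' ≫ pullback.fst _ _ ≫ pullback.snd _ _ = n ∧
      pullback.lift (pullback.lift a n h) b h' ≫ pullback.snd _ _ = b :=
  ⟨by rw [pullback.lift_fst_assoc, pullback.lift_fst],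
    by rw [pullback.lift_fst_assoc, pullback.lift_snd], pullback.lift_snd _ _ _⟩

end IteratedPullback

section HPullback

variable {f : K ⟶ L} {g : M ⟶ L}

/-- The first component of a point of a homotopy pullback. -/
def hPullbackFst (f : K ⟶ L) (g : M ⟶ L) : hPullback f g ⟶ K :=
  pullback.fst _ _ ≫ pullback.fst _ _

/-- The path which is part of a point of a homotopy pullback. -/
def hPullbackMid (f : K ⟶ L) (g : M ⟶ L) : hPullback f g ⟶ pathSpace L :=
  pullback.fst _ _ ≫ pullback.snd _ _

/-- The last component of a point of a homotopy pullback. -/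
def hPullbackSnd (f : K ⟶ L) (g : M ⟶ L) : hPullback f g ⟶ M := pullback.snd _ _

lemma hPullbackMid_start : hPullbackMid f g ≫ pathStart L = hPullbackFst f g ≫ f :=
  pullback_pullback_start

lemma hPullbackMid_end : hPullbackMid f g ≫ pathEnd L = hPullbackSnd f g ≫ g :=
  pullback_pullback_end

/-- The path which is part of a parametrized point of a homotopy pullback. -/
def hPullbackPath (y : A ⟶ hPullback f g) :
    Path ((y ≫ hPullbackFst f g) ≫ f) ((y ≫ hPullbackSnd f g) ≫ g) where
  h := (Path.ofPathSpace (y ≫ hPullbackMid f g)).h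
  h₀ := by rw [(Path.ofPathSpace _).h₀, Category.assoc, hPullbackMid_start, Category.assoc]
  h₁ := by rw [(Path.ofPathSpace _).h₁, Category.assoc, hPullbackMid_end, Category.assoc]

lemma hPullback_hom_ext {y y' : A ⟶ hPullback f g}
    (h₁ : y ≫ hPullbackFst f g = y' ≫ hPullbackFst f g)
    (h₂ : y ≫ hPullbackSnd f g = y' ≫ hPullbackSnd f g)
    (h₃ : (hPullbackPath y).h = (hPullbackPath y').h) : y = y' :=
  pullback_pullback_hom_ext h₁ (pathSpace_hom_ext h₃) h₂

section

variable {a : A ⟶ K} {b : A ⟶ M} (h : A ⊗ Δ[1] ⟶ L) (h₀ : SSet.ι₀ ≫ h = a ≫ f)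
  (h₁ : SSet.ι₁ ≫ h = b ≫ g)

lemma hPullbackLift_fst : hPullbackLift a b h h₀ h₁ ≫ hPullbackFst f g = a :=
  (pullback_pullback_lift _ _).1

lemma hPullbackLift_mid : hPullbackLift a b h h₀ h₁ ≫ hPullbackMid f g = toPathSpace h :=
  (pullback_pullback_lift _ _).2.1

lemma hPullbackLift_snd : hPullbackLift a b h h₀ h₁ ≫ hPullbackSnd f g = b :=
  (pullback_pullback_lift _ _).2.2

lemma hPullbackLift_path : (hPullbackPath (hPullbackLift a b h h₀ h₁)).h = h := by
  change (_ ≫ hPullbackMid f g) ▷ Δ[1] ≫ _ = _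
  rw [hPullbackLift_mid]
  exact toPathSpace_ev h

end

lemma hPullbackPath_comp {B : SSet.{v}} (u : B ⟶ A) (y : A ⟶ hPullback f g) :
    (hPullbackPath (u ≫ y)).h = u ▷ Δ[1] ≫ (hPullbackPath y).h := by
  have := Path.ofPathSpace_comp u (y ≫ hPullbackMid f g)
  rw [← Category.assoc] at this
  exact this

variable [SSet.KanComplex L]

/-- A path in the homotopy pullback is a path in each factor together with a square in `L` between
their images, and a square with given sides exists exactly when the sides commute in the path
groupoid. The separate names for composites let callers choose their form. -/
lemma hPullback_path_iff {y y' : A ⟶ hPullback f g} {a a' : A ⟶ K} {b b' : A ⟶ M}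
    {fa fa' gb gb' : A ⟶ L} (ha : y ≫ hPullbackFst f g = a) (hb : y ≫ hPullbackSnd f g = b)
    (ha' : y' ≫ hPullbackFst f g = a') (hb' : y' ≫ hPullbackSnd f g = b') (hfa : a ≫ f = fa)
    (hfa' : a' ≫ f = fa') (hgb : b ≫ g = gb) (hgb' : b' ≫ g = gb') {p : Path fa gb}
    {p' : Path fa' gb'} (hp : (hPullbackPath y).h = p.h) (hp' : (hPullbackPath y').h = p'.h) :
    Nonempty (Path y y') ↔ ∃ (α : Path a a') (β : Path b b'),
      (α.map f hfa hfa').cls ≫ p'.cls = p.cls ≫ (β.map g hgb hgb').cls := by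
  subst ha hb ha' hb' hfa hfa' hgb hgb'
  obtain rfl : hPullbackPath y = p := Path.ext hp
  obtain rfl : hPullbackPath y' = p' := Path.ext hp'
  constructor
  · rintro ⟨r⟩
    refine ⟨r.map _ rfl rfl, r.map _ rfl rfl,
      Path.comm_of_square (hPullbackPath r.h).h ?_ ?_ ?_ ?_⟩
    · exact (hPullbackPath r.h).h₀
    · exact (hPullbackPath r.h).h₁
    · rw [← hPullbackPath_comp, r.h₀]
    · rw [← hPullbackPath_comp, r.h₁]
  · rintro ⟨α, β, h⟩
    obtain ⟨Γ, h₀, h₁, h₂, h₃⟩ := Path.exists_square_of_comm h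
    refine ⟨⟨hPullbackLift α.h β.h Γ h₀ h₁, hPullback_hom_ext ?_ ?_ ?_,
      hPullback_hom_ext ?_ ?_ ?_⟩⟩
    · exact (congrArg (SSet.ι₀ ≫ ·) (hPullbackLift_fst Γ h₀ h₁)).trans α.h₀
    · exact (congrArg (SSet.ι₀ ≫ ·) (hPullbackLift_snd Γ h₀ h₁)).trans β.h₀
    · exact (hPullbackPath_comp _ _).trans
        ((congrArg (SSet.ι₀ ▷ _ ≫ ·) (hPullbackLift_path Γ h₀ h₁)).trans h₂)
    · exact (congrArg (SSet.ι₁ ≫ ·) (hPullbackLift_fst Γ h₀ h₁)).trans α.h₁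
    · exact (congrArg (SSet.ι₁ ≫ ·) (hPullbackLift_snd Γ h₀ h₁)).trans β.h₁
    · exact (hPullbackPath_comp _ _).trans
        ((congrArg (SSet.ι₁ ▷ _ ≫ ·) (hPullbackLift_path Γ h₀ h₁)).trans h₃)

/-- A path in the homotopy fibre is a path in `K` compatible with the structure paths to `φ`, since
paths in the point are trivial. Contractibility then says that there is a point and that any two
parametrized points are connected. -/
lemma isContractible_hPullback_iff [SSet.KanComplex K] {f : K ⟶ L} {φ : 𝟙_ SSet.{v} ⟶ L} :
    IsContractible (hPullback f φ) ↔
      (∃ x : 𝟙_ SSet.{v} ⟶ K, Nonempty (mk (x ≫ f) ⟶ mk φ)) ∧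
      ∀ (A : SSet.{v}) (x x' : A ⟶ K)
        (γ : mk (x ≫ f) ⟶ mk (SemiCartesianMonoidalCategory.toUnit A ≫ φ))
        (γ' : mk (x' ≫ f) ⟶ mk (SemiCartesianMonoidalCategory.toUnit A ≫ φ)),
        ∃ α : mk x ⟶ mk x', push α f rfl rfl ≫ γ' = γ := by
  have hu {A : SSet.{v}} (y : A ⟶ hPullback f φ) : y ≫ hPullbackSnd f φ =
      SemiCartesianMonoidalCategory.toUnit A := CartesianMonoidalCategory.toUnit_unique _ _
  have key {A : SSet.{v}} {y y' : A ⟶ hPullback f φ} {x x' : A ⟶ K}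
      (hx : y ≫ hPullbackFst f φ = x) (hx' : y' ≫ hPullbackFst f φ = x')
      {p : Path (x ≫ f) (SemiCartesianMonoidalCategory.toUnit A ≫ φ)}
      {p' : Path (x' ≫ f) (SemiCartesianMonoidalCategory.toUnit A ≫ φ)}
      (hp : (hPullbackPath y).h = p.h) (hp' : (hPullbackPath y').h = p'.h) :
      Nonempty (Path y y') ↔ ∃ α : mk x ⟶ mk x', push α f rfl rfl ≫ p'.cls = p.cls := by
    rw [hPullback_path_iff hx (hu y) hx' (hu y') rfl rfl rfl rfl hp hp']
    have hβ (β : Path (SemiCartesianMonoidalCategory.toUnit A)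
        (SemiCartesianMonoidalCategory.toUnit A)) : (β.map φ rfl rfl).cls = 𝟙 _ := by
      rw [show β = Path.refl _ from Path.ext (CartesianMonoidalCategory.toUnit_unique _ _),
        Path.refl_map, Path.cls_refl]
    constructor
    · rintro ⟨α, β, h⟩
      rw [hβ, Category.comp_id] at h
      exact ⟨α.cls, h⟩
    · rintro ⟨α, h⟩
      obtain ⟨α, rfl⟩ := Path.cls_surjective α
      exact ⟨α, Path.refl _, by rw [hβ, Category.comp_id]; exact h⟩
  have lift {A : SSet.{v}} (x : A ⟶ K)
      (p : Path (x ≫ f) (SemiCartesianMonoidalCategory.toUnit A ≫ φ)) :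
      ∃ y : A ⟶ hPullback f φ, y ≫ hPullbackFst f φ = x ∧ (hPullbackPath y).h = p.h :=
    ⟨hPullbackLift x _ p.h p.h₀ p.h₁, hPullbackLift_fst _ _ _, hPullbackLift_path _ _ _⟩
  constructor
  · intro h
    obtain ⟨y, ⟨r⟩, -⟩ := isHomotopyEquivalence_iff_path.1 h
    have hy : y ≫ hPullbackSnd f φ = 𝟙 _ := CartesianMonoidalCategory.toUnit_unique _ _
    refine ⟨⟨y ≫ hPullbackFst f φ, ⟨(⟨(hPullbackPath y).h, (hPullbackPath y).h₀,
      (hPullbackPath y).h₁.trans (by rw [hy, Category.id_comp])⟩ : Path _ _).cls⟩⟩, ?_⟩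
    intro A x x' γ γ'
    obtain ⟨γ, rfl⟩ := Path.cls_surjective γ
    obtain ⟨γ', rfl⟩ := Path.cls_surjective γ'
    obtain ⟨z, hz, hz'⟩ := lift x γ
    obtain ⟨w, hw, hw'⟩ := lift x' γ'
    -- Both given points are connected to the constant family at `y`, hence to each other.
    let u : A ⟶ hPullback f φ := SemiCartesianMonoidalCategory.toUnit A ≫ y
    have path (t : A ⟶ hPullback f φ) : Nonempty (Path u t) :=
      ⟨r.pre t ((Category.assoc _ _ _).symm.trans
        (congrArg (· ≫ y) (CartesianMonoidalCategory.toUnit_unique _ _))) (Category.comp_id _)⟩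
    let p : Path ((u ≫ hPullbackFst f φ) ≫ f) (SemiCartesianMonoidalCategory.toUnit A ≫ φ) :=
      ⟨(hPullbackPath u).h, (hPullbackPath u).h₀, (hPullbackPath u).h₁.trans (by rw [hu])⟩
    obtain ⟨α, hα⟩ := (key rfl hz (p := p) rfl hz').1 (path z)
    obtain ⟨β, hβ⟩ := (key rfl hw (p := p) rfl hw').1 (path w)
    exact ⟨inv α ≫ β, by rw [push_comp (hb := rfl), push_inv, Category.assoc, hβ,
      ← hα, IsIso.inv_hom_id_assoc]⟩
  · rintro ⟨⟨x, ⟨γ⟩⟩, h⟩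
    obtain ⟨γ, rfl⟩ := Path.cls_surjective γ
    obtain ⟨y, -, -⟩ := lift x ⟨γ.h, γ.h₀, γ.h₁.trans (Category.id_comp _).symm⟩
    refine isHomotopyEquivalence_iff_path.2
      ⟨y, ?_, ⟨Path.ofEq (CartesianMonoidalCategory.toUnit_unique _ _)⟩⟩
    have p (t : hPullback f φ ⟶ hPullback f φ) : ∃ p : Path ((t ≫ hPullbackFst f φ) ≫ f)
        (SemiCartesianMonoidalCategory.toUnit _ ≫ φ), (hPullbackPath t).h = p.h :=
      ⟨⟨(hPullbackPath t).h, (hPullbackPath t).h₀, (hPullbackPath t).h₁.trans (by rw [hu])⟩, rfl⟩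
    obtain ⟨p₁, h₁⟩ := p (SemiCartesianMonoidalCategory.toUnit (hPullback f φ) ≫ y)
    obtain ⟨p₂, h₂⟩ := p (𝟙 _)
    -- The universal case: the parameter space is the homotopy fibre itself, and the two points are
    -- the constant map and the identity.
    exact (key rfl rfl h₁ h₂).2 (h _ _ _ _ _)

end HPullback

end HomotopyEquivalences

/-! ### The homotopy 2-category of a simplicial category. -/

section TwoCells

open MapGroupoid SimplicialCategory

variable {C : Type u} [Category.{v} C] [SimplicialCategory C]

lemma eHomEquiv_whiskerLeft {X Y Z : C} (f : X ⟶ Y) (k : Y ⟶ Z) :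
    eHomEquiv SSet f ≫ eHomWhiskerLeft SSet X k = eHomEquiv SSet (f ≫ k) := by
  rw [eHomEquiv_comp, eHomWhiskerLeft, MonoidalCategory.tensorHom_def, rightUnitor_inv_naturality_assoc,
    Category.assoc, unitors_inv_equal]

lemma eHomEquiv_whiskerRight {X Y Z : C} (u : X ⟶ Y) (f : Y ⟶ Z) :
    eHomEquiv SSet f ≫ eHomWhiskerRight SSet u Z = eHomEquiv SSet (u ≫ f) := by
  rw [eHomEquiv_comp, eHomWhiskerRight, tensorHom_def', leftUnitor_inv_naturality_assoc,
    Category.assoc]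

lemma toUnit_unit_comp {K : SSet.{v}} (g : 𝟙_ SSet.{v} ⟶ K) :
    SemiCartesianMonoidalCategory.toUnit _ ≫ g = g := by
  rw [CartesianMonoidalCategory.toUnit_unique (SemiCartesianMonoidalCategory.toUnit _) (𝟙 _),
    Category.id_comp]

lemma const_unit_injective {K : SSet.{v}} {x y : K _⦋0⦌}
    (h : (SSet.const x : 𝟙_ SSet.{v} ⟶ K) = SSet.const y) : x = y :=
  K.unitHomEquiv.symm.injective h

lemma const_leftUnitor_inv : (SSet.const (SSet.stdSimplex.obj₀Equiv.symm 0) : 𝟙_ SSet.{v} ⟶ Δ[1]) ≫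
    (λ_ Δ[1]).inv = SSet.ι₀ := rfl

lemma const_leftUnitor_inv' : (SSet.const (SSet.stdSimplex.obj₀Equiv.symm 1) : 𝟙_ SSet.{v} ⟶ Δ[1]) ≫
    (λ_ Δ[1]).inv = SSet.ι₁ := rfl

variable [∀ X Y : C, SSet.KanComplex (sHom X Y)] {W X Y Z Z' : C}

/-- The homotopy classes of homotopies between two maps. -/
abbrev Cell (f g : X ⟶ Y) : Type v :=
  (mk (eHomEquiv SSet f) : MapGroupoid (𝟙_ SSet) (sHom X Y)) ⟶ mk (eHomEquiv SSet g)

infix:50 " ⇛ " => Cell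

namespace Cell

/-- The cell between two equal maps. -/
def ofEq {f g : X ⟶ Y} (h : f = g) : f ⇛ g := eqToHom (by rw [h])

/-- The composition of a cell with a map on its target. -/
def post {f g : X ⟶ Y} (α : f ⇛ g) (k : Y ⟶ Z) {f' g' : X ⟶ Z} (hf : f ≫ k = f')
    (hg : g ≫ k = g') : f' ⇛ g' :=
  push α (eHomWhiskerLeft SSet X k) (by rw [eHomEquiv_whiskerLeft, hf])
    (by rw [eHomEquiv_whiskerLeft, hg])

/-- The composition of a cell with a map on its source. -/
def pre (u : W ⟶ X) {f g : X ⟶ Y} (α : f ⇛ g) {f' g' : W ⟶ Y} (hf : u ≫ f = f')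
    (hg : u ≫ g = g') : f' ⇛ g' :=
  push α (eHomWhiskerRight SSet u Y) (by rw [eHomEquiv_whiskerRight, hf])
    (by rw [eHomEquiv_whiskerRight, hg])

variable {f g h : X ⟶ Y}

/-- Here and below composites are variables tied down by equations, which absorbs the associativity
of composition in `C` without transports in the formulas. -/
lemma post_comp (α : f ⇛ g) (β : g ⇛ h) (k : Y ⟶ Z) {f' g' h' : X ⟶ Z} (hf : f ≫ k = f')
    (hg : g ≫ k = g') (hh : h ≫ k = h') :
    post (α ≫ β) k hf hh = post α k hf hg ≫ post β k hg hh :=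
  push_comp _ _ _ _ _ _

lemma pre_comp (u : W ⟶ X) (α : f ⇛ g) (β : g ⇛ h) {f' g' h' : W ⟶ Y} (hf : u ≫ f = f')
    (hg : u ≫ g = g') (hh : u ≫ h = h') :
    pre u (α ≫ β) hf hh = pre u α hf hg ≫ pre u β hg hh :=
  push_comp _ _ _ _ _ _

lemma pre_comp_assoc (u : W ⟶ X) (α : f ⇛ g) (β : g ⇛ h) {f' g' h' e : W ⟶ Y} (hf : u ≫ f = f')
    (hg : u ≫ g = g') (hh : u ≫ h = h') (γ : h' ⇛ e) :
    pre u (α ≫ β) hf hh ≫ γ = pre u α hf hg ≫ pre u β hg hh ≫ γ :=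
  (congrArg (· ≫ γ) (pre_comp u α β hf hg hh)).trans (Category.assoc _ _ _)

@[simp]
lemma pre_id (u : W ⟶ X) {f' : W ⟶ Y} (hf hf' : u ≫ f = f') :
    pre u (𝟙 _ : f ⇛ f) hf hf' = 𝟙 _ := push_id _ _ _

lemma post_inv (α : f ⇛ g) (k : Y ⟶ Z) {f' g' : X ⟶ Z} (hf : f ≫ k = f') (hg : g ≫ k = g') :
    post (inv α) k hg hf = inv (post α k hf hg) := push_inv _ _ _ _

lemma post_post (α : f ⇛ g) (k : Y ⟶ Z) (l : Z ⟶ Z') {m : Y ⟶ Z'} (hm : k ≫ l = m)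
    {f' g' : X ⟶ Z} {f'' g'' : X ⟶ Z'} (hf : f ≫ k = f') (hg : g ≫ k = g')
    (hf' : f' ≫ l = f'') (hg' : g' ≫ l = g'') :
    post (post α k hf hg) l hf' hg' =
      post α m (by rw [← hm, ← hf', ← hf, Category.assoc])
        (by rw [← hm, ← hg', ← hg, Category.assoc]) :=
  push_push _ _ _ _ _ _ _ (by rw [← hm, eHomWhiskerLeft_comp])

lemma pre_pre (t : Z ⟶ W) (u : W ⟶ X) (α : f ⇛ g) {m : Z ⟶ X} (hm : t ≫ u = m)
    {f' g' : W ⟶ Y} {f'' g'' : Z ⟶ Y} (hf : u ≫ f = f') (hg : u ≫ g = g')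
    (hf' : t ≫ f' = f'') (hg' : t ≫ g' = g'') :
    pre t (pre u α hf hg) hf' hg' =
      pre m α (by rw [← hm, ← hf', ← hf, Category.assoc])
        (by rw [← hm, ← hg', ← hg, Category.assoc]) :=
  push_push _ _ _ _ _ _ _ (by rw [← hm, eHomWhiskerRight_comp])

lemma post_pre (u : W ⟶ X) (α : f ⇛ g) (k : Y ⟶ Z) {f₁ g₁ : W ⟶ Y} {f₂ g₂ : X ⟶ Z}
    {f₃ g₃ : W ⟶ Z} (hf₁ : u ≫ f = f₁) (hg₁ : u ≫ g = g₁) (hf₂ : f ≫ k = f₂) (hg₂ : g ≫ k = g₂)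
    (hf₃ : f₁ ≫ k = f₃) (hg₃ : g₁ ≫ k = g₃) (hf₃' : u ≫ f₂ = f₃) (hg₃' : u ≫ g₂ = g₃) :
    post (pre u α hf₁ hg₁) k hf₃ hg₃ = pre u (post α k hf₂ hg₂) hf₃' hg₃' :=
  (push_push _ _ _ _ _ _ _ rfl).trans
    (push_push _ _ _ _ _ _ _ (eHom_whisker_exchange SSet u k)).symm

lemma pre_one (α : f ⇛ g) (hf : 𝟙 _ ≫ f = f) (hg : 𝟙 _ ≫ g = g) : pre (𝟙 X) α hf hg = α := by
  have h := eHomWhiskerRight_id SSet X Y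
  simp only [pre, h, push_one]

lemma exists_path (α : f ⇛ g) : ∃ p : Path (eHomEquiv SSet f) (eHomEquiv SSet g), p.cls = α :=
  Path.cls_surjective α

/-- The path determined by a homotopy. -/
def pathOfHtpy (η : Htpy f g) : Path (eHomEquiv SSet f) (eHomEquiv SSet g) where
  h := CartesianMonoidalCategory.snd _ _ ≫ SSet.yonedaEquiv.symm η.edge
  h₀ := by
    have e := const_zero_edge (X := 𝟙_ SSet) η.edge
    rw [SSet.Edge.src_eq] at e
    exact e.trans ((toUnit_comp_eq_const (eHomEquiv SSet f)).symm.trans (toUnit_unit_comp _))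
  h₁ := by
    have e := const_one_edge (X := 𝟙_ SSet) η.edge
    rw [SSet.Edge.tgt_eq] at e
    exact e.trans ((toUnit_comp_eq_const (eHomEquiv SSet g)).symm.trans (toUnit_unit_comp _))

/-- The homotopy determined by a path. -/
def htpyOfPath (p : Path (eHomEquiv SSet f) (eHomEquiv SSet g)) : Htpy f g where
  edge := SSet.yonedaEquiv ((λ_ _).inv ≫ p.h)
  src_eq := by
    apply const_unit_injective
    have e := const_zero_edge (X := 𝟙_ SSet) (SSet.yonedaEquiv ((λ_ _).inv ≫ p.h))
    rw [Equiv.symm_apply_apply] at e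
    exact (e.symm.trans ((congrArg (· ≫ p.h) const_leftUnitor_inv).trans p.h₀)).trans
      ((toUnit_unit_comp _).symm.trans (toUnit_comp_eq_const _))
  tgt_eq := by
    apply const_unit_injective
    have e := const_one_edge (X := 𝟙_ SSet) (SSet.yonedaEquiv ((λ_ _).inv ≫ p.h))
    rw [Equiv.symm_apply_apply] at e
    exact (e.symm.trans ((congrArg (· ≫ p.h) const_leftUnitor_inv').trans p.h₁)).trans
      ((toUnit_unit_comp _).symm.trans (toUnit_comp_eq_const _))

/-- The class of a homotopy. -/
def ofHtpy (η : Htpy f g) : f ⇛ g := (pathOfHtpy η).cls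

lemma ofHtpy_surjective (α : f ⇛ g) : ∃ η : Htpy f g, ofHtpy η = α := by
  obtain ⟨p, rfl⟩ := exists_path α
  refine ⟨htpyOfPath p, congrArg Path.cls (Path.ext ?_)⟩
  change CartesianMonoidalCategory.snd _ _ ≫ SSet.yonedaEquiv.symm (SSet.yonedaEquiv _) = _
  rw [Equiv.symm_apply_apply]
  exact (Category.assoc _ _ _).symm.trans
    ((congrArg (· ≫ p.h) (λ_ Δ[1]).hom_inv_id).trans (Category.id_comp _))

/-- The homotopy `postHtpy`, as a path. -/
def postPath (T : C) (η : Htpy f g) :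
    Path (eHomWhiskerLeft SSet T f) (eHomWhiskerLeft SSet T g) :=
  ⟨postHtpy T η, ι₀_postHtpy T η, ι₁_postHtpy T η⟩

/-- This turns the path that occurs in `pullbackComparison` into a whiskered 2-cell. -/
lemma postPath_pre (u : W ⟶ X) (η : Htpy f g) {f' g' : W ⟶ Y} (hf : u ≫ f = f')
    (hg : u ≫ g = g') :
    ((postPath W η).pre (eHomEquiv SSet u) (by rw [eHomEquiv_whiskerLeft, hf])
      (by rw [eHomEquiv_whiskerLeft, hg])).cls = pre u (ofHtpy η) hf hg := by
  refine congrArg Path.cls (Path.ext ?_)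
  have h : eHomEquiv SSet u ▷ Δ[1] ≫ sHom W X ◁ SSet.yonedaEquiv.symm η.edge =
      CartesianMonoidalCategory.snd _ _ ≫ SSet.yonedaEquiv.symm η.edge ≫ (λ_ _).inv ≫
        eHomEquiv SSet u ▷ _ := by
    apply CartesianMonoidalCategory.hom_ext
    · exact congrArg (· ≫ eHomEquiv SSet u) (CartesianMonoidalCategory.toUnit_unique
        (CartesianMonoidalCategory.fst (𝟙_ SSet) Δ[1])
        (CartesianMonoidalCategory.snd _ _ ≫ SSet.yonedaEquiv.symm η.edge ≫
          SemiCartesianMonoidalCategory.toUnit _))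
    · rfl
  exact congrArg (· ≫ sHomComp W X Y) h

lemma homotopic_iff : Homotopic f g ↔ Nonempty (f ⇛ g) :=
  ⟨fun ⟨η⟩ => ⟨ofHtpy η⟩, fun ⟨α⟩ => ⟨(ofHtpy_surjective α).choose⟩⟩

/-- A representative of `β` gives a homotopy between maps `Map(X, Y) ⟶ Map(X, Z)`; this is its
naturality on the path `α`. -/
lemma interchange {k l : Y ⟶ Z} (α : f ⇛ g) (β : k ⇛ l) {fk fl gk gl : X ⟶ Z}
    (h₁ : f ≫ k = fk) (h₂ : f ≫ l = fl) (h₃ : g ≫ k = gk) (h₄ : g ≫ l = gl) :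
    post α k h₁ h₃ ≫ pre g β h₃ h₄ = pre f β h₁ h₂ ≫ post α l h₂ h₄ := by
  obtain ⟨η, rfl⟩ := ofHtpy_surjective β
  rw [← postPath_pre, ← postPath_pre]
  exact naturality _ _ _ _ _ _

lemma interchange_assoc {k l : Y ⟶ Z} (α : f ⇛ g) (β : k ⇛ l) {fk fl gk gl e : X ⟶ Z}
    (h₁ : f ≫ k = fk) (h₂ : f ≫ l = fl) (h₃ : g ≫ k = gk) (h₄ : g ≫ l = gl) (γ : gl ⇛ e) :
    post α k h₁ h₃ ≫ pre g β h₃ h₄ ≫ γ = pre f β h₁ h₂ ≫ post α l h₂ h₄ ≫ γ :=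
  (Category.assoc _ _ _).symm.trans
    ((congrArg (· ≫ γ) (interchange α β h₁ h₂ h₃ h₄)).trans (Category.assoc _ _ _))

end Cell

end TwoCells

/-! ### Homotopy limits and their weak universal properties. -/

section HomotopyLimits

open MapGroupoid SimplicialCategory

lemma IsContractible.nonempty_path {K : SSet.{v}} [SSet.KanComplex K] (hK : IsContractible K)
    {A : SSet.{v}} (a b : A ⟶ K) : Nonempty (mk a ⟶ mk b) :=
  hK.reflects (Path.ofEq (CartesianMonoidalCategory.toUnit_unique _ _))

lemma IsContractible.path_unique {K : SSet.{v}} [SSet.KanComplex K] (hK : IsContractible K)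
    {A : SSet.{v}} {a b : A ⟶ K} (p q : mk a ⟶ mk b) : p = q := by
  obtain ⟨g, ⟨H⟩, -⟩ := isHomotopyEquivalence_iff_path.1 hK
  rw [IsHomotopyEquivalence.eq_of_path_id H p, IsHomotopyEquivalence.eq_of_path_id H q]
  congr 2
  obtain ⟨p, rfl⟩ := Path.cls_surjective p
  obtain ⟨q, rfl⟩ := Path.cls_surjective q
  refine congrArg Path.cls (Path.ext ?_)
  exact (Category.assoc _ _ _).symm.trans ((congrArg (· ≫ g)
    (CartesianMonoidalCategory.toUnit_unique _ _)).trans (Category.assoc _ _ _))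

variable {C : Type u} [Category.{v} C] [SimplicialCategory C] {T W X Y Z P A B M : C}

lemma IsEquivalence.isHomotopyEquivalence {e : X ⟶ Y} (h : IsEquivalence e) (T : C) :
    IsHomotopyEquivalence (eHomWhiskerLeft SSet T e) := by
  obtain ⟨g, ⟨η⟩, ⟨θ⟩⟩ := h
  refine isHomotopyEquivalence_iff_path.2 ⟨eHomWhiskerLeft SSet T g,
    ⟨⟨postHtpy T η, ?_, ?_⟩⟩, ⟨⟨postHtpy T θ, ?_, ?_⟩⟩⟩
  · rw [ι₀_postHtpy, eHomWhiskerLeft_comp]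
  · rw [ι₁_postHtpy, eHomWhiskerLeft_id]
  · rw [ι₀_postHtpy, eHomWhiskerLeft_comp]
  · rw [ι₁_postHtpy, eHomWhiskerLeft_id]

lemma Equivalent.symm (h : Equivalent X Y) : Equivalent Y X := by
  obtain ⟨f, g, h₁, h₂⟩ := h
  exact ⟨g, f, h₂, h₁⟩

lemma pullbackComparison_fst (T : C) {p : P ⟶ A} {q : P ⟶ B} {f : A ⟶ M} {g : B ⟶ M}
    (η : Htpy (p ≫ f) (q ≫ g)) (x : T ⟶ P) :
    (eHomEquiv SSet x ≫ pullbackComparison T η) ≫ hPullbackFst _ _ = eHomEquiv SSet (x ≫ p) := by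
  rw [Category.assoc, pullbackComparison, hPullbackLift_fst, eHomEquiv_whiskerLeft]

lemma pullbackComparison_snd (T : C) {p : P ⟶ A} {q : P ⟶ B} {f : A ⟶ M} {g : B ⟶ M}
    (η : Htpy (p ≫ f) (q ≫ g)) (x : T ⟶ P) :
    (eHomEquiv SSet x ≫ pullbackComparison T η) ≫ hPullbackSnd _ _ = eHomEquiv SSet (x ≫ q) := by
  rw [Category.assoc, pullbackComparison, hPullbackLift_snd, eHomEquiv_whiskerLeft]

lemma pullbackComparison_path (T : C) {p : P ⟶ A} {q : P ⟶ B} {f : A ⟶ M} {g : B ⟶ M}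
    (η : Htpy (p ≫ f) (q ≫ g)) (x : T ⟶ P) :
    (hPullbackPath (eHomEquiv SSet x ≫ pullbackComparison T η)).h =
      ((Cell.postPath T η).pre (eHomEquiv SSet x) (eHomEquiv_whiskerLeft _ _)
        (eHomEquiv_whiskerLeft _ _)).h :=
  (hPullbackPath_comp _ _).trans
    (congrArg (eHomEquiv SSet x ▷ _ ≫ ·) (hPullbackLift_path _ _ _))

variable [∀ X Y : C, SSet.KanComplex (sHom X Y)]

namespace Homotopic

lemma refl (f : X ⟶ Y) : Homotopic f f := Cell.homotopic_iff.2 ⟨𝟙 _⟩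

lemma of_eq {f g : X ⟶ Y} (h : f = g) : Homotopic f g := h ▸ refl f

lemma symm {f g : X ⟶ Y} (h : Homotopic f g) : Homotopic g f :=
  Cell.homotopic_iff.2 ((Cell.homotopic_iff.1 h).map fun α => inv α)

lemma trans {f g h : X ⟶ Y} (h₁ : Homotopic f g) (h₂ : Homotopic g h) : Homotopic f h := by
  obtain ⟨α⟩ := Cell.homotopic_iff.1 h₁
  obtain ⟨β⟩ := Cell.homotopic_iff.1 h₂
  exact Cell.homotopic_iff.2 ⟨α ≫ β⟩

lemma post {f g : X ⟶ Y} (h : Homotopic f g) (k : Y ⟶ Z) : Homotopic (f ≫ k) (g ≫ k) :=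
  Cell.homotopic_iff.2 ((Cell.homotopic_iff.1 h).map fun α => α.post k rfl rfl)

lemma pre {f g : X ⟶ Y} (h : Homotopic f g) (u : W ⟶ X) : Homotopic (u ≫ f) (u ≫ g) :=
  Cell.homotopic_iff.2 ((Cell.homotopic_iff.1 h).map fun α => α.pre u rfl rfl)

end Homotopic

namespace IsEquivalence

lemma id (X : C) : IsEquivalence (𝟙 X) :=
  ⟨𝟙 X, .of_eq (Category.id_comp _), .of_eq (Category.id_comp _)⟩

lemma comp {e : X ⟶ Y} {e' : Y ⟶ Z} (h : IsEquivalence e) (h' : IsEquivalence e') :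
    IsEquivalence (e ≫ e') := by
  obtain ⟨g, h₁, h₂⟩ := h
  obtain ⟨g', h₁', h₂'⟩ := h'
  refine ⟨g' ≫ g, ?_, ?_⟩
  · have := ((h₁'.post g).pre e)
    simp only [Category.assoc, Category.id_comp] at this ⊢
    exact this.trans h₁
  · have := ((h₂.post e').pre g')
    simp only [Category.assoc, Category.id_comp] at this ⊢
    exact this.trans h₂'

lemma exists_cell {e : X ⟶ Y} (h : IsEquivalence e) {x x' : T ⟶ X} {y y' : T ⟶ Y}
    (hx : x ≫ e = y) (hx' : x' ≫ e = y') (α : y ⇛ y') : ∃ β : x ⇛ x', β.post e hx hx' = α :=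
  (h.isHomotopyEquivalence T).full _ _ α

end IsEquivalence

lemma Equivalent.trans (h : Equivalent X Y) (h' : Equivalent Y Z) : Equivalent X Z := by
  obtain ⟨f, hf⟩ := h
  obtain ⟨g, hg⟩ := h'
  exact ⟨f ≫ g, hf.comp hg⟩

/-- The universal property of homotopy pullback squares, on the level of homotopy classes of
homotopies. -/
structure IsWeakPullback {p : P ⟶ A} {q : P ⟶ B} {f : A ⟶ M} {g : B ⟶ M}
    (η : p ≫ f ⇛ q ≫ g) : Prop where
  exists_lift : ∀ {T : C} (a : T ⟶ A) (b : T ⟶ B) (γ : a ≫ f ⇛ b ≫ g),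
    ∃ (x : T ⟶ P) (α : x ≫ p ⇛ a) (β : x ≫ q ⇛ b),
      α.post f (Category.assoc _ _ _) rfl ≫ γ =
        η.pre x rfl rfl ≫ β.post g (Category.assoc _ _ _) rfl
  unique : ∀ {T : C} (x x' : T ⟶ P) (α : x ≫ p ⇛ x' ≫ p) (β : x ≫ q ⇛ x' ≫ q),
    α.post f (Category.assoc _ _ _) (Category.assoc _ _ _) ≫ η.pre x' rfl rfl =
      η.pre x rfl rfl ≫ β.post g (Category.assoc _ _ _) (Category.assoc _ _ _) →
    Homotopic x x'

/-- On vertices, the comparison map is surjective up to paths and reflects them;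
`hPullback_path_iff` reads these two facts as equations of 2-cells. -/
lemma IsHomotopyPullback.exists_isWeakPullback {p : P ⟶ A} {q : P ⟶ B} {f : A ⟶ M} {g : B ⟶ M}
    (h : IsHomotopyPullback p q f g) : ∃ η : p ≫ f ⇛ q ≫ g, IsWeakPullback η := by
  obtain ⟨η, h⟩ := h
  refine ⟨Cell.ofHtpy η, ?_, ?_⟩
  · intro T a b γ
    obtain ⟨γ, rfl⟩ := Cell.exists_path γ
    obtain ⟨x, hx⟩ := (h T).exists_preimage (hPullbackLift (eHomEquiv SSet a) (eHomEquiv SSet b) γ.h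
      (by rw [γ.h₀, eHomEquiv_whiskerLeft]) (by rw [γ.h₁, eHomEquiv_whiskerLeft]))
    obtain ⟨x, rfl⟩ := (eHomEquiv SSet).surjective x
    obtain ⟨α, β, e⟩ := (hPullback_path_iff (pullbackComparison_fst T η x)
      (pullbackComparison_snd T η x) (hPullbackLift_fst _ _ _) (hPullbackLift_snd _ _ _)
      ((eHomEquiv_whiskerLeft _ _).trans (congrArg _ (Category.assoc _ _ _)))
      (eHomEquiv_whiskerLeft _ _)
      ((eHomEquiv_whiskerLeft _ _).trans (congrArg _ (Category.assoc _ _ _)))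
      (eHomEquiv_whiskerLeft _ _)
      (pullbackComparison_path T η x) (hPullbackLift_path _ _ _)).1 hx
    rw [Cell.postPath_pre _ _ rfl rfl] at e
    exact ⟨x, α.cls, β.cls, e⟩
  · intro T x x' α β e
    obtain ⟨α, rfl⟩ := Cell.exists_path α
    obtain ⟨β, rfl⟩ := Cell.exists_path β
    rw [← Cell.postPath_pre, ← Cell.postPath_pre] at e
    obtain ⟨r⟩ := (hPullback_path_iff (pullbackComparison_fst T η x)
      (pullbackComparison_snd T η x) (pullbackComparison_fst T η x')
      (pullbackComparison_snd T η x')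
      ((eHomEquiv_whiskerLeft _ _).trans (congrArg _ (Category.assoc _ _ _)))
      ((eHomEquiv_whiskerLeft _ _).trans (congrArg _ (Category.assoc _ _ _)))
      ((eHomEquiv_whiskerLeft _ _).trans (congrArg _ (Category.assoc _ _ _)))
      ((eHomEquiv_whiskerLeft _ _).trans (congrArg _ (Category.assoc _ _ _)))
      (pullbackComparison_path T η x) (pullbackComparison_path T η x')).2 ⟨α, β, e⟩
    exact Cell.homotopic_iff.2 ((h T).reflects r)

/-- Only surjectivity up to homotopy is retained, which is enough to glue functions to the line. -/
lemma IsHomotopyPushout.exists_desc {i : W ⟶ X} {j : W ⟶ Y} {k : X ⟶ P} {l : Y ⟶ P}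
    {η : Htpy (i ≫ k) (j ≫ l)} (h : IsHomotopyPushout η) {a : X ⟶ T} {b : Y ⟶ T}
    (γ : Homotopic (i ≫ a) (j ≫ b)) :
    ∃ x : P ⟶ T, Homotopic (k ≫ x) a ∧ Homotopic (l ≫ x) b := by
  obtain ⟨γ⟩ := Cell.homotopic_iff.1 γ
  obtain ⟨γ, -⟩ := Cell.exists_path γ
  obtain ⟨x, ⟨r⟩⟩ := (h T).exists_preimage (hPullbackLift (eHomEquiv SSet a) (eHomEquiv SSet b) γ.h
      (by rw [γ.h₀, eHomEquiv_whiskerRight]) (by rw [γ.h₁, eHomEquiv_whiskerRight]))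
  obtain ⟨x, rfl⟩ := (eHomEquiv SSet).surjective x
  refine ⟨x, Cell.homotopic_iff.2 ⟨(r.map (hPullbackFst _ _) ?_ ?_).cls⟩,
    Cell.homotopic_iff.2 ⟨(r.map (hPullbackSnd _ _) ?_ ?_).cls⟩⟩
  · rw [Category.assoc, pushoutComparison, hPullbackLift_fst, eHomEquiv_whiskerRight]
  · rw [hPullbackLift_fst]
  · rw [Category.assoc, pushoutComparison, hPullbackLift_snd, eHomEquiv_whiskerRight]
  · rw [hPullbackLift_snd]

/-- The universal property of homotopy products, on the level of homotopy classes of homotopies. -/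
structure IsWeakProduct (a : P ⟶ A) (b : P ⟶ B) : Prop where
  exists_lift : ∀ {T : C} (x : T ⟶ A) (y : T ⟶ B),
    ∃ z : T ⟶ P, Homotopic (z ≫ a) x ∧ Homotopic (z ≫ b) y
  exists_cell : ∀ {T : C} {z z' : T ⟶ P} (α : z ≫ a ⇛ z' ≫ a) (β : z ≫ b ⇛ z' ≫ b),
    ∃ σ : z ⇛ z', σ.post a rfl rfl = α ∧ σ.post b rfl rfl = β

lemma IsHomotopyProduct.isWeakProduct {a : P ⟶ A} {b : P ⟶ B} (h : IsHomotopyProduct a b) :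
    IsWeakProduct a b where
  exists_lift {T} x y := by
    obtain ⟨z, ⟨r⟩⟩ := (h T).exists_preimage
      (CartesianMonoidalCategory.lift (eHomEquiv SSet x) (eHomEquiv SSet y))
    obtain ⟨z, rfl⟩ := (eHomEquiv SSet).surjective z
    refine ⟨z, Cell.homotopic_iff.2 ⟨(r.map (CartesianMonoidalCategory.fst _ _) ?_ ?_).cls⟩,
      Cell.homotopic_iff.2 ⟨(r.map (CartesianMonoidalCategory.snd _ _) ?_ ?_).cls⟩⟩
    · rw [Category.assoc, CartesianMonoidalCategory.lift_fst, eHomEquiv_whiskerLeft]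
    · rw [CartesianMonoidalCategory.lift_fst]
    · rw [Category.assoc, CartesianMonoidalCategory.lift_snd, eHomEquiv_whiskerLeft]
    · rw [CartesianMonoidalCategory.lift_snd]
  exists_cell {T z z'} α β := by
    obtain ⟨α, rfl⟩ := Cell.exists_path α
    obtain ⟨β, rfl⟩ := Cell.exists_path β
    have := kanComplex_tensor (sHom T A) (sHom T B)
    have e (z : T ⟶ P) : eHomEquiv SSet z ≫ CartesianMonoidalCategory.lift
        (eHomWhiskerLeft SSet T a) (eHomWhiskerLeft SSet T b) =
        CartesianMonoidalCategory.lift (eHomEquiv SSet (z ≫ a)) (eHomEquiv SSet (z ≫ b)) := by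
      rw [CartesianMonoidalCategory.comp_lift, eHomEquiv_whiskerLeft, eHomEquiv_whiskerLeft]
    let r : Path
        (CartesianMonoidalCategory.lift (eHomEquiv SSet (z ≫ a)) (eHomEquiv SSet (z ≫ b)))
        (CartesianMonoidalCategory.lift (eHomEquiv SSet (z' ≫ a)) (eHomEquiv SSet (z' ≫ b))) :=
      ⟨CartesianMonoidalCategory.lift α.h β.h,
        by rw [CartesianMonoidalCategory.comp_lift, α.h₀, β.h₀],
        by rw [CartesianMonoidalCategory.comp_lift, α.h₁, β.h₁]⟩
    obtain ⟨σ, hσ⟩ := (h T).full (e z) (e z') r.cls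
    refine ⟨σ, ?_, ?_⟩
    · have := congrArg (fun t => push t (CartesianMonoidalCategory.fst _ _)
        (CartesianMonoidalCategory.lift_fst _ _) (CartesianMonoidalCategory.lift_fst _ _)) hσ
      refine ((push_push _ _ _ _ _ _ _ (CartesianMonoidalCategory.lift_fst _ _)).symm.trans
        this).trans ?_
      exact congrArg Path.cls (Path.ext (CartesianMonoidalCategory.lift_fst _ _))
    · have := congrArg (fun t => push t (CartesianMonoidalCategory.snd _ _)
        (CartesianMonoidalCategory.lift_snd _ _) (CartesianMonoidalCategory.lift_snd _ _)) hσ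
      refine ((push_push _ _ _ _ _ _ _ (CartesianMonoidalCategory.lift_snd _ _)).symm.trans
        this).trans ?_
      exact congrArg Path.cls (Path.ext (CartesianMonoidalCategory.lift_snd _ _))

namespace IsWeakProduct

variable {a : P ⟶ A} {b : P ⟶ B}

lemma homotopic (h : IsWeakProduct a b) {z z' : T ⟶ P} (ha : Homotopic (z ≫ a) (z' ≫ a))
    (hb : Homotopic (z ≫ b) (z' ≫ b)) : Homotopic z z' := by
  obtain ⟨α⟩ := Cell.homotopic_iff.1 ha
  obtain ⟨β⟩ := Cell.homotopic_iff.1 hb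
  obtain ⟨σ, -⟩ := h.exists_cell α β
  exact Cell.homotopic_iff.2 ⟨σ⟩

lemma exists_isEquivalence (h : IsWeakProduct a b) {a' : Z ⟶ A} {b' : Z ⟶ B}
    (h' : IsWeakProduct a' b') :
    ∃ e : P ⟶ Z, IsEquivalence e ∧ Homotopic (e ≫ a') a ∧ Homotopic (e ≫ b') b := by
  obtain ⟨e, h₁, h₂⟩ := h'.exists_lift a b
  obtain ⟨g, h₁', h₂'⟩ := h.exists_lift a' b'
  refine ⟨e, ⟨g, h.homotopic ?_ ?_, h'.homotopic ?_ ?_⟩, h₁, h₂⟩ <;>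
    rw [Category.assoc, Category.id_comp]
  · exact (h₁'.pre e).trans h₁
  · exact (h₂'.pre e).trans h₂
  · exact (h₁.pre g).trans h₁'
  · exact (h₂.pre g).trans h₂'

lemma comp_left (h : IsWeakProduct a b) {e : A ⟶ X} (he : IsEquivalence e) :
    IsWeakProduct (a ≫ e) b where
  exists_lift {T} x y := by
    obtain ⟨g, hg, hg'⟩ := id he
    obtain ⟨z, h₁, h₂⟩ := h.exists_lift (x ≫ g) y
    refine ⟨z, ?_, h₂⟩
    have := (h₁.post e).trans (.of_eq (Category.assoc _ _ _))
    rw [Category.assoc] at this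
    exact this.trans ((hg'.pre x).trans (.of_eq (Category.comp_id _)))
  exists_cell {T z z'} α β := by
    obtain ⟨α', rfl⟩ := he.exists_cell (Category.assoc _ _ _) (Category.assoc _ _ _) α
    obtain ⟨σ, rfl, rfl⟩ := h.exists_cell α' β
    exact ⟨σ, (Cell.post_post σ a e rfl rfl rfl _ _).symm, rfl⟩

end IsWeakProduct

/-- Mapping spaces into `M` are contractible, so the path needed for a point of the homotopy
pullback exists, and the square condition on a pair of paths is automatic. -/
lemma IsHomotopyPullback.isHomotopyProduct {p : P ⟶ A} {q : P ⟶ B} {f : A ⟶ M} {g : B ⟶ M}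
    (h : IsHomotopyPullback p q f g) (hM : IsHomotopyTerminal M) : IsHomotopyProduct p q := by
  obtain ⟨η, h⟩ := h
  intro T
  have hf {S : SSet.{v}} (x : S ⟶ sHom T P) :
      (x ≫ pullbackComparison T η) ≫ hPullbackFst _ _ = x ≫ eHomWhiskerLeft SSet T p := by
    rw [Category.assoc, pullbackComparison, hPullbackLift_fst]
  have hs {S : SSet.{v}} (x : S ⟶ sHom T P) :
      (x ≫ pullbackComparison T η) ≫ hPullbackSnd _ _ = x ≫ eHomWhiskerLeft SSet T q := by
    rw [Category.assoc, pullbackComparison, hPullbackLift_snd]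
  apply IsHomotopyEquivalence.of_bijective
  · intro S y
    obtain ⟨γ⟩ := (hM T).nonempty_path
      ((y ≫ CartesianMonoidalCategory.fst _ _) ≫ eHomWhiskerLeft SSet T f)
      ((y ≫ CartesianMonoidalCategory.snd _ _) ≫ eHomWhiskerLeft SSet T g)
    obtain ⟨γ, -⟩ := Path.cls_surjective γ
    obtain ⟨x, ⟨r⟩⟩ := (h T).exists_preimage (hPullbackLift _ _ γ.h γ.h₀ γ.h₁)
    have r₁ := r.map (hPullbackFst _ _) (hf x) (hPullbackLift_fst _ _ _)
    have r₂ := r.map (hPullbackSnd _ _) (hs x) (hPullbackLift_snd _ _ _)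
    refine ⟨x, ⟨⟨CartesianMonoidalCategory.lift r₁.h r₂.h, ?_, ?_⟩⟩⟩
    · rw [CartesianMonoidalCategory.comp_lift, CartesianMonoidalCategory.comp_lift, r₁.h₀, r₂.h₀]
    · rw [CartesianMonoidalCategory.comp_lift, r₁.h₁, r₂.h₁,
        ← CartesianMonoidalCategory.comp_lift, CartesianMonoidalCategory.lift_fst_snd,
        Category.comp_id]
  · rintro S x x' ⟨r⟩
    have r₁ := r.map (CartesianMonoidalCategory.fst _ _)
      (a' := x ≫ eHomWhiskerLeft SSet T p) (b' := x' ≫ eHomWhiskerLeft SSet T p)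
      (by rw [Category.assoc, CartesianMonoidalCategory.lift_fst])
      (by rw [Category.assoc, CartesianMonoidalCategory.lift_fst])
    have r₂ := r.map (CartesianMonoidalCategory.snd _ _)
      (a' := x ≫ eHomWhiskerLeft SSet T q) (b' := x' ≫ eHomWhiskerLeft SSet T q)
      (by rw [Category.assoc, CartesianMonoidalCategory.lift_snd])
      (by rw [Category.assoc, CartesianMonoidalCategory.lift_snd])
    have e := (hPullback_path_iff (hf x) (hs x) (hf x') (hs x') rfl rfl rfl rfl
      (p := ⟨(hPullbackPath (x ≫ pullbackComparison T η)).h,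
        (hPullbackPath _).h₀.trans (congrArg (· ≫ _) (hf x)),
        (hPullbackPath _).h₁.trans (congrArg (· ≫ _) (hs x))⟩)
      (p' := ⟨(hPullbackPath (x' ≫ pullbackComparison T η)).h,
        (hPullbackPath _).h₀.trans (congrArg (· ≫ _) (hf x')),
        (hPullbackPath _).h₁.trans (congrArg (· ≫ _) (hs x'))⟩) rfl rfl).2
      ⟨r₁, r₂, (hM T).path_unique _ _⟩
    obtain ⟨e⟩ := e
    obtain ⟨e⟩ := (h T).reflects e
    exact ⟨(Path.cls_surjective e).choose⟩

end HomotopyLimits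

/-! ### Calculus of weak pullbacks. -/

section WeakPullbacks

open SimplicialCategory

variable {C : Type u} [Category.{v} C] [SimplicialCategory C]
  {T W X Y Z P P' A B M : C}

namespace IsHomotopyTerminal

lemma nonempty_hom (hM : IsHomotopyTerminal M) (T : C) : Nonempty (T ⟶ M) := by
  obtain ⟨g, -⟩ := hM T
  exact ⟨(eHomEquiv SSet).symm g⟩

variable [∀ X Y : C, SSet.KanComplex (sHom X Y)]

lemma nonempty_cell (hM : IsHomotopyTerminal M) (f g : T ⟶ M) : Nonempty (f ⇛ g) :=
  (hM T).nonempty_path _ _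

end IsHomotopyTerminal

variable [∀ X Y : C, SSet.KanComplex (sHom X Y)]

lemma IsWeakProduct.exists_cell' {a : P ⟶ A} {b : P ⟶ B} (h : IsWeakProduct a b) {z z' : T ⟶ P}
    {za za' : T ⟶ A} {zb zb' : T ⟶ B} (e₁ : z ≫ a = za) (e₁' : z' ≫ a = za') (e₂ : z ≫ b = zb)
    (e₂' : z' ≫ b = zb') (α : za ⇛ za') (β : zb ⇛ zb') :
    ∃ σ : z ⇛ z', σ.post a e₁ e₁' = α ∧ σ.post b e₂ e₂' = β := by
  subst e₁ e₁' e₂ e₂'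
  exact h.exists_cell α β

namespace IsWeakPullback

variable {p : P ⟶ A} {q : P ⟶ B} {f : A ⟶ M} {g : B ⟶ M} {η : p ≫ f ⇛ q ≫ g}

lemma exists_lift' (h : IsWeakPullback η) (a : T ⟶ A) (b : T ⟶ B) {af bg : T ⟶ M}
    (haf : a ≫ f = af) (hbg : b ≫ g = bg) (γ : af ⇛ bg) :
    ∃ (x : T ⟶ P) (α : x ≫ p ⇛ a) (β : x ≫ q ⇛ b),
      α.post f (Category.assoc _ _ _) haf ≫ γ =
        η.pre x rfl rfl ≫ β.post g (Category.assoc _ _ _) hbg := by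
  subst haf hbg
  exact h.exists_lift a b γ

lemma unique' (h : IsWeakPullback η) (x x' : T ⟶ P) {xp xp' : T ⟶ A} {xq xq' : T ⟶ B}
    {xpf xpf' xqg xqg' : T ⟶ M} (h₁ : x ≫ p = xp) (h₁' : x' ≫ p = xp') (h₂ : x ≫ q = xq)
    (h₂' : x' ≫ q = xq') (h₃ : xp ≫ f = xpf) (h₃' : xp' ≫ f = xpf') (h₄ : xq ≫ g = xqg)
    (h₄' : xq' ≫ g = xqg') (h₅ : x ≫ p ≫ f = xpf) (h₅' : x' ≫ p ≫ f = xpf')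
    (h₆ : x ≫ q ≫ g = xqg) (h₆' : x' ≫ q ≫ g = xqg') (α : xp ⇛ xp') (β : xq ⇛ xq')
    (e : α.post f h₃ h₃' ≫ η.pre x' h₅' h₆' = η.pre x h₅ h₆ ≫ β.post g h₄ h₄') :
    Homotopic x x' := by
  subst h₁ h₁' h₂ h₂' h₅ h₅' h₆ h₆'
  exact h.unique x x' α β e

lemma equivalent (h : IsWeakPullback η) {p' : P' ⟶ A} {q' : P' ⟶ B} {η' : p' ≫ f ⇛ q' ≫ g}
    (h' : IsWeakPullback η') : Equivalent P P' := by
  have key {P P' : C} {p : P ⟶ A} {q : P ⟶ B} {η : p ≫ f ⇛ q ≫ g} (h : IsWeakPullback η)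
      {p' : P' ⟶ A} {q' : P' ⟶ B} {η' : p' ≫ f ⇛ q' ≫ g} {x : P ⟶ P'} {y : P' ⟶ P}
      (α : x ≫ p' ⇛ p) (β : x ≫ q' ⇛ q) (e : α.post f (Category.assoc _ _ _) rfl ≫ η =
        η'.pre x rfl rfl ≫ β.post g (Category.assoc _ _ _) rfl)
      (α' : y ≫ p ⇛ p') (β' : y ≫ q ⇛ q') (e' : α'.post f (Category.assoc _ _ _) rfl ≫ η' =
        η.pre y rfl rfl ≫ β'.post g (Category.assoc _ _ _) rfl) :
      Homotopic (x ≫ y) (𝟙 P) := by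
    refine h.unique' (x ≫ y) (𝟙 P) (xpf := x ≫ y ≫ p ≫ f) (xpf' := p ≫ f)
      (xqg := x ≫ y ≫ q ≫ g) (xqg' := q ≫ g) (Category.assoc _ _ _) (Category.id_comp _)
      (Category.assoc _ _ _) (Category.id_comp _) (by simp) rfl (by simp) rfl (by simp) (by simp)
      (by simp) (by simp) (α'.pre x rfl rfl ≫ α) (β'.pre x rfl rfl ≫ β) ?_
    rw [Cell.pre_one, Cell.post_comp (hg := Category.assoc _ _ _),
      Cell.post_comp (hg := Category.assoc _ _ _),
      Cell.post_pre x α' f rfl rfl (Category.assoc _ _ _) rfl _ _ rfl rfl,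
      Cell.post_pre x β' g rfl rfl (Category.assoc _ _ _) rfl _ _ rfl rfl,
      ← Cell.pre_pre x y η rfl rfl rfl rfl rfl]
    refine (Category.assoc _ _ _).trans ((congrArg _ e).trans ?_)
    rw [← Cell.pre_comp_assoc, ← Cell.pre_comp_assoc, e']
  obtain ⟨x, α, β, e⟩ := h'.exists_lift p q η
  obtain ⟨y, α', β', e'⟩ := h.exists_lift p' q' η'
  exact ⟨x, y, key h α β e α' β' e', key h' α' β' e' α β e⟩

/-- Interchange moves `θ` past `α`. The lemma is needed because collars match the maps to the line
only up to homotopy. -/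
lemma of_cell (h : IsWeakPullback η) {f' : A ⟶ M} (θ : f' ⇛ f) :
    IsWeakPullback (θ.pre p rfl rfl ≫ η) where
  exists_lift a b γ := by
    obtain ⟨x, α, β, e⟩ := h.exists_lift a b (inv (θ.pre a rfl rfl) ≫ γ)
    refine ⟨x, α, β, ?_⟩
    rw [Cell.pre_comp (hg := rfl), Cell.pre_pre x p θ rfl]
    refine Eq.trans ?_ (Category.assoc _ _ _).symm
    rw [← e, ← Cell.interchange_assoc α θ _ _ rfl rfl, IsIso.hom_inv_id_assoc]
  unique x x' α β e := by
    refine h.unique x x' α β ?_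
    rw [Cell.pre_comp (hg := rfl), Cell.pre_comp (hg := rfl), Cell.pre_pre x' p θ rfl,
      Cell.pre_pre x p θ rfl] at e
    have e' := e.trans (Category.assoc _ _ _)
    rw [Cell.interchange_assoc α θ _ (Category.assoc _ _ _) _ (Category.assoc _ _ _)] at e'
    exact (cancel_epi _).1 e'

end IsWeakPullback

/-- The fibre of `A × B ⟶ B` over a point `g` is the slice `s`. A map `φ` into the product lying
over the point is recovered from `φ ≫ a`, since 2-cells into a product can be prescribed by their
components. -/
lemma IsWeakProduct.isWeakPullback {a : P ⟶ A} {b : P ⟶ B} (h : IsWeakProduct a b)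
    (hM : IsHomotopyTerminal M) (o : A ⟶ M) (g : M ⟶ B) {s : A ⟶ P} (hs : s ≫ a ⇛ 𝟙 A)
    (η : s ≫ b ⇛ o ≫ g) : IsWeakPullback η where
  exists_lift {T} φ o' γ := by
    obtain ⟨β⟩ := hM.nonempty_cell ((φ ≫ a) ≫ o) o'
    obtain ⟨α, -, hα⟩ := h.exists_cell' (z := (φ ≫ a) ≫ s) (z' := φ) (Category.assoc _ _ _) rfl
      (Category.assoc _ _ _) rfl (hs.pre (φ ≫ a) rfl (Category.comp_id _))
      (η.pre (φ ≫ a) rfl rfl ≫ β.post g (Category.assoc _ _ _) rfl ≫ inv γ)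
    exact ⟨φ ≫ a, α, β, by rw [hα]; simp⟩
  unique {T} x x' α β _ := by
    have e (x : T ⟶ A) : Homotopic x ((x ≫ s) ≫ a) :=
      Cell.homotopic_iff.2 ⟨inv (hs.pre x (Category.assoc _ _ _).symm (Category.comp_id _))⟩
    exact (e x).trans ((Homotopic.post (Cell.homotopic_iff.2 ⟨α⟩) a).trans (e x').symm)

end WeakPullbacks

/-! ### Underlying spaces and open subobjects. -/

namespace GeometricStructure

open SimplicialCategory

variable {C : Type u} [Category.{v} C] [SimplicialCategory C] (D : GeometricStructure C)
  {T V W X Y Z P Q : C} {M N : Man}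

lemma onSpace_id (X : C) : D.onSpace (𝟙 X) = 𝟙 _ := by simp [onSpace]

lemma onSpace_comp (f : X ⟶ Y) (g : Y ⟶ Z) : D.onSpace (f ≫ g) = D.onSpace f ≫ D.onSpace g := by
  simp [onSpace]

lemma onSpace_comp_apply (f : X ⟶ Y) (g : Y ⟶ Z) (x : D.space X) :
    D.onSpace (f ≫ g) x = D.onSpace g (D.onSpace f x) := by
  rw [onSpace_comp]; rfl

lemma onSpace_eq {f g : X ⟶ Y} (h : Homotopic f g) : D.onSpace f = D.onSpace g :=
  congrArg (fun t => t.hom) (D.map_eq_of_homotopic h)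

lemma toMan_comp (k : X ⟶ Y) (f : Y ⟶ D.i.obj M) (x : D.space X) :
    D.toMan (k ≫ f) x = D.toMan f (D.onSpace k x) := by
  simp only [toMan, onSpace_comp]; rfl

lemma toMan_map (f : X ⟶ D.i.obj M) (g : M ⟶ N) (x : D.space X) :
    D.toMan (f ≫ D.i.map g) x = Man.toMap g (D.toMan f x) := by
  have e := congrArg (fun t => t.hom) (D.iU.hom.naturality g)
  rw [toMan_comp]
  exact ConcreteCategory.congr_hom e (D.onSpace f x)

lemma toMan_eq {f g : X ⟶ D.i.obj M} (h : Homotopic f g) : D.toMan f = D.toMan g :=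
  congrArg (fun t => (t ≫ (D.iU.hom.app M).hom).hom) (D.onSpace_eq h)

lemma isIso_onSpace {e : X ⟶ Y} (he : IsEquivalence e) : IsIso (D.onSpace e) := by
  obtain ⟨g, h, h'⟩ := he
  refine ⟨D.onSpace g, ?_, ?_⟩
  · rw [← onSpace_comp, D.onSpace_eq h, onSpace_id]
  · rw [← onSpace_comp, D.onSpace_eq h', onSpace_id]

lemma range_comp_subset (f : X ⟶ Y) (g : Y ⟶ Z) :
    Set.range (D.onSpace (f ≫ g)) ⊆ Set.range (D.onSpace g) := by
  rintro _ ⟨x, rfl⟩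
  exact ⟨_, (D.onSpace_comp_apply _ _ _).symm⟩

variable [∀ X Y : C, SSet.KanComplex (sHom X Y)]

/-- The lifting properties of open subobjects, on the level of homotopy classes of homotopies. -/
structure IsWeakOpen (k : V ⟶ X) : Prop where
  isOpenEmbedding : Topology.IsOpenEmbedding (D.onSpace k)
  exists_lift : ∀ {T : C} (φ : T ⟶ X), Set.range (D.onSpace φ) ⊆ Set.range (D.onSpace k) →
    ∃ ψ : T ⟶ V, Homotopic (ψ ≫ k) φ
  exists_cell : ∀ {T : C} {ψ ψ' : T ⟶ V} {φ φ' : T ⟶ X} (h : ψ ≫ k = φ) (h' : ψ' ≫ k = φ')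
    (α : φ ⇛ φ'), ∃ β : ψ ⇛ ψ', β.post k h h' = α

variable {D}

lemma exists_push_eq {K L A : SSet.{v}} [SSet.KanComplex K] [SSet.KanComplex L] {f : K ⟶ L}
    {x x' : A ⟶ K} {a a' c : A ⟶ L} (ha : x ≫ f = a) (ha' : x' ≫ f = a')
    (h : ∀ (γ : MapGroupoid.mk (x ≫ f) ⟶ MapGroupoid.mk c)
      (γ' : MapGroupoid.mk (x' ≫ f) ⟶ MapGroupoid.mk c),
      ∃ α : MapGroupoid.mk x ⟶ MapGroupoid.mk x', MapGroupoid.push α f rfl rfl ≫ γ' = γ)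
    (γ : MapGroupoid.mk a ⟶ MapGroupoid.mk c) (γ' : MapGroupoid.mk a' ⟶ MapGroupoid.mk c) :
    ∃ α : MapGroupoid.mk x ⟶ MapGroupoid.mk x', MapGroupoid.push α f ha ha' ≫ γ' = γ := by
  subst ha ha'
  exact h γ γ'

lemma IsOpenSubobject.isWeakOpen {k : V ⟶ X} (h : D.IsOpenSubobject k) : D.IsWeakOpen k where
  isOpenEmbedding := h.1
  exists_lift {T} φ hφ := by
    obtain ⟨x, r⟩ := (isContractible_hPullback_iff.1 (h.2 T φ hφ)).1
    obtain ⟨x, rfl⟩ := (eHomEquiv SSet).surjective x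
    rw [eHomEquiv_whiskerLeft] at r
    exact ⟨x, Cell.homotopic_iff.2 r⟩
  exists_cell {T ψ ψ' φ φ'} e e' α := by
    subst e e'
    have hr : Set.range (D.onSpace (ψ' ≫ k)) ⊆ Set.range (D.onSpace k) := by
      rintro _ ⟨x, rfl⟩
      exact ⟨_, (D.onSpace_comp_apply _ _ _).symm⟩
    -- Both `ψ`, with structure path `α`, and `ψ'`, with the constant one, are factorizations of `ψ'
    -- ≫ k`.
    have key := (isContractible_hPullback_iff.1 (h.2 T (ψ' ≫ k) hr)).2 (𝟙_ SSet)
      (eHomEquiv SSet ψ) (eHomEquiv SSet ψ')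
    rw [toUnit_unit_comp] at key
    obtain ⟨β, hβ⟩ := exists_push_eq (eHomEquiv_whiskerLeft _ _) (eHomEquiv_whiskerLeft _ _) key α (𝟙 _)
    exact ⟨β, (Category.comp_id _).symm.trans hβ⟩

namespace IsWeakOpen

lemma homotopic {k : V ⟶ X} (h : D.IsWeakOpen k) {ψ ψ' : T ⟶ V}
    (e : Homotopic (ψ ≫ k) (ψ' ≫ k)) : Homotopic ψ ψ' := by
  obtain ⟨α⟩ := Cell.homotopic_iff.1 e
  obtain ⟨β, -⟩ := h.exists_cell rfl rfl α
  exact Cell.homotopic_iff.2 ⟨β⟩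

lemma of_isEquivalence (D : GeometricStructure C) {e : X ⟶ Y} (he : IsEquivalence e) :
    D.IsWeakOpen e where
  isOpenEmbedding := by
    have := D.isIso_onSpace he
    exact (TopCat.homeoOfIso (asIso (D.onSpace e))).isOpenEmbedding
  exists_lift φ _ := by
    obtain ⟨g, -, h⟩ := he
    refine ⟨φ ≫ g, ?_⟩
    rw [Category.assoc]
    exact (h.pre φ).trans (.of_eq (Category.comp_id _))
  exists_cell h h' α := he.exists_cell h h' α

lemma comp {k : V ⟶ X} {l : X ⟶ Y} (hk : D.IsWeakOpen k) (hl : D.IsWeakOpen l) :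
    D.IsWeakOpen (k ≫ l) where
  isOpenEmbedding := by
    rw [onSpace_comp, TopCat.coe_comp]
    exact hl.isOpenEmbedding.comp hk.isOpenEmbedding
  exists_lift φ hφ := by
    obtain ⟨ψ, hψ⟩ := hl.exists_lift φ (hφ.trans (D.range_comp_subset _ _))
    obtain ⟨χ, hχ⟩ := hk.exists_lift ψ (by
      rintro _ ⟨x, rfl⟩
      obtain ⟨y, hy⟩ := hφ ⟨x, rfl⟩
      refine ⟨y, hl.isOpenEmbedding.injective ?_⟩
      rw [← D.onSpace_comp_apply, ← D.onSpace_comp_apply, D.onSpace_eq hψ, hy])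
    refine ⟨χ, ?_⟩
    rw [← Category.assoc]
    exact (hχ.post l).trans hψ
  exists_cell h h' α := by
    obtain ⟨β, rfl⟩ := hl.exists_cell ((Category.assoc _ _ _).trans h)
      ((Category.assoc _ _ _).trans h') α
    obtain ⟨γ, rfl⟩ := hk.exists_cell rfl rfl β
    exact ⟨γ, (Cell.post_post _ _ _ rfl _ _ _ _).symm⟩

lemma exists_isEquivalence {k : V ⟶ X} {k' : W ⟶ X} (hk : D.IsWeakOpen k) (hk' : D.IsWeakOpen k')
    (h : Set.range (D.onSpace k) = Set.range (D.onSpace k')) :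
    ∃ e : V ⟶ W, IsEquivalence e ∧ Homotopic (e ≫ k') k := by
  obtain ⟨e, he⟩ := hk'.exists_lift k h.subset
  obtain ⟨g, hg⟩ := hk.exists_lift k' h.symm.subset
  refine ⟨e, ⟨g, hk.homotopic ?_, hk'.homotopic ?_⟩, he⟩ <;>
    rw [Category.assoc, Category.id_comp]
  · exact (hg.pre e).trans he
  · exact (he.pre g).trans hg

end IsWeakOpen

/-- Maps with values in an open subobject lift to it, and so do cells between them; hence
restricting `f` to a `V` that contains the image of `p` does not change the pullback. This is how a
fibre is computed inside a collar. -/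
lemma _root_.DerivedCobordism.IsWeakPullback.lift_open {A B L : C} {p : P ⟶ A} {q : P ⟶ B}
    {f : A ⟶ L} {g : B ⟶ L} {η : p ≫ f ⇛ q ≫ g} (h : IsWeakPullback η) {k : V ⟶ A}
    (hk : D.IsWeakOpen k) (hp : Set.range (D.onSpace p) ⊆ Set.range (D.onSpace k)) :
    ∃ (p' : P ⟶ V) (η' : p' ≫ (k ≫ f) ⇛ q ≫ g), IsWeakPullback η' := by
  obtain ⟨p', hp'⟩ := hk.exists_lift p hp
  obtain ⟨κ⟩ := Cell.homotopic_iff.1 hp'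
  refine ⟨p', κ.post f (Category.assoc _ _ _) rfl ≫ η, ?_, ?_⟩
  · intro T a b γ
    obtain ⟨x, α, β, e⟩ := h.exists_lift' (a ≫ k) b (Category.assoc _ _ _) rfl γ
    obtain ⟨α', hα'⟩ := hk.exists_cell (Category.assoc x p' k) rfl (κ.pre x rfl rfl ≫ α)
    refine ⟨x, α', β, ?_⟩
    rw [← Cell.post_post α' k f rfl (Category.assoc _ _ _) rfl (by simp) (by simp), hα',
      Cell.post_comp (hg := Category.assoc _ _ _), Cell.pre_comp (hg := rfl), Category.assoc, e]
    refine Eq.trans ?_ (Category.assoc _ _ _).symm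
    congr 1
    exact Cell.post_pre _ _ _ _ _ _ _ _ _ _ _
  · intro T x x' α β e
    let κx := κ.pre x (f' := x ≫ p' ≫ k) rfl rfl
    let κx' := κ.pre x' (f' := x' ≫ p' ≫ k) rfl rfl
    let α' := α.post k (Category.assoc _ _ _) (Category.assoc _ _ _)
    refine h.unique x x' (inv κx ≫ α' ≫ κx') β ?_
    rw [Cell.pre_comp (hg := rfl), Cell.pre_comp (hg := rfl)] at e
    have e₁ := Cell.post_pre x κ f rfl rfl (Category.assoc _ _ _) rfl
      (show (x ≫ p' ≫ k) ≫ f = x ≫ p' ≫ k ≫ f by simp) (Category.assoc x p f) rfl rfl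
    have e₂ := Cell.post_pre x' κ f rfl rfl (Category.assoc _ _ _) rfl
      (show (x' ≫ p' ≫ k) ≫ f = x' ≫ p' ≫ k ≫ f by simp) (Category.assoc x' p f) rfl rfl
    have e₃ := Cell.post_post α k f rfl (Category.assoc _ _ _) (Category.assoc _ _ _)
      (show (x ≫ p' ≫ k) ≫ f = x ≫ p' ≫ k ≫ f by simp)
      (show (x' ≫ p' ≫ k) ≫ f = x' ≫ p' ≫ k ≫ f by simp)
    rw [← e₁, ← e₂, ← e₃] at e
    have e' := e.trans (Category.assoc _ _ _)
    rw [Cell.post_comp (hg := show (x ≫ p' ≫ k) ≫ f = x ≫ p' ≫ k ≫ f by simp),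
      Cell.post_comp (hg := show (x' ≫ p' ≫ k) ≫ f = x' ≫ p' ≫ k ≫ f by simp), Cell.post_inv]
    refine (Category.assoc _ _ _).trans ((IsIso.inv_comp_eq _).2 ?_)
    exact (Category.assoc _ _ _).trans e'

end GeometricStructure

/-! ### Transverse squares of manifolds. -/

namespace Man

/-- A finite-dimensional vector space, as a manifold. -/
def vec (E : Type) [NormedAddCommGroup E] [NormedSpace ℝ E] [FiniteDimensional ℝ E] : Man where
  E := E
  carrier := E

section

variable {E F : Type} [NormedAddCommGroup E] [NormedSpace ℝ E] [FiniteDimensional ℝ E]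
  [NormedAddCommGroup F] [NormedSpace ℝ F] [FiniteDimensional ℝ F]

/-- A smooth map between vector spaces, as a morphism of manifolds. -/
def ofContDiff (f : E → F) (hf : ContDiff ℝ ∞ f) : vec E ⟶ vec F :=
  (⟨f, hf.contMDiff⟩ : ContMDiffMap (vec E).model (vec F).model (vec E).carrier (vec F).carrier ∞)

/-- The function underlying a morphism of vector spaces. -/
def toFun (f : vec E ⟶ vec F) : E → F := toMap f

lemma contDiff_toFun (f : vec E ⟶ vec F) : ContDiff ℝ ∞ (toFun f) :=
  contMDiff_iff_contDiff.1 (toMap f).contMDiff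

end

variable {L M N : Man}

lemma hom_ext {f g : M ⟶ N} (h : ∀ x, toMap f x = toMap g x) : f = g := ContMDiffMap.ext h

lemma continuous_toMap (f : M ⟶ N) : Continuous (toMap f) := (toMap f).contMDiff.continuous

/-- A morphism with values in an open subset, as a morphism to this open subset. -/
def codRestrict (f : M ⟶ N) (U : TopologicalSpace.Opens N.carrier) (h : ∀ x, toMap f x ∈ U) :
    M ⟶ N.opens U :=
  (⟨fun x => ⟨toMap f x, h x⟩,
    (ContMDiff.subtypeVal_comp_iff (I := M.model) (I' := N.model) U _).1 (toMap f).contMDiff⟩ :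
    ContMDiffMap M.model N.model M.carrier U ∞)

lemma codRestrict_incl (f : M ⟶ N) (U : TopologicalSpace.Opens N.carrier)
    (h : ∀ x, toMap f x ∈ U) : codRestrict f U h ≫ N.opensIncl U = f := rfl

/-- Near `y` the inclusion has a smooth right inverse, extended by the junk value `y` off `U`; the
chain rule splits the differential. -/
lemma diff_opensIncl_surjective (U : TopologicalSpace.Opens N.carrier)
    (y : (N.opens U).carrier) (w : N.E) : ∃ v : N.E, diff (N.opensIncl U) y v = w := by
  classical
  let r : N.carrier → U := fun z => if h : z ∈ U then ⟨z, h⟩ else y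
  have e : (Subtype.val ∘ r : N.carrier → N.carrier) =ᶠ[nhds y.1] id := by
    filter_upwards [U.isOpen.mem_nhds y.2] with z hz
    simp [r, show z ∈ U from hz]
  have hr : ContMDiffAt N.model N.model ∞ r y.1 :=
    (ContMDiffAt.subtypeVal_comp_iff (I := N.model) (I' := N.model) U r y.1).1
      (contMDiffAt_id.congr_of_eventuallyEq e)
  have hy : r y.1 = y := dif_pos y.2
  have h₁ : MDifferentiableAt N.model N.model (Subtype.val : U → N.carrier) (r y.1) :=
    (contMDiff_subtype_val (n := ∞) (r y.1)).mdifferentiableAt (by simp)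
  have h₂ : MDifferentiableAt N.model N.model r y.1 := hr.mdifferentiableAt (by simp)
  have h := mfderiv_comp y.1 h₁ h₂
  rw [e.mfderiv_eq, mfderiv_id] at h
  refine ⟨mfderiv N.model N.model r y.1 w, ?_⟩
  have h' := congrArg (fun t : N.E →L[ℝ] N.E => t w) h
  rw [hy] at h'
  exact h'.symm

/-- Consequently `i` turns preimages of open subsets into homotopy pullbacks. -/
lemma transverse_opensIncl (g : M ⟶ N) (U : TopologicalSpace.Opens N.carrier) :
    Transverse g (N.opensIncl U) := by
  intro a b _ w
  obtain ⟨v, hv⟩ := diff_opensIncl_surjective U b w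
  exact ⟨0, v, by rw [map_zero, zero_add, hv]⟩

/-- The preimage of an open subset. -/
def preimage (g : M ⟶ N) (U : TopologicalSpace.Opens N.carrier) :
    TopologicalSpace.Opens M.carrier :=
  ⟨toMap g ⁻¹' U, U.isOpen.preimage (continuous_toMap g)⟩

lemma isPullback_opensIncl (g : M ⟶ N) (U : TopologicalSpace.Opens N.carrier) :
    IsPullback (M.opensIncl (preimage g U))
      (codRestrict (M.opensIncl (preimage g U) ≫ g) U fun x => x.2) g (N.opensIncl U) where
  w := rfl
  isLimit' := ⟨PullbackCone.IsLimit.mk _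
    (fun s => codRestrict s.fst _ fun x => by
      have h : toMap g (toMap s.fst x) = toMap (N.opensIncl U) (toMap s.snd x) :=
        congrArg (fun t => toMap t x) s.condition
      change toMap g (toMap s.fst x) ∈ U
      rw [h]
      exact (toMap s.snd x).2)
    (fun _ => rfl)
    (fun s => hom_ext fun x => Subtype.ext (congrArg (fun t => toMap t x) s.condition))
    (fun _ _ h _ => hom_ext fun x => Subtype.ext (congrArg (fun t => toMap t x) h))⟩

lemma isPullback_id_opensIncl (U : TopologicalSpace.Opens N.carrier) :
    IsPullback (𝟙 _) (𝟙 _) (N.opensIncl U) (N.opensIncl U) where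
  w := rfl
  isLimit' := ⟨PullbackCone.IsLimit.mk _ (fun s => s.fst) (fun _ => rfl)
    (fun s => hom_ext fun x => Subtype.ext (congrArg (fun t => toMap t x) s.condition))
    (fun _ _ h _ => h)⟩

/-- The map to the point. -/
def toPoint (M : Man) : M ⟶ euclidean 0 :=
  (ContMDiffMap.const (0 : EuclideanSpace ℝ (Fin 0)) :
    ContMDiffMap M.model (euclidean 0).model M.carrier (euclidean 0).carrier ∞)

lemma toPoint_unique (f g : M ⟶ euclidean 0) : f = g :=
  hom_ext fun _ => Subsingleton.elim (α := EuclideanSpace ℝ (Fin 0)) _ _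

lemma transverse_point (f : M ⟶ euclidean 0) (g : N ⟶ euclidean 0) : Transverse f g :=
  fun _ _ _ _ => ⟨0, 0, Subsingleton.elim (α := EuclideanSpace ℝ (Fin 0)) _ _⟩

lemma isPullback_prod (E F : Type) [NormedAddCommGroup E] [NormedSpace ℝ E]
    [FiniteDimensional ℝ E] [NormedAddCommGroup F] [NormedSpace ℝ F] [FiniteDimensional ℝ F] :
    IsPullback (ofContDiff (Prod.fst : E × F → E) contDiff_fst)
      (ofContDiff (Prod.snd : E × F → F) contDiff_snd) (toPoint _) (toPoint _) where
  w := toPoint_unique _ _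
  isLimit' := ⟨PullbackCone.IsLimit.mk _
    (fun s => (⟨fun x => ((toMap s.fst x : E), (toMap s.snd x : F)),
      (toMap s.fst).contMDiff.prodMk_space (toMap s.snd).contMDiff⟩ :
        ContMDiffMap s.pt.model (vec (E × F)).model s.pt.carrier (vec (E × F)).carrier ∞))
    (fun _ => rfl) (fun _ => rfl)
    (fun _ _ h h' => hom_ext fun x => Prod.ext (congrArg (fun t => toMap t x) h)
      (congrArg (fun t => toMap t x) h'))⟩

end Man

open SimplicialCategory

/-! ### Discrete mapping spaces. -/

section Discrete

lemma eq_of_ι₀_eq {S : Type v} {u w : 𝟙_ SSet.{v} ⊗ Δ[1] ⟶ (SimplicialObject.const (Type v)).obj S}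
    (h : SSet.ι₀ ≫ u = SSet.ι₀ ≫ w) : u = w := by
  have e (u : 𝟙_ SSet.{v} ⊗ Δ[1] ⟶ (SimplicialObject.const (Type v)).obj S) :
      SSet.ι₀ ≫ u = SSet.const (SimplicialObject.δ ((SimplicialObject.const (Type v)).obj S)
        (n := 0) 1 (SSet.yonedaEquiv ((λ_ Δ[1]).inv ≫ u))) := by
    have := const_zero_edge (X := 𝟙_ SSet) (SSet.yonedaEquiv ((λ_ Δ[1]).inv ≫ u))
    rw [Equiv.symm_apply_apply] at this
    exact (congrArg (· ≫ u) const_leftUnitor_inv).symm.trans ((Category.assoc _ _ _).trans this)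
  have h' := const_unit_injective ((e u).symm.trans (h.trans (e w)))
  exact (cancel_epi _).1 (SSet.yonedaEquiv.injective h')

/-- Up to conjugation by `H`, a path in `K` comes from a path in the discrete `S`, and that is
determined by its starting point. -/
lemma IsHomotopyEquivalence.path_unique_of_const {S : Type v} {K : SSet.{v}} [SSet.KanComplex K]
    {f : (SimplicialObject.const (Type v)).obj S ⟶ K} (hf : IsHomotopyEquivalence f)
    {a b : 𝟙_ SSet ⟶ K} (p q : MapGroupoid.mk a ⟶ MapGroupoid.mk b) : p = q := by
  obtain ⟨g, -, ⟨H⟩⟩ := isHomotopyEquivalence_iff_path.1 hf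
  rw [IsHomotopyEquivalence.eq_of_path_id H p, IsHomotopyEquivalence.eq_of_path_id H q]
  congr 2
  obtain ⟨p, rfl⟩ := Path.cls_surjective p
  obtain ⟨q, rfl⟩ := Path.cls_surjective q
  refine congrArg Path.cls (Path.ext ?_)
  have e : p.h ≫ g = q.h ≫ g := eq_of_ι₀_eq
    ((congrArg (· ≫ g) p.h₀).trans (congrArg (· ≫ g) q.h₀).symm)
  exact (Category.assoc _ _ _).symm.trans ((congrArg (· ≫ f) e).trans (Category.assoc _ _ _))

lemma exists_comp_ofVertices {S : Type v} {K : SSet.{v}} (σ : S → K _⦋0⦌)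
    (x : 𝟙_ SSet ⟶ (SimplicialObject.const (Type v)).obj S) :
    ∃ s, x ≫ ofVertices σ = K.unitHomEquiv.symm (σ s) := by
  refine ⟨SSet.unitHomEquiv _ x, K.unitHomEquiv.injective ?_⟩
  rw [Equiv.apply_symm_apply]
  have e : SimplexCategory.const ⦋0⦌ ⦋0⦌ 0 = 𝟙 _ := by decide
  change K.map (SimplexCategory.const ⦋0⦌ ⦋0⦌ 0).op (σ (SSet.unitHomEquiv _ x)) = _
  rw [e]
  simp

end Discrete

/-! ### Identities as pullbacks and as open subobjects. -/

section IdentitySquares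

variable {C : Type u} [Category.{v} C] [SimplicialCategory C]
  [∀ X Y : C, SSet.KanComplex (sHom X Y)] {X Y : C}

/-- With `isOpenSubobject_id`, this makes a model imbedding an imbedding, for the cover of the
target by itself. -/
lemma isHomotopyPullback_id (p : X ⟶ Y) : IsHomotopyPullback (𝟙 X) p p (𝟙 Y) := by
  obtain ⟨η, -⟩ := Cell.ofHtpy_surjective
    (Cell.ofEq (show 𝟙 X ≫ p = p ≫ 𝟙 Y by rw [Category.id_comp, Category.comp_id]))
  refine ⟨η, fun T => ?_⟩
  have hf {S : SSet.{v}} (x : S ⟶ sHom T X) :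
      (x ≫ pullbackComparison T η) ≫ hPullbackFst _ _ = x := by
    rw [Category.assoc, pullbackComparison, hPullbackLift_fst, eHomWhiskerLeft_id,
      Category.comp_id]
  apply IsHomotopyEquivalence.of_bijective
  · intro S y
    let x := y ≫ hPullbackFst _ _
    let r₁ := hPullbackPath (x ≫ pullbackComparison T η)
    have hid {S : SSet.{v}} (z : S ⟶ sHom T Y) : z ≫ eHomWhiskerLeft SSet T (𝟙 Y) = z :=
      (congrArg (z ≫ ·) (eHomWhiskerLeft_id SSet T Y)).trans (Category.comp_id _)
    let r₁' : Path (x ≫ eHomWhiskerLeft SSet T p) ((x ≫ pullbackComparison T η) ≫ hPullbackSnd _ _) :=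
      ⟨r₁.h, r₁.h₀.trans (congrArg (· ≫ _) (hf x)), r₁.h₁.trans (hid _)⟩
    let r₂ : Path (x ≫ eHomWhiskerLeft SSet T p) (y ≫ hPullbackSnd _ _) :=
      ⟨(hPullbackPath y).h, (hPullbackPath y).h₀, (hPullbackPath y).h₁.trans (hid _)⟩
    obtain ⟨β, hβ⟩ := Path.cls_surjective (inv r₁'.cls ≫ r₂.cls)
    refine ⟨x, (hPullback_path_iff (hf x) rfl rfl rfl rfl rfl (hid _) (hid _) (p := r₁') (p' := r₂) rfl rfl).2 ⟨.refl _, β, ?_⟩⟩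
    rw [Path.refl_map, Path.cls_refl, Category.id_comp]
    have : (β.map (eHomWhiskerLeft SSet T (𝟙 Y)) (hid _) (hid _)).cls = β.cls :=
      congrArg Path.cls (Path.ext (hid _))
    rw [this, hβ, IsIso.hom_inv_id_assoc]
  · rintro S x x' ⟨r⟩
    exact ⟨r.map (hPullbackFst _ _) (hf x) (hf x')⟩

lemma GeometricStructure.isOpenSubobject_id (D : GeometricStructure C) (X : C) :
    D.IsOpenSubobject (𝟙 X) := by
  refine ⟨by rw [D.onSpace_id]; exact Topology.IsOpenEmbedding.id, fun T φ _ => ?_⟩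
  refine isContractible_hPullback_iff.2 ⟨⟨eHomEquiv SSet φ, ?_⟩, ?_⟩
  · rw [eHomEquiv_whiskerLeft, Category.comp_id]
    exact ⟨𝟙 _⟩
  · intro A x x' γ γ'
    exact ((IsEquivalence.id X).isHomotopyEquivalence T).full rfl rfl (γ ≫ inv γ') |>.imp
      fun α h => by rw [h, Category.assoc, IsIso.inv_hom_id, Category.comp_id]

end IdentitySquares

/-! ### Factorization through open submanifolds. -/

namespace GeometricStructure

variable {C : Type u} [Category.{v} C] [SimplicialCategory C] {D : GeometricStructure C}
  [∀ X Y : C, SSet.KanComplex (sHom X Y)] {T V W X Y Z P Q : C} {M N : Man}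

lemma cell_unique {f g : D.i.obj M ⟶ D.i.obj N} (α β : f ⇛ g) : α = β :=
  (D.fullyFaithful M N).path_unique_of_const α β

lemma exists_map (h : D.i.obj M ⟶ D.i.obj N) : ∃ g : M ⟶ N, Homotopic (D.i.map g) h := by
  obtain ⟨x, ⟨r⟩⟩ := (D.fullyFaithful M N).exists_preimage (eHomEquiv SSet h)
  obtain ⟨s, hs⟩ := exists_comp_ofVertices _ x
  rw [hs] at r
  refine ⟨s.down, Cell.homotopic_iff.2 ⟨?_⟩⟩
  have e : (sHom (D.i.obj M) (D.i.obj N)).unitHomEquiv.symm (homEquiv' _ _ (D.i.map s.down)) =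
    eHomEquiv SSet (D.i.map s.down) := Equiv.symm_apply_apply _ _
  rw [e] at r
  exact r.cls

/-- As `U ×_N U = U` is a transverse fibre product, the inclusion is a monomorphism up to homotopy:
the pair `ψ`, `ψ'` with `α` lifts to a single map, connected to both. -/
lemma exists_opensIncl_cell (U : TopologicalSpace.Opens N.carrier)
    {ψ ψ' : T ⟶ D.i.obj (N.opens U)} {φ φ' : T ⟶ D.i.obj N}
    (h : ψ ≫ D.i.map (N.opensIncl U) = φ) (h' : ψ' ≫ D.i.map (N.opensIncl U) = φ') (α : φ ⇛ φ') :
    ∃ β : ψ ⇛ ψ', β.post _ h h' = α := by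
  subst h h'
  obtain ⟨η, hη⟩ := (D.transverse (Man.isPullback_id_opensIncl U)
    (Man.transverse_opensIncl _ U)).exists_isWeakPullback
  obtain ⟨x, β, β', e⟩ := hη.exists_lift ψ ψ' α
  -- Cells between maps of manifolds are unique, so the filling of the square is the identity.
  rw [cell_unique η (𝟙 _), Cell.pre_id, Category.id_comp] at e
  refine ⟨inv β ≫ β', ?_⟩
  rw [Cell.post_comp (hg := Category.assoc _ _ _), Cell.post_inv, ← e, IsIso.inv_hom_id_assoc]

variable (D) in
/-- The map `φ` factors, up to homotopy, through the open submanifold `U`. -/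
def LiftsTo (φ : T ⟶ D.i.obj M) (U : TopologicalSpace.Opens M.carrier) : Prop :=
  ∃ ψ : T ⟶ D.i.obj (M.opens U), Homotopic (ψ ≫ D.i.map (M.opensIncl U)) φ

namespace LiftsTo

variable {φ : T ⟶ D.i.obj M} {U : TopologicalSpace.Opens M.carrier}

lemma congr {φ' : T ⟶ D.i.obj M} (h : D.LiftsTo φ U) (e : Homotopic φ φ') : D.LiftsTo φ' U :=
  h.imp fun _ h => h.trans e

lemma pre (h : D.LiftsTo φ U) (x : V ⟶ T) : D.LiftsTo (x ≫ φ) U := by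
  obtain ⟨ψ, h⟩ := h
  exact ⟨x ≫ ψ, by rw [Category.assoc]; exact h.pre x⟩

lemma of_forall_mem (φ : T ⟶ D.i.obj M) (g : M ⟶ N) {U : TopologicalSpace.Opens N.carrier}
    (h : ∀ x, Man.toMap g x ∈ U) : D.LiftsTo (φ ≫ D.i.map g) U :=
  ⟨φ ≫ D.i.map (Man.codRestrict g U h), .of_eq (by
    rw [Category.assoc, ← D.i.map_comp, Man.codRestrict_incl])⟩

lemma pullback {g : M ⟶ N} {U : TopologicalSpace.Opens N.carrier}
    (h : D.LiftsTo (φ ≫ D.i.map g) U) : D.LiftsTo φ (Man.preimage g U) := by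
  obtain ⟨ψ, h⟩ := h
  obtain ⟨γ⟩ := Cell.homotopic_iff.1 h.symm
  obtain ⟨η, hη⟩ := (D.transverse (Man.isPullback_opensIncl g U)
    (Man.transverse_opensIncl _ U)).exists_isWeakPullback
  obtain ⟨x, β, -⟩ := hη.exists_lift φ ψ γ
  exact ⟨x, Cell.homotopic_iff.2 ⟨β⟩⟩

end LiftsTo

end GeometricStructure

open SimplicialCategory

/-! ### Maps with values in an open subset of the line. -/

namespace GeometricStructure

variable {C : Type u} [Category.{v} C] [SimplicialCategory C] {D : GeometricStructure C}
  {T V W X Y Z P Q A B : C} {M N : Man}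

/-- A compact Hausdorff space, as an object of `CG`. -/
def compactCG (K : Type) [TopologicalSpace K] [CompactSpace K] [T2Space K] : CG :=
  ⟨TopCat.of K, inferInstanceAs (T2Space K), inferInstanceAs (CompactlyGeneratedSpace K)⟩

/-- Compact Hausdorff spaces belong to `CG`, so the universal property applies to them without a
description of the topology of a pullback in `CG`. -/
lemma exists_map_of_isPullback {L : C} {p : P ⟶ A} {q : P ⟶ B} {f : A ⟶ L} {g : B ⟶ L}
    (h : IsPullback (D.U.map p) (D.U.map q) (D.U.map f) (D.U.map g)) {K : Type}
    [TopologicalSpace K] [CompactSpace K] [T2Space K] (a : C(K, D.space A)) (b : C(K, D.space B))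
    (e : ∀ x, D.onSpace f (a x) = D.onSpace g (b x)) :
    ∃ t : C(K, D.space P), (∀ x, D.onSpace p (t x) = a x) ∧ ∀ x, D.onSpace q (t x) = b x := by
  let a' : compactCG K ⟶ D.U.obj A := ObjectProperty.homMk (TopCat.ofHom a)
  let b' : compactCG K ⟶ D.U.obj B := ObjectProperty.homMk (TopCat.ofHom b)
  have w : a' ≫ D.U.map f = b' ≫ D.U.map g :=
    ObjectProperty.hom_ext _ (TopCat.hom_ext (ContinuousMap.ext e))
  exact ⟨(h.lift a' b' w).hom.hom,
    fun x => ConcreteCategory.congr_hom (congrArg (fun t => t.hom) (h.lift_fst a' b' w)) x,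
    fun x => ConcreteCategory.congr_hom (congrArg (fun t => t.hom) (h.lift_snd a' b' w)) x⟩

lemma exists_point_of_isPullback {L : C} {p : P ⟶ A} {q : P ⟶ B} {f : A ⟶ L} {g : B ⟶ L}
    (h : IsPullback (D.U.map p) (D.U.map q) (D.U.map f) (D.U.map g)) (a : D.space A)
    (b : D.space B) (e : D.onSpace f a = D.onSpace g b) :
    ∃ z, D.onSpace p z = a ∧ D.onSpace q z = b := by
  obtain ⟨t, h₁, h₂⟩ := exists_map_of_isPullback h (K := PUnit) (.const _ a) (.const _ b)
    fun _ => e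
  exact ⟨t ⟨⟩, h₁ _, h₂ _⟩

lemma point_ext_of_isPullback {L : C} {p : P ⟶ A} {q : P ⟶ B} {f : A ⟶ L} {g : B ⟶ L}
    (h : IsPullback (D.U.map p) (D.U.map q) (D.U.map f) (D.U.map g)) {z z' : D.space P}
    (h₁ : D.onSpace p z = D.onSpace p z') (h₂ : D.onSpace q z = D.onSpace q z') : z = z' := by
  let c (z : D.space P) : compactCG PUnit ⟶ D.U.obj P :=
    ObjectProperty.homMk (TopCat.ofHom (.const PUnit z))
  have e : c z = c z' := h.hom_ext
    (ObjectProperty.hom_ext _ (TopCat.hom_ext (ContinuousMap.ext fun _ => h₁)))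
    (ObjectProperty.hom_ext _ (TopCat.hom_ext (ContinuousMap.ext fun _ => h₂)))
  exact ConcreteCategory.congr_hom (congrArg (fun t => t.hom) e) PUnit.unit

variable (D) in
/-- The underlying space of `i M` is `M`. -/
def homeo (M : Man) : D.space (D.i.obj M) ≃ₜ M.carrier :=
  TopCat.homeoOfIso ((ObjectProperty.ι _).mapIso (D.iU.app M))

lemma toMan_apply (f : X ⟶ D.i.obj M) (x : D.space X) :
    D.toMan f x = D.homeo M (D.onSpace f x) := rfl

lemma homeo_map (g : M ⟶ N) (x : D.space (D.i.obj M)) :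
    D.homeo N (D.onSpace (D.i.map g) x) = Man.toMap g (D.homeo M x) := by
  have := D.toMan_map (𝟙 _) g x
  rwa [Category.id_comp, toMan_apply, toMan_apply, onSpace_id] at this

variable [∀ X Y : C, SSet.KanComplex (sHom X Y)]

lemma homotopic_zero {n : ℕ} {p : P ⟶ X} {q : P ⟶ D.i.obj (Man.euclidean 0)}
    {f : X ⟶ D.i.obj (Man.euclidean n)} (h : IsHomotopyPullback p q f (D.i.map (Man.origin n)))
    (o : X ⟶ D.i.obj (Man.euclidean 0)) :
    Homotopic (p ≫ f) (p ≫ o ≫ D.i.map (Man.origin n)) := by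
  obtain ⟨η, -⟩ := h
  refine Homotopic.trans ⟨η⟩ ?_
  rw [← Category.assoc]
  exact (Cell.homotopic_iff.2 (D.terminal.nonempty_cell _ _)).post _

/-- On `V` the map `F` is homotopic to zero, hence `g` is homotopic to `g + ‖F‖²`. The latter is
positive on all of `E`: at a zero of `F`, which is a point of `V`, because of `g`, and elsewhere
because of `‖F‖²`. So it factors through `(0, ∞)` already as a smooth map. -/
lemma liftsTo_of_zeroSet {E : Type} [NormedAddCommGroup E] [NormedSpace ℝ E]
    [FiniteDimensional ℝ E] {k : ℕ} {p : V ⟶ D.i.obj (Man.vec E)}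
    (F z : Man.vec E ⟶ Man.vec (EuclideanSpace ℝ (Fin k))) (hz : ∀ x, Man.toFun z x = 0)
    (hp : Homotopic (p ≫ D.i.map F) (p ≫ D.i.map z))
    (hF : ∀ x, Man.toFun F x = 0 → ∃ v, D.toMan p v = x) (g : Man.vec E ⟶ Man.vec ℝ)
    (hg : ∀ x, 0 ≤ Man.toFun g x) (hg' : ∀ v, 0 < Man.toFun g (D.toMan p v)) :
    D.LiftsTo (p ≫ D.i.map g) (⟨Set.Ioi (0 : ℝ), isOpen_Ioi⟩ : TopologicalSpace.Opens ℝ) := by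
  let G := EuclideanSpace ℝ (Fin k)
  let pair (F : Man.vec E ⟶ Man.vec G) : Man.vec E ⟶ Man.vec (E × G) :=
    Man.ofContDiff (fun x => (x, Man.toFun F x)) (contDiff_id.prodMk (Man.contDiff_toFun F))
  let m : Man.vec (E × G) ⟶ Man.vec ℝ :=
    Man.ofContDiff (fun y => Man.toFun g y.1 + ‖y.2‖ ^ 2)
      (((Man.contDiff_toFun g).comp contDiff_fst).add ((contDiff_norm_sq ℝ).comp contDiff_snd))
  have hprod := ((D.transverse (Man.isPullback_prod E G)
    (Man.transverse_point _ _)).isHomotopyProduct D.terminal).isWeakProduct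
  -- Since `i` preserves the product `E × ℝᵏ`, the maps `x ↦ (x, F x)` and `x ↦ (x, 0)` become
  -- homotopic on `V`.
  have h₁ : Homotopic (p ≫ D.i.map (pair F)) (p ≫ D.i.map (pair z)) := by
    refine hprod.homotopic (.of_eq ?_) ?_
    · rw [Category.assoc, Category.assoc, ← D.i.map_comp, ← D.i.map_comp]
      rfl
    · rw [Category.assoc, Category.assoc, ← D.i.map_comp, ← D.i.map_comp]
      exact hp
  have h₂ : pair z ≫ m = g := Man.hom_ext fun x => by
    exact (congrArg (fun t : G => Man.toFun g x + ‖t‖ ^ 2) (hz x)).trans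
      (show Man.toFun g x + ‖(0 : G)‖ ^ 2 = Man.toFun g x by simp)
  have h₃ := h₁.post (D.i.map m)
  rw [Category.assoc, Category.assoc, ← D.i.map_comp, ← D.i.map_comp, h₂] at h₃
  refine LiftsTo.congr (LiftsTo.of_forall_mem p (pair F ≫ m) fun x => ?_) h₃
  change 0 < Man.toFun g x + ‖Man.toFun F x‖ ^ 2
  by_cases h : Man.toFun F x = 0
  · obtain ⟨v, rfl⟩ := hF x h
    have := hg' v
    positivity
  · have := hg x
    have : 0 < ‖Man.toFun F x‖ := norm_pos_iff.2 h
    positivity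

lemma GoodForIntersectionTheory.exists_smooth_extension (hD : D.GoodForIntersectionTheory)
    {p : X ⟶ D.i.obj M} (hp : D.IsModelImbedding p) (h : X ⟶ D.line) :
    ∃ g : M ⟶ Man.line, Homotopic (p ≫ D.i.map g) h := by
  obtain ⟨h', e⟩ := hD.exists_extension p (fun y => ⟨_, 𝟙 _, _, 𝟙 _, p, D.isOpenSubobject_id _,
    by rw [D.onSpace_id]; exact ⟨y, rfl⟩, isHomotopyPullback_id p, hp⟩) h
  obtain ⟨g, hg⟩ := exists_map h'
  exact ⟨g, (hg.pre p).trans e⟩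

/-- By the extension axiom and full faithfulness `k` is the restriction of a smooth function `g` on
`ℝⁿ`, and `liftsTo_of_zeroSet` applies to `χ ∘ g`. -/
lemma GoodForIntersectionTheory.liftsTo_localModel (hD : D.GoodForIntersectionTheory)
    (hV : D.IsLocalModel V) (k : V ⟶ D.line) (χ : Man.line ⟶ Man.line)
    (hχ : ∀ x : ℝ, 0 ≤ Man.toFun (E := ℝ) (F := ℝ) χ x)
    (hχ' : ∀ v, 0 < Man.toFun (E := ℝ) (F := ℝ) χ (D.toMan k v)) :
    D.LiftsTo (k ≫ D.i.map χ) (⟨Set.Ioi (0 : ℝ), isOpen_Ioi⟩ : TopologicalSpace.Opens ℝ) := by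
  obtain ⟨n, m, F, p, q, h⟩ := hV
  obtain ⟨g, hg⟩ := hD.exists_smooth_extension ⟨m, D.i.map F, q, h⟩ k
  have e : Homotopic (p ≫ D.i.map (g ≫ χ)) (k ≫ D.i.map χ) := by
    rw [D.i.map_comp, ← Category.assoc]
    exact hg.post _
  refine LiftsTo.congr (liftsTo_of_zeroSet (E := EuclideanSpace ℝ (Fin n)) (k := m) F
    (Man.toPoint (Man.euclidean n) ≫ Man.origin m) (fun _ => rfl) ?_ ?_ (g ≫ χ) (fun x => hχ _) ?_) e
  · have := homotopic_zero h (D.i.map (Man.toPoint _))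
    rwa [← D.i.map_comp] at this
  · intro x hx
    obtain ⟨v, hv, -⟩ := exists_point_of_isPullback (D.isPullback h) ((D.homeo _).symm x)
      ((D.homeo (Man.euclidean 0)).symm (0 : EuclideanSpace ℝ (Fin 0))) (by
        apply (D.homeo _).injective
        rw [homeo_map, homeo_map]
        exact (congrArg (Man.toMap F) (Homeomorph.apply_symm_apply _ x)).trans hx)
    exact ⟨v, (congrArg (D.homeo _) hv).trans (Homeomorph.apply_symm_apply _ _)⟩
  · intro v
    have h₁ := hχ' v
    rw [← D.toMan_eq hg, D.toMan_map] at h₁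
    exact h₁

/-- A smooth function on the line which takes an open interval, and no other point, into a
neighbourhood of the origin that is not the whole line. -/
lemma exists_contDiff_preimage {B : Set ℝ} (hB : IsOpen B) (h₀ : (0 : ℝ) ∈ B)
    (hB' : B ⊆ Set.Ioo (-1) 1) {J : Set ℝ} (hJ : IsOpen J) :
    ∃ ψ : ℝ → ℝ, ContDiff ℝ ∞ ψ ∧ ∀ t, ψ t ∈ B ↔ t ∈ J := by
  obtain ⟨β, hβ, hβ', hβ''⟩ := hJ.exists_contDiff_support_eq (n := ⊤)
  -- The number `sSup S` is the largest nonpositive one outside `B`, so `(sSup S, 0] ⊆ B`. The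
  -- function takes this value off `J`, and values in `(sSup S, 0]` on `J`.
  let S := {x | x ≤ (0 : ℝ) ∧ x ∉ B}
  have hS : IsClosed S := isClosed_Iic.inter hB.isClosed_compl
  have hne : S.Nonempty := ⟨-1, by norm_num, fun h => lt_irrefl _ (hB' h).1⟩
  have hbdd : BddAbove S := ⟨0, fun x hx => hx.1⟩
  have ha := hS.csSup_mem hne hbdd
  refine ⟨fun t => sSup S * (1 - β t), contDiff_const.mul (contDiff_const.sub hβ'), fun t => ?_⟩
  have hr := hβ'' ⟨t, rfl⟩
  rw [← hβ, Function.mem_support]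
  constructor
  · intro h h'
    beta_reduce at h
    rw [h', sub_zero, mul_one] at h
    exact ha.2 h
  · intro h
    have hpos : 0 < β t := lt_of_le_of_ne hr.1 (Ne.symm h)
    have ha' : sSup S < 0 := lt_of_le_of_ne ha.1 fun h => ha.2 (h ▸ h₀)
    by_contra hn
    have : sSup S * (1 - β t) ∈ S := ⟨by nlinarith [hr.2], hn⟩
    have := le_csSup hbdd this
    nlinarith

/-- The open subobjects given by the axioms are abstract, so `φ` is moved into a convenient one by a
function `ψ`: a local model `V` over a neighbourhood `B` of the origin with `ψ ⁻¹' B = J`. If `χ ≥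
0` vanishes exactly off `B`, then `χ` on `V` lifts to `(0, ∞)` by `liftsTo_localModel`, hence so
does `χ ∘ ψ ∘ φ`. As `J` is the preimage of `(0, ∞)` under `χ ∘ ψ`, transversality lifts `φ` to `J`.
-/
lemma GoodForIntersectionTheory.liftsTo_open (hD : D.GoodForIntersectionTheory)
    (φ : T ⟶ D.line) (J : TopologicalSpace.Opens ℝ) (h : ∀ x, (D.toMan φ x : ℝ) ∈ J) :
    D.LiftsTo φ (J : TopologicalSpace.Opens Man.line.carrier) := by
  -- Bounding the neighbourhood ensures that `B` omits a point, which `ψ` needs as its value off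
  -- `J`.
  let W : TopologicalSpace.Opens (D.space D.line) :=
    ⟨D.homeo Man.line ⁻¹' (Set.Ioo (-1) 1 : Set ℝ), (isOpen_Ioo (α := ℝ)).preimage (D.homeo Man.line).continuous⟩
  obtain ⟨V, k, hk, hk₀, hkW, hV⟩ := hD.exists_localModel D.line
    ((D.homeo Man.line).symm (0 : ℝ)) W (by
      have : (0 : ℝ) ∈ Set.Ioo (-1 : ℝ) 1 := by norm_num
      exact (congrArg (· ∈ (Set.Ioo (-1) 1 : Set ℝ))
        (Homeomorph.apply_symm_apply (D.homeo Man.line) (0 : ℝ))).mpr this)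
  let B : Set ℝ := (D.homeo Man.line) '' Set.range (D.onSpace k)
  have hB : IsOpen B := (D.homeo Man.line).isOpenMap _ hk.1.isOpen_range
  have hB₀ : (0 : ℝ) ∈ B := ⟨_, hk₀, Homeomorph.apply_symm_apply _ _⟩
  have hB' : B ⊆ Set.Ioo (-1) 1 := by
    rintro _ ⟨y, hy, rfl⟩
    exact hkW hy
  obtain ⟨ψ, hψ, hψB⟩ := exists_contDiff_preimage hB hB₀ hB' J.isOpen
  obtain ⟨χ, hχ, hχ', hχ''⟩ := hB.exists_contDiff_support_eq (n := ⊤)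
  let ψ' : Man.line ⟶ Man.line := Man.ofContDiff ψ hψ
  let χ' : Man.line ⟶ Man.line := Man.ofContDiff χ hχ'
  obtain ⟨x, hx⟩ := hk.isWeakOpen.exists_lift (φ ≫ D.i.map ψ') (by
    rintro _ ⟨t, rfl⟩
    obtain ⟨y, hy, e⟩ := (hψB _).2 (h t)
    have : D.onSpace (φ ≫ D.i.map ψ') t = y := (D.homeo Man.line).injective (by
      rw [← toMan_apply, D.toMan_map, e]
      rfl)
    rwa [this])
  have hl := (hD.liftsTo_localModel hV k χ' (fun x => (hχ'' ⟨x, rfl⟩).1) fun v => by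
    have : χ (D.toMan k v) ≠ 0 :=
      Function.mem_support.1 (hχ.symm.subset ⟨_, ⟨v, rfl⟩, rfl⟩)
    exact lt_of_le_of_ne (hχ'' ⟨_, rfl⟩).1 this.symm).pre x
  have e : Homotopic (x ≫ k ≫ D.i.map χ') (φ ≫ D.i.map (ψ' ≫ χ')) := by
    have := hx.post (D.i.map χ')
    rwa [Category.assoc, Category.assoc, ← D.i.map_comp] at this
  have := (hl.congr e).pullback
  have hJ (t : ℝ) : 0 < χ (ψ t) ↔ t ∈ J := by
    rw [← SetLike.mem_coe, ← hψB, ← hχ, Function.mem_support]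
    exact ⟨ne_of_gt, fun h => lt_of_le_of_ne (hχ'' ⟨_, rfl⟩).1 h.symm⟩
  have hJ' : Man.preimage (ψ' ≫ χ') (⟨Set.Ioi (0 : ℝ), isOpen_Ioi⟩ : TopologicalSpace.Opens ℝ) =
      J := TopologicalSpace.Opens.ext (Set.ext hJ)
  rwa [hJ'] at this

end GeometricStructure

open SimplicialCategory

namespace Man

/-- A smooth function on the line. -/
abbrev fn (θ : ℝ → ℝ) (hθ : ContDiff ℝ ∞ θ) : line ⟶ line := ofContDiff θ hθ

/-- The translation by `c`. -/
def translation (c : ℝ) : line ⟶ line := fn (fun t => c + t) (contDiff_const.add contDiff_id)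

lemma intervalAt_translation (c ε : ℝ) :
    intervalAt c ε ≫ translation (-c) = line.opensIncl _ :=
  hom_ext fun x => neg_add_cancel_left c (x.1 : ℝ)

lemma translation_translation (c : ℝ) : translation (-c) ≫ translation c = 𝟙 line :=
  hom_ext fun x => add_neg_cancel_left c (x : ℝ)

end Man

/-! ### Products with the line, and collars. -/

namespace GeometricStructure

variable {C : Type u} [Category.{v} C] [SimplicialCategory C] {D : GeometricStructure C}
  {T V W X Y Z Z' Z₁ P Q Q₁ A B : C} {M N : Man}

variable (D) in
/-- The real function underlying a map to the line. -/
def value (f : X ⟶ D.line) (x : D.space X) : ℝ := D.toMan f x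

lemma continuous_value (f : X ⟶ D.line) : Continuous (D.value f) := (D.toMan f).continuous

lemma value_comp (k : X ⟶ Y) (f : Y ⟶ D.line) (x : D.space X) :
    D.value (k ≫ f) x = D.value f (D.onSpace k x) := D.toMan_comp k f x

lemma value_fn (f : X ⟶ D.line) {θ : ℝ → ℝ} (hθ : ContDiff ℝ ∞ θ) (x : D.space X) :
    D.value (f ≫ D.i.map (Man.fn θ hθ)) x = θ (D.value f x) := D.toMan_map f _ x

lemma value_eq {f g : X ⟶ D.line} (h : Homotopic f g) (x : D.space X) :
    D.value f x = D.value g x := congrArg (fun t => t x) (D.toMan_eq h)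

lemma value_intervalAt {c ε : ℝ} (f : X ⟶ D.i.obj (Man.interval ε)) (x : D.space X) :
    D.value (f ≫ D.i.map (Man.intervalAt c ε)) x ∈ Set.Ioo (c - ε) (c + ε) := by
  obtain ⟨t, ht, e⟩ : ∃ t : ℝ, t ∈ Set.Ioo (-ε) ε ∧
      D.value (f ≫ D.i.map (Man.intervalAt c ε)) x = c + t :=
    ⟨(D.toMan f x).1, (D.toMan f x).2, D.toMan_map f _ x⟩
  rw [e]
  constructor <;> linarith [ht.1, ht.2]

lemma surjective_onSpace {e : X ⟶ Y} (he : IsEquivalence e) :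
    Function.Surjective (D.onSpace e) := by
  have := D.isIso_onSpace he
  exact (TopCat.homeoOfIso (asIso (D.onSpace e))).surjective

lemma range_equivalence_comp {e : X ⟶ Y} (he : IsEquivalence e) (k : Y ⟶ Z) :
    Set.range (D.onSpace (e ≫ k)) = Set.range (D.onSpace k) := by
  rw [onSpace_comp, TopCat.coe_comp]
  exact (surjective_onSpace he).range_comp _

/-- The product is kept in its form as a pullback over the point because `U` is assumed to preserve
pullbacks; properness of the projection depends on it. -/
lemma GoodForIntersectionTheory.exists_isHomotopyPullback_point (hD : D.GoodForIntersectionTheory)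
    (X : C) (M : Man) : ∃ (Q : C) (a : Q ⟶ X) (b : Q ⟶ D.i.obj M)
      (o : X ⟶ D.i.obj (Man.euclidean 0)), IsHomotopyPullback a b o (D.i.map (Man.toPoint M)) := by
  obtain ⟨o⟩ := D.terminal.nonempty_hom X
  obtain ⟨Q, a, b, h⟩ := hD.exists_pullback o (D.i.map (Man.toPoint M))
  exact ⟨Q, a, b, o, h⟩

variable [∀ X Y : C, SSet.KanComplex (sHom X Y)]

lemma GoodForIntersectionTheory.exists_intervalAt_lift (hD : D.GoodForIntersectionTheory)
    (φ : T ⟶ D.line) {c ε : ℝ} (h : ∀ x, D.value φ x ∈ Set.Ioo (c - ε) (c + ε)) :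
    ∃ ψ : T ⟶ D.i.obj (Man.interval ε), Homotopic (ψ ≫ D.i.map (Man.intervalAt c ε)) φ := by
  obtain ⟨ψ, hψ⟩ := hD.liftsTo_open (φ ≫ D.i.map (Man.translation (-c)))
    ⟨Set.Ioo (-ε) ε, isOpen_Ioo⟩ fun x => by
      change D.value _ x ∈ Set.Ioo (-ε) ε
      rw [Man.translation, value_fn]
      constructor <;> linarith [(h x).1, (h x).2]
  refine ⟨ψ, ?_⟩
  have := hψ.post (D.i.map (Man.translation c))
  rw [Category.assoc, Category.assoc, ← D.i.map_comp, ← D.i.map_comp,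
    Man.translation_translation, D.i.map_id, Category.comp_id] at this
  exact this

lemma homotopic_of_intervalAt {c ε : ℝ} {ψ ψ' : T ⟶ D.i.obj (Man.interval ε)}
    (h : Homotopic (ψ ≫ D.i.map (Man.intervalAt c ε)) (ψ' ≫ D.i.map (Man.intervalAt c ε))) :
    Homotopic ψ ψ' := by
  have := h.post (D.i.map (Man.translation (-c)))
  rw [Category.assoc, Category.assoc, ← D.i.map_comp, Man.intervalAt_translation] at this
  obtain ⟨α⟩ := Cell.homotopic_iff.1 this
  obtain ⟨β, -⟩ := exists_opensIncl_cell _ rfl rfl α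
  exact Cell.homotopic_iff.2 ⟨β⟩

lemma GoodForIntersectionTheory.exists_product (hD : D.GoodForIntersectionTheory)
    (X : C) (M : Man) : ∃ (Q : C) (a : Q ⟶ X) (b : Q ⟶ D.i.obj M), IsHomotopyProduct a b := by
  obtain ⟨Q, a, b, o, h⟩ := hD.exists_isHomotopyPullback_point X M
  exact ⟨Q, a, b, h.isHomotopyProduct D.terminal⟩

/-- The restriction of a product with the line to an interval is a product with the interval. -/
lemma GoodForIntersectionTheory.exists_intervalProduct_equivalence
    (hD : D.GoodForIntersectionTheory) {a : Q ⟶ Z} {b : Q ⟶ D.line} (hQ : IsWeakProduct a b)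
    {c ε : ℝ} {a₁ : Q₁ ⟶ Z₁} {b₁ : Q₁ ⟶ D.i.obj (Man.interval ε)} (hQ₁ : IsWeakProduct a₁ b₁)
    {z : Z₁ ⟶ Z} (hz : IsEquivalence z) {l : V ⟶ Q} (hl : D.IsWeakOpen l)
    (hl' : Set.range (D.onSpace l) = D.value b ⁻¹' Set.Ioo (c - ε) (c + ε)) :
    ∃ m : Q₁ ⟶ V, IsEquivalence m ∧
      Homotopic (m ≫ l ≫ b) (b₁ ≫ D.i.map (Man.intervalAt c ε)) := by
  obtain ⟨z', hz₁, hz₂⟩ := hz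
  obtain ⟨n, hna, hnb⟩ := hQ.exists_lift (a₁ ≫ z) (b₁ ≫ D.i.map (Man.intervalAt c ε))
  obtain ⟨m, hm⟩ := hl.exists_lift n (by
    rintro _ ⟨x, rfl⟩
    rw [hl', Set.mem_preimage, ← value_comp, value_eq hnb]
    exact value_intervalAt _ _)
  -- The inverse of `m` needs the line coordinate of `V` as a map to the manifold `(-ε, ε)`; this
  -- rests on `liftsTo_open`.
  obtain ⟨ψ, hψ⟩ := hD.exists_intervalAt_lift (l ≫ b) (c := c) (ε := ε) fun x => by
    have : D.onSpace l x ∈ D.value b ⁻¹' Set.Ioo (c - ε) (c + ε) := hl' ▸ ⟨x, rfl⟩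
    rwa [value_comp]
  obtain ⟨g, hga, hgb⟩ := hQ₁.exists_lift (l ≫ a ≫ z') ψ
  have hmb : Homotopic (m ≫ l ≫ b) (b₁ ≫ D.i.map (Man.intervalAt c ε)) := by
    have := hm.post b
    rw [Category.assoc] at this
    exact this.trans hnb
  have hma : Homotopic (m ≫ l ≫ a) (a₁ ≫ z) := by
    have := hm.post a
    rw [Category.assoc] at this
    exact this.trans hna
  refine ⟨m, ⟨g, hQ₁.homotopic ?_ (homotopic_of_intervalAt (c := c) ?_),
    hl.homotopic (hQ.homotopic ?_ ?_)⟩, hmb⟩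
  · rw [Category.assoc, Category.id_comp]
    refine (hga.pre m).trans ?_
    have := hma.post z'
    simp only [Category.assoc] at this
    exact this.trans ((hz₁.pre a₁).trans (.of_eq (Category.comp_id _)))
  · simp only [Category.assoc, Category.id_comp]
    have := (hgb.post (D.i.map (Man.intervalAt c ε))).trans hψ
    rw [Category.assoc] at this
    exact (this.pre m).trans hmb
  · simp only [Category.assoc, Category.id_comp]
    refine (hma.pre g).trans ?_
    have := hga.post z
    simp only [Category.assoc] at this
    refine this.trans ?_
    have := hz₂.pre (l ≫ a)
    simpa only [Category.assoc, Category.comp_id] using this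
  · simp only [Category.assoc, Category.id_comp]
    refine (hmb.pre g).trans ?_
    have := hgb.post (D.i.map (Man.intervalAt c ε))
    rw [Category.assoc] at this
    exact this.trans hψ

variable (D) in
/-- Over the open subset `J` of the line, the map `f` looks like the projection of `Z × ℝ`. -/
def HasCollar (f : X ⟶ D.line) (J : Set ℝ) (Z : C) : Prop :=
  ∃ (V : C) (k : V ⟶ X) (Q : C) (a : Q ⟶ Z) (b : Q ⟶ D.line) (j : V ⟶ Q),
    D.IsWeakOpen k ∧ Set.range (D.onSpace k) = D.value f ⁻¹' J ∧ IsWeakProduct a b ∧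
    D.IsWeakOpen j ∧ Set.range (D.onSpace j) = D.value b ⁻¹' J ∧ Homotopic (j ≫ b) (k ≫ f)

namespace HasCollar

variable {f : X ⟶ D.line} {J : Set ℝ}

/-- Open subobjects with the same image are equivalent, so any of them can serve as the domain of
the collar. -/
lemma exists_of_isWeakOpen (h : D.HasCollar f J Z) {k : V ⟶ X} (hk : D.IsWeakOpen k)
    (hk' : Set.range (D.onSpace k) = D.value f ⁻¹' J) :
    ∃ (Q : C) (a : Q ⟶ Z) (b : Q ⟶ D.line) (j : V ⟶ Q), IsWeakProduct a b ∧
      D.IsWeakOpen j ∧ Set.range (D.onSpace j) = D.value b ⁻¹' J ∧ Homotopic (j ≫ b) (k ≫ f) := by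
  obtain ⟨V', k', Q, a, b, j, h₁, h₂, h₃, h₄, h₅, h₆⟩ := h
  obtain ⟨e, he, he'⟩ := hk.exists_isEquivalence h₁ (hk'.trans h₂.symm)
  refine ⟨Q, a, b, e ≫ j, h₃, (IsWeakOpen.of_isEquivalence D he).comp h₄,
    (range_equivalence_comp he j).trans h₅, ?_⟩
  have := he'.post f
  rw [Category.assoc] at this ⊢
  exact (h₆.pre e).trans this

lemma congr {f' : X ⟶ D.line} (h : D.HasCollar f J Z) (e : Homotopic f f') :
    D.HasCollar f' J Z := by
  obtain ⟨V, k, Q, a, b, j, h₁, h₂, h₃, h₄, h₅, h₆⟩ := h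
  refine ⟨V, k, Q, a, b, j, h₁, h₂.trans ?_, h₃, h₄, h₅, h₆.trans (e.pre k)⟩
  ext x
  rw [Set.mem_preimage, Set.mem_preimage, value_eq e]

lemma comp_equivalence (h : D.HasCollar f J Z) {e : Z ⟶ Z'} (he : IsEquivalence e) :
    D.HasCollar f J Z' := by
  obtain ⟨V, k, Q, a, b, j, h₁, h₂, h₃, h₄⟩ := h
  exact ⟨V, k, Q, a ≫ e, b, j, h₁, h₂, h₃.comp_left he, h₄⟩

/-- A collar may be moved from an open subobject to the ambient object. -/
lemma of_open {l : A ⟶ X} (hl : D.IsWeakOpen l) (hJ : D.value f ⁻¹' J ⊆ Set.range (D.onSpace l))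
    (h : D.HasCollar (l ≫ f) J Z) : D.HasCollar f J Z := by
  obtain ⟨V, k, Q, a, b, j, h₁, h₂, h₃, h₄, h₅, h₆⟩ := h
  refine ⟨V, k ≫ l, Q, a, b, j, h₁.comp hl, ?_, h₃, h₄, h₅, by rwa [Category.assoc]⟩
  rw [onSpace_comp, TopCat.coe_comp, Set.range_comp, h₂]
  ext x
  constructor
  · rintro ⟨y, hy, rfl⟩
    rwa [Set.mem_preimage, value_comp] at hy
  · intro hx
    obtain ⟨y, rfl⟩ := hJ hx
    exact ⟨y, by rwa [Set.mem_preimage, value_comp], rfl⟩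

/-- A collar may be restricted to an open subobject. -/
lemma restrict (hD : D.GoodForIntersectionTheory) (h : D.HasCollar f J Z) (hJ : IsOpen J)
    {l : A ⟶ X} (hl : D.IsWeakOpen l) (hJ' : D.value f ⁻¹' J ⊆ Set.range (D.onSpace l)) :
    D.HasCollar (l ≫ f) J Z := by
  obtain ⟨V, k, hk, hk'⟩ := hD.exists_openSubobject A
    ⟨D.value (l ≫ f) ⁻¹' J, hJ.preimage (continuous_value _)⟩
  have hr : Set.range (D.onSpace (k ≫ l)) = D.value f ⁻¹' J := by
    rw [onSpace_comp, TopCat.coe_comp, Set.range_comp, hk']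
    ext x
    constructor
    · rintro ⟨y, hy, rfl⟩
      change D.value _ _ ∈ J at hy
      rwa [value_comp] at hy
    · intro hx
      obtain ⟨y, rfl⟩ := hJ' hx
      exact ⟨y, show D.value _ _ ∈ J by rwa [value_comp], rfl⟩
  obtain ⟨Q, a, b, j, h₁, h₂, h₃, h₄⟩ := h.exists_of_isWeakOpen (hk.isWeakOpen.comp hl) hr
  exact ⟨V, k, Q, a, b, j, hk.isWeakOpen, hk', h₁, h₂, h₃, by rwa [Category.assoc] at h₄⟩

lemma shrink (hD : D.GoodForIntersectionTheory) (h : D.HasCollar f J Z) {J' : Set ℝ}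
    (hJ' : IsOpen J') (hle : J' ⊆ J) : D.HasCollar f J' Z := by
  obtain ⟨V, k, Q, a, b, j, h₁, h₂, h₃, h₄, h₅, h₆⟩ := h
  obtain ⟨V', k', hk, hk'⟩ := hD.exists_openSubobject V
    ⟨D.value (k ≫ f) ⁻¹' J', hJ'.preimage (continuous_value _)⟩
  -- One computation for both images of `V'`, in `X` through `k` and in `Q` through `j`.
  have key {S : C} {m : V ⟶ S} {g : S ⟶ D.line} (hm : Set.range (D.onSpace m) = D.value g ⁻¹' J)
      (e : Homotopic (m ≫ g) (k ≫ f)) :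
      Set.range (D.onSpace (k' ≫ m)) = D.value g ⁻¹' J' := by
    rw [onSpace_comp, TopCat.coe_comp, Set.range_comp, hk']
    ext x
    constructor
    · rintro ⟨y, hy, rfl⟩
      change D.value _ _ ∈ J' at hy
      rwa [← value_eq e, value_comp] at hy
    · intro hx
      obtain ⟨y, rfl⟩ : x ∈ Set.range (D.onSpace m) := hm ▸ hle hx
      exact ⟨y, show D.value _ _ ∈ J' by rwa [← value_eq e, value_comp], rfl⟩
  refine ⟨V', k' ≫ k, Q, a, b, k' ≫ j, hk.isWeakOpen.comp h₁, key h₂ (.refl _), h₃,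
    hk.isWeakOpen.comp h₄, key h₅ h₆, ?_⟩
  rw [Category.assoc, Category.assoc]
  exact h₆.pre k'

end HasCollar

end GeometricStructure

open SimplicialCategory

section

variable {C : Type u} [Category.{v} C] [SimplicialCategory C] {P X A B : C}
  [∀ X Y : C, SSet.KanComplex (sHom X Y)]

lemma IsWeakProduct.comp_right {a : P ⟶ A} {b : P ⟶ B} (h : IsWeakProduct a b) {e : B ⟶ X}
    (he : IsEquivalence e) : IsWeakProduct a (b ≫ e) where
  exists_lift {T} x y := by
    obtain ⟨g, hg, hg'⟩ := id he
    obtain ⟨z, h₁, h₂⟩ := h.exists_lift x (y ≫ g)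
    refine ⟨z, h₁, ?_⟩
    have := (h₂.post e).trans (.of_eq (Category.assoc _ _ _))
    rw [Category.assoc] at this
    exact this.trans ((hg'.pre y).trans (.of_eq (Category.comp_id _)))
  exists_cell {T z z'} α β := by
    obtain ⟨β', rfl⟩ := he.exists_cell (Category.assoc _ _ _) (Category.assoc _ _ _) β
    obtain ⟨σ, rfl, rfl⟩ := h.exists_cell α β'
    exact ⟨σ, rfl, (Cell.post_post σ b e rfl rfl rfl _ _).symm⟩

end

/-! ### Fibres of collars; reflexivity and symmetry. -/

namespace GeometricStructure

variable {C : Type u} [Category.{v} C] [SimplicialCategory C] {D : GeometricStructure C}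
  {T V W X Y Z Z' Z₁ P P' Q Q₁ A B : C} {M N : Man}

lemma value_point (q : P ⟶ D.i.obj (Man.euclidean 0)) (c : ℝ) (x : D.space P) :
    D.value (q ≫ D.i.map (Man.point Man.line c)) x = c := D.toMan_map q _ x

lemma IsFiber.value_eq {p : P ⟶ X} {f : X ⟶ D.line} {c : ℝ} (h : D.IsFiber p f c)
    (x : D.space P) : D.value f (D.onSpace p x) = c := by
  obtain ⟨q, η, -⟩ := h
  rw [← value_comp, GeometricStructure.value_eq ⟨η⟩, value_point]

lemma IsProper.reparam {f : X ⟶ D.line} (hf : D.IsProper f) {θ θ' : ℝ → ℝ} (hθ : ContDiff ℝ ∞ θ)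
    (hθ' : Continuous θ') (h₁ : ∀ t, θ' (θ t) = t) (h₂ : ∀ t, θ (θ' t) = t) :
    D.IsProper (f ≫ D.i.map (Man.fn θ hθ)) := by
  intro K hK
  convert hf _ (hK.image hθ') using 1
  ext x
  constructor
  · intro hx
    change D.value _ x ∈ K at hx
    rw [value_fn] at hx
    exact ⟨_, hx, h₁ _⟩
  · rintro ⟨t, ht, e⟩
    change D.value _ x ∈ K
    have e' : θ' t = D.value f x := e
    rwa [value_fn, ← e', h₂]

/-- The preimage of `K` is the image of the compact space `Z × K`, mapped to the space of `Q` by the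
universal property of the pullback in `CG`. -/
lemma isProper_of_isHomotopyPullback (hZ : D.IsCompact Z) {a : Q ⟶ Z} {b : Q ⟶ D.line}
    {o : Z ⟶ D.i.obj (Man.euclidean 0)} {g : D.line ⟶ D.i.obj (Man.euclidean 0)}
    (hQ : IsHomotopyPullback a b o g) {K : Set ℝ} (hK : _root_.IsCompact K) :
    _root_.IsCompact (D.value b ⁻¹' K) := by
  have := isCompact_iff_compactSpace.1 hK
  have : CompactSpace (D.space Z) := hZ
  have : T2Space (D.space Z) := (D.U.obj Z).property.1
  have hsub (x y : D.space (D.i.obj (Man.euclidean 0))) : x = y :=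
    (D.homeo (Man.euclidean 0)).injective (Subsingleton.elim (α := EuclideanSpace ℝ (Fin 0)) _ _)
  let r : ℝ → D.space D.line := (D.homeo Man.line).symm
  have hr : Continuous r := (D.homeo Man.line).symm.continuous
  let y : C(D.space Z × K, D.space D.line) :=
    ⟨fun x => r x.2.1, hr.comp (continuous_subtype_val.comp continuous_snd)⟩
  obtain ⟨t, ht, ht'⟩ := exists_map_of_isPullback (D.isPullback hQ) ⟨Prod.fst, continuous_fst⟩ y
    fun _ => hsub _ _
  have hv (x : D.space Z × K) : D.value b (t x) = x.2.1 :=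
    (congrArg (D.homeo Man.line) (ht' x)).trans
      (Homeomorph.apply_symm_apply (D.homeo Man.line) _)
  convert isCompact_range t.continuous using 1
  ext x
  constructor
  · intro hx
    exact ⟨(D.onSpace a x, ⟨D.value b x, hx⟩),
      point_ext_of_isPullback (D.isPullback hQ) (ht _) ((D.homeo Man.line).injective (hv _))⟩
  · rintro ⟨s, rfl⟩
    rw [Set.mem_preimage, hv]
    exact s.2.2

variable [∀ X Y : C, SSet.KanComplex (sHom X Y)]

namespace HasCollar

variable {f : X ⟶ D.line} {J : Set ℝ} {c : ℝ}

/-- The diffeomorphism also acts on the line factor of the model `Z × ℝ`, so neither the open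
subobjects nor `Z` change. -/
lemma reparam (h : D.HasCollar f J Z) {θ θ' : ℝ → ℝ} (hθ : ContDiff ℝ ∞ θ)
    (hθ' : ContDiff ℝ ∞ θ') (h₁ : ∀ t, θ' (θ t) = t) (h₂ : ∀ t, θ (θ' t) = t) :
    D.HasCollar (f ≫ D.i.map (Man.fn θ hθ)) (θ' ⁻¹' J) Z := by
  have he : IsEquivalence (D.i.map (Man.fn θ hθ)) := by
    refine ⟨D.i.map (Man.fn θ' hθ'), .of_eq ?_, .of_eq ?_⟩ <;> rw [← D.i.map_comp, ← D.i.map_id]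
    · exact congrArg D.i.map (Man.hom_ext fun t => h₁ t)
    · exact congrArg D.i.map (Man.hom_ext fun t => h₂ t)
  have hv {S : C} (g : S ⟶ D.line) :
      D.value (g ≫ D.i.map (Man.fn θ hθ)) ⁻¹' (θ' ⁻¹' J) = D.value g ⁻¹' J := by
    ext x
    rw [Set.mem_preimage, Set.mem_preimage, Set.mem_preimage, value_fn, h₁]
  obtain ⟨V, k, Q, a, b, j, h₁, h₂, h₃, h₄, h₅, h₆⟩ := h
  refine ⟨V, k, Q, a, _, j, h₁, h₂.trans (hv f).symm, h₃.comp_right he, h₄,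
    h₅.trans (hv b).symm, ?_⟩
  rw [← Category.assoc, ← Category.assoc]
  exact h₆.post _

/-- The fibre over a point of a collar. -/
lemma equivalent_fiber (h : D.HasCollar f J Z) (hc : c ∈ J) {p : P ⟶ X} (hp : D.IsFiber p f c) :
    Equivalent P Z := by
  obtain ⟨V, k, Q, a, b, j, hk, hk', hQ, hj, hj', e⟩ := h
  have hr : Set.range (D.onSpace p) ⊆ Set.range (D.onSpace k) := by
    rintro _ ⟨x, rfl⟩
    rw [hk', Set.mem_preimage, hp.value_eq]
    exact hc
  obtain ⟨q, hp⟩ := hp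
  obtain ⟨η, hη⟩ := hp.exists_isWeakPullback
  -- Both `P` and `Z` are pullbacks of the point `c` along maps from `V` to the line: `P` along `k ≫
  -- f`, and `Z`, as a slice of `Z × ℝ`, along the homotopic map `j ≫ b`.
  obtain ⟨p', η', hη'⟩ := hη.lift_open hk hr
  obtain ⟨o⟩ := D.terminal.nonempty_hom Z
  obtain ⟨s, hs, hs'⟩ := hQ.exists_lift (𝟙 Z) (o ≫ D.i.map (Man.point Man.line c))
  obtain ⟨σ⟩ := Cell.homotopic_iff.1 hs
  obtain ⟨τ⟩ := Cell.homotopic_iff.1 hs'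
  obtain ⟨s', τ', hτ'⟩ := (hQ.isWeakPullback D.terminal o _ σ τ).lift_open hj (by
    rintro _ ⟨x, rfl⟩
    rw [hj', Set.mem_preimage, ← value_comp, value_eq hs', value_point]
    exact hc)
  obtain ⟨θ⟩ := Cell.homotopic_iff.1 e.symm
  exact hη'.equivalent (hτ'.of_cell θ)

lemma exists_fiber (hD : D.GoodForIntersectionTheory) (h : D.HasCollar f J Z) (hc : c ∈ J) :
    ∃ (P : C) (p : P ⟶ X), D.IsFiber p f c ∧ Equivalent Z P := by
  obtain ⟨P, p, q, hp⟩ := hD.exists_pullback f (D.i.map (Man.point Man.line c))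
  exact ⟨P, p, ⟨q, hp⟩, (h.equivalent_fiber hc ⟨q, hp⟩).symm⟩

lemma isCollaredAt (hD : D.GoodForIntersectionTheory) (h : D.HasCollar f J Z) (hJ : IsOpen J)
    (hc : c ∈ J) : D.IsCollaredAt f c := by
  obtain ⟨ε, hε, hεJ⟩ := Metric.isOpen_iff.1 hJ c hc
  rw [Real.ball_eq_Ioo] at hεJ
  obtain ⟨P, p, hp, hP⟩ := h.exists_fiber hD hc
  obtain ⟨z, hz⟩ := hP.symm
  obtain ⟨V, k, hk, hk'⟩ := hD.exists_openSubobject X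
    ⟨D.value f ⁻¹' Set.Ioo (c - ε) (c + ε), isOpen_Ioo.preimage (continuous_value f)⟩
  obtain ⟨Q, a, b, j, hQ, hj, hj', e⟩ :=
    (h.shrink hD isOpen_Ioo hεJ).exists_of_isWeakOpen hk.isWeakOpen hk'
  obtain ⟨Q₁, a₁, b₁, hQ₁⟩ := hD.exists_product P (Man.interval ε)
  obtain ⟨m, ⟨g, hg, hg'⟩, hm⟩ :=
    hD.exists_intervalProduct_equivalence hQ hQ₁.isWeakProduct hz hj hj'
  refine ⟨ε, V, k, P, p, Q₁, a₁, b₁, g, hε, hk, hk', hp, hQ₁, ⟨m, hg', hg⟩, ?_⟩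
  have h₁ := hg'.post (j ≫ b)
  rw [Category.assoc, Category.id_comp] at h₁
  exact e.symm.trans (h₁.symm.trans (hm.pre g))

end HasCollar

/-- The product with the interval is the part of `P' × ℝ` over that interval. The fibre `P'` chosen
by the collar need not be `P`, but `equivalent_fiber` identifies the two up to equivalence. -/
lemma IsCollaredAt.exists_hasCollar (hD : D.GoodForIntersectionTheory) {f : X ⟶ D.line} {c : ℝ}
    (h : D.IsCollaredAt f c) {p : P ⟶ X} (hp : D.IsFiber p f c) (hZ : Equivalent Z P) :
    ∃ J : Set ℝ, IsOpen J ∧ c ∈ J ∧ D.HasCollar f J Z := by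
  obtain ⟨ε, V, k, P', p', Q₁, a₁, b₁, e, hε, hk, hk', hp', hQ₁, he, e'⟩ := h
  obtain ⟨Q, a, b, hQ⟩ := hD.exists_product P' Man.line
  obtain ⟨V', l, hl, hl'⟩ := hD.exists_openSubobject Q
    ⟨D.value b ⁻¹' Set.Ioo (c - ε) (c + ε), isOpen_Ioo.preimage (continuous_value b)⟩
  obtain ⟨m, hm, hm'⟩ := hD.exists_intervalProduct_equivalence hQ.isWeakProduct
    hQ₁.isWeakProduct (.id P') hl.isWeakOpen hl'
  have hc : c ∈ Set.Ioo (c - ε) (c + ε) := ⟨by linarith, by linarith⟩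
  have H : D.HasCollar f (Set.Ioo (c - ε) (c + ε)) P' := by
    refine ⟨V, k, Q, a, b, e ≫ m ≫ l, hk.isWeakOpen, hk', hQ.isWeakProduct,
      (IsWeakOpen.of_isEquivalence D he).comp
        ((IsWeakOpen.of_isEquivalence D hm).comp hl.isWeakOpen),
      (range_equivalence_comp he _).trans ((range_equivalence_comp hm _).trans hl'), ?_⟩
    rw [Category.assoc, Category.assoc]
    exact (hm'.pre e).trans e'.symm
  obtain ⟨z, hz⟩ := (H.equivalent_fiber hc hp).symm.trans hZ.symm
  exact ⟨_, isOpen_Ioo, hc, H.comp_equivalence hz⟩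

/-- Being cobordant, in terms of collars modelled on the given objects. -/
lemma GoodForIntersectionTheory.derivedCobordant_iff (hD : D.GoodForIntersectionTheory) :
    D.DerivedCobordant Z Z' ↔ ∃ (X : C) (f : X ⟶ D.line), D.IsProper f ∧
      (∃ J : Set ℝ, IsOpen J ∧ 0 ∈ J ∧ D.HasCollar f J Z) ∧
      ∃ J : Set ℝ, IsOpen J ∧ 1 ∈ J ∧ D.HasCollar f J Z' := by
  constructor
  · rintro ⟨X, f, hf, h₀, h₁, ⟨P, p, hp, hP⟩, P', p', hp', hP'⟩
    exact ⟨X, f, hf, h₀.exists_hasCollar hD hp hP, h₁.exists_hasCollar hD hp' hP'⟩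
  · rintro ⟨X, f, hf, ⟨J, hJ, hJ', h⟩, J₁, hJ₁, hJ₁', h₁⟩
    exact ⟨X, f, hf, h.isCollaredAt hD hJ hJ', h₁.isCollaredAt hD hJ₁ hJ₁',
      h.exists_fiber hD hJ', h₁.exists_fiber hD hJ₁'⟩

lemma GoodForIntersectionTheory.derivedCobordant_symm (hD : D.GoodForIntersectionTheory)
    (h : D.DerivedCobordant Z Z') : D.DerivedCobordant Z' Z := by
  obtain ⟨X, f, hf, ⟨J, hJ, hJ', h⟩, J₁, hJ₁, hJ₁', h₁⟩ := hD.derivedCobordant_iff.1 h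
  have hθ : ContDiff ℝ ∞ fun t : ℝ => 1 - t := contDiff_const.sub contDiff_id
  have hc (t : ℝ) : 1 - (1 - t) = t := by ring
  refine hD.derivedCobordant_iff.2 ⟨X, _, hf.reparam hθ hθ.continuous hc hc,
    ⟨_, hJ₁.preimage hθ.continuous, ?_, h₁.reparam hθ hθ hc hc⟩,
    ⟨_, hJ.preimage hθ.continuous, ?_, h.reparam hθ hθ hc hc⟩⟩
  · simpa using hJ₁'
  · simpa using hJ'

lemma GoodForIntersectionTheory.derivedCobordant_refl (hD : D.GoodForIntersectionTheory)
    (hZ : D.IsCompact Z) : D.DerivedCobordant Z Z := by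
  obtain ⟨Q, a, b, o, hQ⟩ := hD.exists_isHomotopyPullback_point Z Man.line
  have H : D.HasCollar b Set.univ Z := ⟨Q, 𝟙 Q, Q, a, b, 𝟙 Q, .of_isEquivalence D (.id Q),
    by rw [onSpace_id]; exact Set.range_id, (hQ.isHomotopyProduct D.terminal).isWeakProduct,
    .of_isEquivalence D (.id Q), by rw [onSpace_id]; exact Set.range_id, .refl _⟩
  exact hD.derivedCobordant_iff.2 ⟨Q, b, fun K hK => isProper_of_isHomotopyPullback hZ hQ hK,
    ⟨_, isOpen_univ, trivial, H⟩, _, isOpen_univ, trivial, H⟩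

end GeometricStructure

open SimplicialCategory

/-! ### Gluing spaces along open subsets. -/

section TopologicalPushouts

open Topology

variable {W X Y P : TopCat.{0}} {i : W ⟶ X} {j : W ⟶ Y} {k : X ⟶ P} {l : Y ⟶ P}

lemma range_union_range_of_isPushout (h : IsPushout i j k l) (z : P) :
    (∃ x, k x = z) ∨ ∃ y, l y = z :=
  Types.eq_or_eq_of_isPushout (h.map (forget TopCat)) z

lemma isOpen_iff_of_isPushout (h : IsPushout i j k l) (S : Set P) :
    IsOpen S ↔ IsOpen (k ⁻¹' S) ∧ IsOpen (l ⁻¹' S) := by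
  refine ⟨fun hS => ⟨hS.preimage k.hom.continuous, hS.preimage l.hom.continuous⟩,
    fun ⟨h₁, h₂⟩ => (TopCat.isOpen_iff_of_isColimit _ h.isColimit S).2 ?_⟩
  rintro (_ | _ | _)
  · exact h₁.preimage i.hom.continuous
  · exact h₁
  · exact h₂

/-- Openness in `P` is tested on both pieces. Points of `X` and `Y` are identified only through `W`,
so the preimage of `l '' S` in `X` is the image under `i` of an open subset of `W`. -/
lemma isOpenEmbedding_of_isPushout (h : IsPushout i j k l) (hi : IsOpenEmbedding i)
    (hj : IsOpenEmbedding j) : IsOpenEmbedding l := by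
  have hinj : Function.Injective l :=
    Types.pushoutCocone_inr_injective_of_isColimit (h.map (forget TopCat)).isColimit hi.injective
  refine .of_continuous_injective_isOpenMap l.hom.continuous hinj fun S hS =>
    (isOpen_iff_of_isPushout h _).2 ⟨?_, by rwa [Set.preimage_image_eq _ hinj]⟩
  convert hi.isOpenMap _ (hS.preimage hj.continuous) using 1
  ext x
  constructor
  · rintro ⟨y, hy, e⟩
    obtain ⟨s, rfl, rfl⟩ := (Types.pushoutCocone_inl_eq_inr_iff_of_isColimit
      (h.map (forget TopCat)).isColimit hi.injective x y).1 e.symm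
    exact ⟨s, hy, rfl⟩
  · rintro ⟨s, hs, rfl⟩
    exact ⟨_, hs, (ConcreteCategory.congr_hom h.w s).symm⟩

/-- Two points of one piece are separated there, as it is open and Hausdorff. For points `x` and `y`
of different pieces, either the glued function `χ` separates them or, by `H`, one is in the overlap
and both are in one piece. -/
lemma t2Space_of_isPushout (h : IsPushout i j k l) (hi : IsOpenEmbedding i)
    (hj : IsOpenEmbedding j) [T2Space X] [T2Space Y] {φ : X → ℝ} {ψ : Y → ℝ} (hφ : Continuous φ)
    (hψ : Continuous ψ) (e : ∀ w, φ (i w) = ψ (j w))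
    (H : ∀ x y, φ x = ψ y → x ∈ Set.range i ∨ y ∈ Set.range j) : T2Space P := by
  have hl := isOpenEmbedding_of_isPushout h hi hj
  have hk := isOpenEmbedding_of_isPushout h.flip hj hi
  let χ : P ⟶ TopCat.of ℝ := h.desc (TopCat.ofHom ⟨φ, hφ⟩) (TopCat.ofHom ⟨ψ, hψ⟩)
    (TopCat.hom_ext (ContinuousMap.ext e))
  have hχk (x : X) : χ (k x) = φ x := ConcreteCategory.congr_hom (h.inl_desc _ _ _) x
  have hχl (y : Y) : χ (l y) = ψ y := ConcreteCategory.congr_hom (h.inr_desc _ _ _) y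
  have hij (w : W) : k (i w) = l (j w) := ConcreteCategory.congr_hom h.w w
  have sep {S : TopCat.{0}} [T2Space S] {m : S ⟶ P} (hm : IsOpenEmbedding m) {s t : S}
      (hst : m s ≠ m t) : ∃ U V : Set P, IsOpen U ∧ IsOpen V ∧ m s ∈ U ∧ m t ∈ V ∧
        Disjoint U V := by
    obtain ⟨U, V, hU, hV, hs, ht, hd⟩ := t2_separation (fun h : s = t => hst (congrArg m h))
    exact ⟨m '' U, m '' V, hm.isOpenMap _ hU, hm.isOpenMap _ hV, ⟨s, hs, rfl⟩, ⟨t, ht, rfl⟩,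
      (Set.disjoint_image_iff hm.injective).2 hd⟩
  have mixed (x : X) (y : Y) (hxy : k x ≠ l y) : ∃ U V : Set P, IsOpen U ∧ IsOpen V ∧ k x ∈ U ∧
      l y ∈ V ∧ Disjoint U V := by
    by_cases hv : φ x = ψ y
    · rcases H x y hv with ⟨w, rfl⟩ | ⟨w, rfl⟩
      · rw [hij] at hxy ⊢
        exact sep hl hxy
      · rw [← hij] at hxy ⊢
        exact sep hk hxy
    · obtain ⟨U, V, hU, hV, hs, ht, hd⟩ := t2_separation hv
      exact ⟨χ ⁻¹' U, χ ⁻¹' V, hU.preimage χ.hom.continuous, hV.preimage χ.hom.continuous,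
        by rwa [Set.mem_preimage, hχk], by rwa [Set.mem_preimage, hχl], hd.preimage _⟩
  refine ⟨fun p q hpq => ?_⟩
  rcases range_union_range_of_isPushout h p with ⟨x, rfl⟩ | ⟨y, rfl⟩ <;>
    rcases range_union_range_of_isPushout h q with ⟨x', rfl⟩ | ⟨y', rfl⟩
  · exact sep hk hpq
  · exact mixed x y' hpq
  · obtain ⟨U, V, hU, hV, hs, ht, hd⟩ := mixed x' y hpq.symm
    exact ⟨V, U, hV, hU, ht, hs, hd.symm⟩
  · exact sep hl hpq

end TopologicalPushouts

/-! ### Gluing cobordisms; transitivity. -/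

namespace GeometricStructure

variable {C : Type u} [Category.{v} C] [SimplicialCategory C] {D : GeometricStructure C}
  {X Y Z Z' Z₁ A B : C}

variable [∀ X Y : C, SSet.KanComplex (sHom X Y)]

/-- Gluing along a common collar. -/
lemma GoodForIntersectionTheory.exists_glue (hD : D.GoodForIntersectionTheory)
    {f : A ⟶ D.line} {g : B ⟶ D.line} {r s : ℝ} (hf : ∀ x, D.value f x < s)
    (hg : ∀ y, r < D.value g y) (hfZ : D.HasCollar f (Set.Ioo r s) Z)
    (hgZ : D.HasCollar g (Set.Ioo r s) Z) :
    ∃ (P : C) (k : A ⟶ P) (l : B ⟶ P) (h : P ⟶ D.line), D.IsWeakOpen k ∧ D.IsWeakOpen l ∧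
      Homotopic (k ≫ h) f ∧ Homotopic (l ≫ h) g ∧
      (∀ z, D.value h z < s → z ∈ Set.range (D.onSpace k)) ∧
      ∀ z, r < D.value h z → z ∈ Set.range (D.onSpace l) := by
  obtain ⟨W, i, hi, hi'⟩ := hD.exists_openSubobject A
    ⟨D.value f ⁻¹' Set.Ioo r s, isOpen_Ioo.preimage (continuous_value f)⟩
  obtain ⟨W₂, i₂, hi₂, hi₂'⟩ := hD.exists_openSubobject B
    ⟨D.value g ⁻¹' Set.Ioo r s, isOpen_Ioo.preimage (continuous_value g)⟩
  obtain ⟨Q, a, b, j, hQ, hj, hj', ej⟩ := hfZ.exists_of_isWeakOpen hi.isWeakOpen hi'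
  obtain ⟨Q₂, a₂, b₂, j₂, hQ₂, hj₂, hj₂', ej₂⟩ := hgZ.exists_of_isWeakOpen hi₂.isWeakOpen hi₂'
  obtain ⟨e, he, -, heb⟩ := hQ.exists_isEquivalence hQ₂
  have hv (x : D.space Q) : D.value b₂ (D.onSpace e x) = D.value b x := by
    rw [← value_comp, value_eq heb]
  -- Once the two models of `Z × ℝ` are identified by `e`, the two collars are open subobjects with
  -- the same image, hence equivalent over the line.
  obtain ⟨m, hm, hm'⟩ := (hj.comp (IsWeakOpen.of_isEquivalence D he)).exists_isEquivalence hj₂ (by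
    rw [hj₂', onSpace_comp, TopCat.coe_comp, Set.range_comp, hj']
    ext y
    constructor
    · rintro ⟨x, hx, rfl⟩
      rwa [Set.mem_preimage, hv]
    · intro hy
      obtain ⟨x, rfl⟩ := surjective_onSpace (D := D) he y
      exact ⟨x, by rwa [Set.mem_preimage, hv] at hy, rfl⟩)
  have comm : Homotopic (i ≫ f) ((m ≫ i₂) ≫ g) := by
    rw [Category.assoc]
    have h₁ := hm'.post b₂
    rw [Category.assoc, Category.assoc] at h₁
    exact ej.symm.trans ((heb.symm.pre j).trans (h₁.symm.trans (ej₂.pre m)))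
  have hr : Set.range (D.onSpace (m ≫ i₂)) = D.value g ⁻¹' Set.Ioo r s :=
    (range_equivalence_comp hm i₂).trans hi₂'
  have ho : D.IsWeakOpen (m ≫ i₂) := (IsWeakOpen.of_isEquivalence D hm).comp hi₂.isWeakOpen
  have : T2Space (D.space A) := (D.U.obj A).property.1
  have : T2Space (D.space B) := (D.U.obj B).property.1
  have hpush := IsPushout.of_hasPushout (D.onSpace i) (D.onSpace (m ≫ i₂))
  obtain ⟨P, k, l, hP⟩ := hD.exists_union i i₂ m hi hi₂ hm ⟨_, _, _, hpush,
    t2Space_of_isPushout hpush hi.1 ho.isOpenEmbedding (continuous_value f) (continuous_value g)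
      (fun w => by rw [← value_comp, ← value_comp, value_eq comm])
      -- A value common to `A` and `B` is below `s` and above `r`, so the point of `A` is in the
      -- overlap.
      (fun x y hxy => .inl (hi' ▸ ⟨hxy ▸ hg y, hf x⟩))⟩
  obtain ⟨η⟩ := hP.comm
  obtain ⟨h, hk, hl⟩ := (hD.union_isHomotopyPushout hP η).exists_desc comm
  have hkv (x : D.space A) : D.value h (D.onSpace k x) = D.value f x := by
    rw [← value_comp, value_eq hk]
  have hlv (y : D.space B) : D.value h (D.onSpace l y) = D.value g y := by
    rw [← value_comp, value_eq hl]
  have hw (w : D.space W) : D.onSpace k (D.onSpace i w) = D.onSpace l (D.onSpace (m ≫ i₂) w) :=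
    ConcreteCategory.congr_hom hP.isPushout.w w
  refine ⟨P, k, l, h, hP.inl.isWeakOpen, hP.inr.isWeakOpen, hk, hl, fun z hz => ?_,
    fun z hz => ?_⟩
  · rcases range_union_range_of_isPushout hP.isPushout z with ⟨x, rfl⟩ | ⟨y, rfl⟩
    · exact ⟨x, rfl⟩
    · obtain ⟨w, rfl⟩ : y ∈ Set.range (D.onSpace (m ≫ i₂)) := hr ▸ ⟨hg y, hlv y ▸ hz⟩
      exact ⟨_, hw w⟩
  · rcases range_union_range_of_isPushout hP.isPushout z with ⟨x, rfl⟩ | ⟨y, rfl⟩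
    · obtain ⟨w, rfl⟩ : x ∈ Set.range (D.onSpace i) := hi' ▸ ⟨hkv x ▸ hz, hf x⟩
      exact ⟨_, (hw w).symm⟩
    · exact ⟨y, rfl⟩

/-- The preimage of a compact subset under an open subobject which contains it. -/
lemma IsProper.isCompact_image {f : X ⟶ D.line} (hf : D.IsProper f) {l : A ⟶ X}
    (hl : D.IsWeakOpen l) {K : Set ℝ} (hK : _root_.IsCompact K)
    (h : D.value f ⁻¹' K ⊆ Set.range (D.onSpace l)) {g : A ⟶ D.line} (e : Homotopic (l ≫ f) g) :
    _root_.IsCompact (D.value g ⁻¹' K) := by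
  convert (hl.isOpenEmbedding.isInducing.isCompact_preimage_iff h).2 (hf K hK) using 1
  ext x
  rw [Set.mem_preimage, ← value_eq e, value_comp]
  rfl

lemma GoodForIntersectionTheory.derivedCobordant_trans (hD : D.GoodForIntersectionTheory)
    (h : D.DerivedCobordant Z Z') (h' : D.DerivedCobordant Z' Z₁) : D.DerivedCobordant Z Z₁ := by
  obtain ⟨X, f, hf, ⟨J, hJ, h0J, hfJ⟩, J', hJ', h1J, hfJ'⟩ := hD.derivedCobordant_iff.1 h
  obtain ⟨Y, g, hg, ⟨K, hK, h0K, hgK⟩, K', hK', h1K, hgK'⟩ := hD.derivedCobordant_iff.1 h'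
  have hθ : ContDiff ℝ ∞ fun t : ℝ => 1 + t := contDiff_const.add contDiff_id
  have hθ' : ContDiff ℝ ∞ fun t : ℝ => -1 + t := contDiff_const.add contDiff_id
  have e₁ (t : ℝ) : -1 + (1 + t) = t := by ring
  have e₂ (t : ℝ) : 1 + (-1 + t) = t := by ring
  replace hgK := hgK.reparam hθ hθ' e₁ e₂
  replace hgK' := hgK'.reparam hθ hθ' e₁ e₂
  replace hg := hg.reparam hθ hθ'.continuous e₁ e₂
  replace hK := hK.preimage hθ'.continuous
  replace hK' := hK'.preimage hθ'.continuous
  -- From here on `g` is the translate, with collars at `1` and `2`.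
  generalize g ≫ D.i.map (Man.fn (fun t => 1 + t) hθ) = g at hgK hgK' hg
  replace h0K : (1 : ℝ) ∈ (fun t : ℝ => -1 + t) ⁻¹' K := by simpa using h0K
  replace h1K : (2 : ℝ) ∈ (fun t : ℝ => -1 + t) ⁻¹' K' := by
    rw [Set.mem_preimage]
    norm_num
    exact h1K
  generalize (fun t : ℝ => -1 + t) ⁻¹' K = K at hK h0K hgK
  generalize (fun t : ℝ => -1 + t) ⁻¹' K' = K' at hK' h1K hgK'
  obtain ⟨ε, hε, hεJ⟩ := Metric.isOpen_iff.1 (hJ'.inter hK) 1 ⟨h1J, h0K⟩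
  rw [Real.ball_eq_Ioo] at hεJ
  -- The bound `1 / 2` keeps the outer levels `0` and `2` away from the overlap.
  obtain ⟨r, s, hr, hs, h0r, hr1, h1s, hs2⟩ :
      ∃ r s : ℝ, 1 - ε ≤ r ∧ s ≤ 1 + ε ∧ 0 < r ∧ r < 1 ∧ 1 < s ∧ s < 2 :=
    ⟨1 - min ε (1 / 2), 1 + min ε (1 / 2), by linarith [min_le_left ε (1 / 2)],
      by linarith [min_le_left ε (1 / 2)], by linarith [min_le_right ε (1 / 2)],
      by linarith [lt_min hε (by norm_num : (0 : ℝ) < 1 / 2)],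
      by linarith [lt_min hε (by norm_num : (0 : ℝ) < 1 / 2)],
      by linarith [min_le_right ε (1 / 2)]⟩
  have hrs : Set.Ioo r s ⊆ J' ∩ K := (Set.Ioo_subset_Ioo hr hs).trans hεJ
  obtain ⟨A, lA, hA, hA'⟩ := hD.exists_openSubobject X
    ⟨D.value f ⁻¹' Set.Iio s, isOpen_Iio.preimage (continuous_value f)⟩
  obtain ⟨B, lB, hB, hB'⟩ := hD.exists_openSubobject Y
    ⟨D.value g ⁻¹' Set.Ioi r, isOpen_Ioi.preimage (continuous_value g)⟩
  have hfA {S : Set ℝ} (hS : S ⊆ Set.Iio s) :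
      D.value f ⁻¹' S ⊆ Set.range (D.onSpace lA) := hA' ▸ Set.preimage_mono hS
  have hgB {S : Set ℝ} (hS : S ⊆ Set.Ioi r) :
      D.value g ⁻¹' S ⊆ Set.range (D.onSpace lB) := hB' ▸ Set.preimage_mono hS
  obtain ⟨P, k, l, h, hk, hl, hkf, hlg, hks, hlr⟩ := hD.exists_glue (f := lA ≫ f) (g := lB ≫ g)
    (r := r) (s := s) (fun x => by
      have : D.onSpace lA x ∈ D.value f ⁻¹' Set.Iio s := hA'.subset ⟨x, rfl⟩
      rwa [value_comp])
    (fun y => by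
      have : D.onSpace lB y ∈ D.value g ⁻¹' Set.Ioi r := hB'.subset ⟨y, rfl⟩
      rwa [value_comp])
    ((hfJ'.shrink hD isOpen_Ioo (hrs.trans Set.inter_subset_left)).restrict hD isOpen_Ioo
      hA.isWeakOpen (hfA Set.Ioo_subset_Iio_self))
    ((hgK.shrink hD isOpen_Ioo (hrs.trans Set.inter_subset_right)).restrict hD isOpen_Ioo
      hB.isWeakOpen (hgB Set.Ioo_subset_Ioi_self))
  have hJr := hJ.inter (isOpen_Iio (a := r))
  have hKs := hK'.inter (isOpen_Ioi (a := s))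
  have hrs' : r < s := hr1.trans h1s
  have c₀ : D.HasCollar h (J ∩ Set.Iio r) Z :=
    (((hfJ.shrink hD hJr Set.inter_subset_left).restrict hD hJr hA.isWeakOpen
      (hfA fun t ht => lt_trans ht.2 hrs')).congr hkf.symm).of_open hk
        fun z hz => hks z (lt_trans hz.2 hrs')
  have c₂ : D.HasCollar h (K' ∩ Set.Ioi s) Z₁ :=
    (((hgK'.shrink hD hKs Set.inter_subset_left).restrict hD hKs hB.isWeakOpen
      (hgB fun t ht => lt_trans hrs' ht.2)).congr hlg.symm).of_open hl
        fun z hz => hlr z (lt_trans hrs' hz.2)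
  -- The pieces need not be proper over the line near their cut ends. Cutting `S` at `1`, strictly
  -- between `r` and `s`, leaves levels whose preimages in `X` and in `Y` lie entirely in the
  -- pieces.
  have hh : D.IsProper h := fun (S : Set ℝ) (hS : _root_.IsCompact S) => by
    have h₁ := (hf.isCompact_image hA.isWeakOpen (hS.inter_right (isClosed_Iic (a := 1)))
      (hfA fun t ht => lt_of_le_of_lt ht.2 h1s) (.refl _)).image (D.onSpace k).hom.continuous
    have h₂ := (hg.isCompact_image hB.isWeakOpen (hS.inter_right (isClosed_Ici (a := 1)))
      (hgB fun t ht => lt_of_lt_of_le hr1 ht.2) (.refl _)).image (D.onSpace l).hom.continuous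
    convert h₁.union h₂ using 1
    change D.value h ⁻¹' S = _
    ext z
    constructor
    · intro hz
      rcases le_total (D.value h z) 1 with hz' | hz'
      · obtain ⟨x, rfl⟩ := hks z (lt_of_le_of_lt hz' h1s)
        rw [Set.mem_preimage] at hz
        rw [← value_comp, value_eq hkf] at hz hz'
        exact .inl ⟨x, ⟨hz, hz'⟩, rfl⟩
      · obtain ⟨y, rfl⟩ := hlr z (lt_of_lt_of_le hr1 hz')
        rw [Set.mem_preimage] at hz
        rw [← value_comp, value_eq hlg] at hz hz'
        exact .inr ⟨y, ⟨hz, hz'⟩, rfl⟩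
    · rintro (⟨x, hx, rfl⟩ | ⟨y, hy, rfl⟩)
      · have := hx.1
        rw [← value_eq hkf, value_comp] at this
        exact this
      · have := hy.1
        rw [← value_eq hlg, value_comp] at this
        exact this
  -- Rescaling moves the outer collar from the level `2` to `1`.
  have hρ : ContDiff ℝ ∞ fun t : ℝ => t / 2 := contDiff_id.div_const 2
  have hρ' : ContDiff ℝ ∞ fun t : ℝ => 2 * t := contDiff_const.mul contDiff_id
  have e₃ (t : ℝ) : 2 * (t / 2) = t := by ring
  have e₄ (t : ℝ) : 2 * t / 2 = t := by ring
  refine hD.derivedCobordant_iff.2 ⟨P, _, hh.reparam hρ hρ'.continuous e₃ e₄,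
    ⟨_, hJr.preimage hρ'.continuous, ?_, c₀.reparam hρ hρ' e₃ e₄⟩,
    _, hKs.preimage hρ'.continuous, ?_, c₂.reparam hρ hρ' e₃ e₄⟩
  · rw [Set.mem_preimage, mul_zero]
    exact ⟨h0J, h0r⟩
  · rw [Set.mem_preimage, mul_one]
    exact ⟨h1K, hs2⟩

end GeometricStructure

end DerivedCobordism

end

theorem proposition3p10 {C : Type u} [Category.{v} C] [SimplicialCategory C]
    (D : DerivedCobordism.GeometricStructure C) (hD : D.GoodForIntersectionTheory) :
    _root_.Equivalence fun Z₀ Z₁ : {Z : C // D.IsCompact Z} => D.DerivedCobordant Z₀.1 Z₁.1 := by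
  have := D.kan
  exact ⟨fun Z => hD.derivedCobordant_refl Z.2, hD.derivedCobordant_symm, hD.derivedCobordant_trans⟩
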